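/- Let $a<b$ and let $X=\{X(t):t\in[a,b]\}$ be a jointly measurable stochastic process with mean function $\mu(t)=\mathbb E X(t)$. Let $X_1,X_2,\dots$ be independent realizations of $X$, let $T_{ij}$ ($i,j\ge1$) be random times with density $f_T$ on $[a,b]$, and let $U_{ij}$ ($i,j\ge 1$) be identically distributed random errors with mean zero and finite variance; all $X_i$, $T_{ij}$, $U_{ij}$ are independent. Put $Y_{ij}=X_i(T_{ij})+U_{ij}$. For each $n$ one observes $(T_{ij},Y_{ij})$ for $1\le i\le n$, $1\le j\le m_i$, where the integers $m_i=m_{in}\ge 2$ are deterministic and may depend on $n$. Given a kernel $K$ and bandwidths $h_\mu=h_{\mu,n}>0$, let $K_h(x)=h^{-1}K(x/h)$ and let $\widehat\mu(t)=\widehat a_0$ be the local-linear estimator, where $$(\widehat a_0,\widehat a_1)\in\mathop{\arg\min}_{a_0,a_1}\ \frac1n\sum_{i=1}^n\frac1{m_i}\sum_{j=1}^{m_i}\{Y_{ij}-a_0-a_1(T_{ij}-t)\}^2K_{h_\mu}(T_{ij}-t)$$ (any minimizer may be chosen where it is not unique). Let $\gamma_{n1}=\bigl(n^{-1}\sum_{i=1}^n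 m_i^{-1}\bigr)^{-1}$. Assume: (i) there are constants $0<m_T\le M_T<\infty$ with $m_T\le f_T\le M_T$ on $[a,b]$, and $f_T$ is differentiable on $[a,b]$ with bounded derivative; (ii) $K$ is a symmetric probability density on $[-1,1]$, of bounded variation on $[-1,1]$; (iii) $\mu$ is twice differentiable on $[a,b]$ with bounded second derivative; (iv) for some $\lambda\in(2,\infty)$, $\mathbb E|U_{ij}|^{\lambda}<\infty$ and $\mathbb E\bigl(\sup_{t\in[a,b]}|X(t)|^{\lambda}\bigr)<\infty$, and, as $n\to\infty$, $h_\mu\to0$ and $(h_\mu^2+h_\mu/\gamma_{n1})^{-1}(\log n/n)^{1-2/\lambda}\to0$. Then the following hold as $n\to\infty$. (a) If $\max_{1\le i\le n}m_i\le M$ for all $n$ and some fixed $M$, then $$\sup_{t\in[a,b]}|\widehat\mu(t)-\mu(t)|=O\bigl(h_\mu^2+\{\log n/(nh_\mu)\}^{1/2}\bigr)\quad\text{a.s.}$$ (b) If $\min_{1\le i\le n}m_i\ge M_n$ for all $n$ and some sequence $M_n>0$ with $M_n^{-1}=O(h_\mu)$ and $h_\mu=O\bigl((\log n/n)^{1/4}\bigr)$,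 then $$\sup_{t\in[a,b]}|\widehat\mu(t)-\mu(t)|=O\bigl(\{\log n/n\}^{1/2}\bigr)\quad\text{a.s.}$$ -/

import Mathlib

open MeasureTheory ProbabilityTheory Filter Topology Asymptotics
open scoped ENNReal

namespace FunctionalData

/-- The data model. `X ξ t` is the value at time `t` of the sample path `ξ` of a stochastic process
with sample space `(Ξ, Q)`; only times `t ∈ [a, b]` matter. The `i`-th curve is `X (ζ i ω)`, where
the `ζ i` are independent draws from `Q`, so that the curves are independent realizations of `X`.
The observation times `T i j` have density `fT` on `[a, b]`, and the errors `U i j` are identically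
distributed with mean zero and finite variance. All of these are independent. The data available
at stage `n` are the entries `i < n`, `j < m n i` of these arrays. -/
structure IsModel {Ω Ξ : Type*} [MeasurableSpace Ω] [MeasurableSpace Ξ]
    (P : Measure Ω) (Q : Measure Ξ) (a b : ℝ) (X : Ξ → ℝ → ℝ) (ζ : ℕ → Ω → Ξ)
    (fT : ℝ → ℝ) (T U : ℕ → ℕ → Ω → ℝ) (m : ℕ → ℕ → ℕ) : Prop where
  lt : a < b
  measurable_process : Measurable (Function.uncurry X)
  realization : ∀ i, MeasurePreserving (ζ i) P Q
  measurable_time : ∀ i j, Measurable (T i j)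
  law_time : ∀ i j, P.map (T i j) =
    (volume.restrict (Set.Icc a b)).withDensity (fun t => ENNReal.ofReal (fT t))
  measurable_error : ∀ i j, Measurable (U i j)
  identDistrib_error : ∀ i j, IdentDistrib (U i j) (U 0 0) P P
  memLp_error : ∀ i j, MemLp (U i j) 2 P
  mean_error : ∀ i j, ∫ ω, U i j ω ∂P = 0
  independent : iIndep
    (Sum.elim (fun i : ℕ => MeasurableSpace.comap (ζ i) inferInstance)
      (Sum.elim (fun p : ℕ × ℕ => MeasurableSpace.comap (T p.1 p.2) inferInstance)
        (fun p : ℕ × ℕ => MeasurableSpace.comap (U p.1 p.2) inferInstance))) P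
  two_le : ∀ n i, i < n → 2 ≤ m n i

/-- The mean function `μ(t) = E X(t)`. -/
noncomputable def meanFun {Ξ : Type*} [MeasurableSpace Ξ] (Q : Measure Ξ) (X : Ξ → ℝ → ℝ)
    (t : ℝ) : ℝ :=
  ∫ ξ, X ξ t ∂Q

/-- The observations `Y i j = X_i (T i j) + U i j`. -/
def obs {Ω Ξ : Type*} (X : Ξ → ℝ → ℝ) (ζ : ℕ → Ω → Ξ) (T U : ℕ → ℕ → Ω → ℝ)
    (i j : ℕ) (ω : Ω) : ℝ :=
  X (ζ i ω) (T i j ω) + U i j ω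

/-- The rescaled kernel `K_h(x) = K(x / h) / h`. -/
noncomputable def scaledKernel (K : ℝ → ℝ) (h x : ℝ) : ℝ := h⁻¹ * K (x / h)

/-- The weighted least squares criterion of the local-linear smoother at `t`, computed from the
first `n` curves with `m i` observations on curve `i`, at one outcome (times `T`, responses `Y`). -/
noncomputable def criterion (K : ℝ → ℝ) (h : ℝ) (n : ℕ) (m : ℕ → ℕ) (T Y : ℕ → ℕ → ℝ) (t : ℝ)
    (c : ℝ × ℝ) : ℝ :=
  (n : ℝ)⁻¹ * ∑ i ∈ Finset.range n, (m i : ℝ)⁻¹ * ∑ j ∈ Finset.range (m i),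
    (Y i j - c.1 - c.2 * (T i j - t)) ^ 2 * scaledKernel K h (T i j - t)

/-- `μhat n ω t` is the local-linear estimator: the intercept of a minimizer of the criterion at
every `t ∈ [a, b]`. Where the minimizer is not unique, any choice is admitted. -/
def IsLocalLinearEstimator {Ω : Type*} (a b : ℝ) (K : ℝ → ℝ) (h : ℕ → ℝ) (m : ℕ → ℕ → ℕ)
    (T Y : ℕ → ℕ → Ω → ℝ) (μhat : ℕ → Ω → ℝ → ℝ) : Prop :=
  ∀ n ω, ∀ t ∈ Set.Icc a b, ∃ a₁ : ℝ,
    IsMinOn (criterion K (h n) n (m n) (fun i j => T i j ω) (fun i j => Y i j ω) t)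
      Set.univ (μhat n ω t, a₁)

/-- The density of the observation times is bounded away from `0` and `∞` on `[a, b]` and
differentiable there with bounded derivative (one-sided at the endpoints). -/
def DensityCondition (a b : ℝ) (fT : ℝ → ℝ) : Prop :=
  (∃ c C : ℝ, 0 < c ∧ ∀ t ∈ Set.Icc a b, c ≤ fT t ∧ fT t ≤ C) ∧
  DifferentiableOn ℝ fT (Set.Icc a b) ∧
  ∃ D : ℝ, ∀ t ∈ Set.Icc a b, |derivWithin fT (Set.Icc a b) t| ≤ D

/-- `K` is a symmetric probability density on `[-1, 1]`, of bounded variation there. -/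
structure KernelCondition (K : ℝ → ℝ) : Prop where
  nonneg : ∀ x, 0 ≤ K x
  symm : ∀ x, K (-x) = K x
  support : ∀ x, x ∉ Set.Icc (-1 : ℝ) 1 → K x = 0
  integral_eq_one : ∫ x, K x = 1
  boundedVariation : BoundedVariationOn K (Set.Icc (-1) 1)

/-- `μ` is twice differentiable on `[a, b]` (one-sided at the endpoints) with bounded second
derivative. -/
def MeanCondition (a b : ℝ) (μ : ℝ → ℝ) : Prop :=
  DifferentiableOn ℝ μ (Set.Icc a b) ∧
  DifferentiableOn ℝ (derivWithin μ (Set.Icc a b)) (Set.Icc a b) ∧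
  ∃ D : ℝ, ∀ t ∈ Set.Icc a b,
    |derivWithin (derivWithin μ (Set.Icc a b)) (Set.Icc a b) t| ≤ D

/-- The harmonic mean `(n⁻¹ ∑_{i < n} 1 / m i)⁻¹` of the numbers of observations per curve. -/
noncomputable def harmonicMean (n : ℕ) (m : ℕ → ℕ) : ℝ :=
  ((n : ℝ)⁻¹ * ∑ i ∈ Finset.range n, (m i : ℝ)⁻¹)⁻¹

/-- The moment condition: `E |U|^p < ∞` and `E (sup_{t ∈ [a, b]} |X(t)|^p) < ∞`. -/
structure MomentCondition {Ω Ξ : Type*} [MeasurableSpace Ω] [MeasurableSpace Ξ]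
    (P : Measure Ω) (Q : Measure Ξ) (a b : ℝ) (X : Ξ → ℝ → ℝ) (U : ℕ → ℕ → Ω → ℝ)
    (p : ℝ) : Prop where
  error : ∀ i j, ∫⁻ ω, ‖U i j ω‖ₑ ^ p ∂P < ∞
  aemeasurable_sup : AEMeasurable (fun ξ => ⨆ t ∈ Set.Icc a b, ‖X ξ t‖ₑ ^ p) Q
  process : ∫⁻ ξ, ⨆ t ∈ Set.Icc a b, ‖X ξ t‖ₑ ^ p ∂Q < ∞

/-- The bandwidth condition: `h n > 0`, `h → 0` and
`(h² + h / γ)⁻¹ (log n / n)^{1 - 2/p} → 0`, with `γ` the harmonic mean of the `m n i`. -/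
structure BandwidthCondition (h : ℕ → ℝ) (m : ℕ → ℕ → ℕ) (p : ℝ) : Prop where
  pos : ∀ n, 0 < h n
  tendsto_zero : Tendsto h atTop (𝓝 0)
  rate : Tendsto (fun n : ℕ => (h n ^ 2 + h n / harmonicMean n (m n))⁻¹ *
    (Real.log n / n) ^ (1 - 2 / p)) atTop (𝓝 0)

/-- `sup_{t ∈ [a, b]} |μhat n ω t - μ t| = O(r n)` as `n → ∞`, for almost every `ω`. The supremum
is taken in `[0, ∞]`. -/
def UniformRateAS {Ω : Type*} [MeasurableSpace Ω] (P : Measure Ω) (a b : ℝ)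
    (μhat : ℕ → Ω → ℝ → ℝ) (μ : ℝ → ℝ) (r : ℕ → ℝ) : Prop :=
  ∀ᵐ ω ∂P, ∃ C : ℝ, ∀ᶠ n in atTop,
    ⨆ t ∈ Set.Icc a b, ‖μhat n ω t - μ t‖ₑ ≤ ENNReal.ofReal (C * r n)

end FunctionalData

/-!
Write `γ` for the harmonic mean of the numbers of observations per curve, `L = log n`,
`g = h² + h / γ` (up to constants the variance of the empirical mass of a window of width `h`,
called `spread`) and `A = √(L g / n)` (`devRate`). The local-linear estimator satisfies
`sup_t |μhat t - μ t| = O(h² + A / h)` almost surely, from which both rates follow: if the `m i` are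
bounded then `g = O(h)`, and if `1 / m i = O(h)` then `g = O(h²)`.

*Reduction to interval masses.* The normal equations bound the error of the intercept by two
weighted moments of the residuals of the tangent line of `μ` at `t`, provided the quadratic form of
the kernel-weighted design is uniformly positive definite (`abs_intercept_sub_le`). For the law of
the times this holds because one half of every window lies in `[a, b]` (`exists_design_form`).
Taylor's formula bounds the bias by `h²`. The remaining terms are sums of `K(u) u ^ r` against the
points `T i j`, weighted by `1`, by `X_i(T i j) - μ(T i j)` or by `U i j`. A function of bounded
variation is a difference of monotone functions, whose superlevel sets are intervals, so all these
sums are controlled by the same sums over the intervals contained in the window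
(`exists_abs_sum_sub_integral_le`, `exists_abs_localLinear_sub_le`).

*Uniform deviations.* For nonnegative terms truncated at a level of order `n A / L`, Bernstein's
inequality on the grid of mesh `1 / n`, monotonicity in the interval between grid points, and
Borel–Cantelli show that the sums over all intervals in all windows deviate from their expectations
by `O(A)` (`exists_ae_eventually_abs_sum_sub_le`). For design and curves the independent blocks are
the curves, for the errors they are the single observations.

*Truncation.* With the level `Q = n A / L`, the bandwidth condition says that
`Q ^ (1 - p) = O(A)`. What truncation removes from the curves is at most `Q ^ (1 - p)` times the
average of the `p`-th powers of their envelopes, which converges by the strong law of large numbers.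
For the errors the same works if the `m i` are bounded. If they are not, the averages of
`|U i j| ^ p` form a triangular array to which the strong law need not apply; but then the
assumptions of the dense case force `p > 4`, and Borel–Cantelli over the pairs `(i, j)`, with
`|U i j| ≤ C ((i + 1) (j + 1)) ^ (1 / 4)`, shows that from some `n` on no error is truncated at all
(`IsModel.ae_errorExcess_le_of_dense`).
-/

namespace FunctionalData

/-! ### Functions of bounded variation as mixtures of interval indicators -/

theorem integral_eq_integral_Ioc_measureReal_lt {α : Type*} [MeasurableSpace α] (ν : Measure α)
    [IsFiniteMeasure ν] {f : α → ℝ} {c : ℝ} (hf : Measurable f) (hf0 : ∀ x, 0 ≤ f x)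
    (hfc : ∀ x, f x ≤ c) :
    ∫ x, f x ∂ν = ∫ s in Set.Ioc 0 c, ν.real {x | s < f x} := by
  have hint : Integrable f ν := by
    refine Integrable.of_bound hf.aestronglyMeasurable c (ae_of_all _ fun x => ?_)
    rw [Real.norm_of_nonneg (hf0 x)]; exact hfc x
  rw [hint.integral_eq_integral_meas_lt (ae_of_all _ hf0)]
  refine setIntegral_eq_of_subset_of_forall_sdiff_eq_zero measurableSet_Ioi
    Set.Ioc_subset_Ioi_self fun s hs => ?_
  have : {x | s < f x} = ∅ := by
    ext x
    simp only [Set.mem_ofPred_eq, Set.mem_empty_iff_false, iff_false, not_lt]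
    by_contra! h
    exact hs.2 ⟨hs.1, (h.le.trans (hfc x))⟩
  simp [this]

theorem integrableOn_measureReal_lt {α : Type*} [MeasurableSpace α] (ν : Measure α)
    [IsFiniteMeasure ν] (f : α → ℝ) (c : ℝ) :
    IntegrableOn (fun s => ν.real {x | s < f x}) (Set.Ioc 0 c) := by
  have hanti : Antitone (fun s => ν.real {x | s < f x}) := fun s s' hs =>
    measureReal_mono (fun x hx => lt_of_le_of_lt hs hx)
  exact (hanti.antitoneOn _).integrableOn_isCompact isCompact_Icc |>.mono_set Set.Ioc_subset_Icc_self

/-- A signed combination of point masses that is uniformly close to `ν` on the superlevel sets of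
`f` is close to `ν` on `f`: both sides are integrals over the levels of `f`. -/
theorem abs_sum_sub_integral_le_of_superlevel {ι : Type*} (S : Finset ι) (w x : ι → ℝ)
    (ν : Measure ℝ) [IsFiniteMeasure ν] {f : ℝ → ℝ} {c ε : ℝ} (hc : 0 ≤ c) (hf : Measurable f)
    (hf0 : ∀ x, 0 ≤ f x) (hfc : ∀ x, f x ≤ c)
    (hε : ∀ s, 0 ≤ s →
      |∑ i ∈ S, w i * {y | s < f y}.indicator 1 (x i) - ν.real {y | s < f y}| ≤ ε) :
    |∑ i ∈ S, w i * f (x i) - ∫ y, f y ∂ν| ≤ c * ε := by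
  have hdirac : ∀ i, f (x i) = ∫ s in Set.Ioc 0 c, (Measure.dirac (x i)).real {y | s < f y} := by
    intro i
    rw [← integral_eq_integral_Ioc_measureReal_lt _ hf hf0 hfc, integral_dirac]
  have hms : ∀ s, MeasurableSet {y | s < f y} := fun s => measurableSet_lt measurable_const hf
  have hval : ∀ i s, (Measure.dirac (x i)).real {y | s < f y} =
      {y | s < f y}.indicator 1 (x i) := by
    intro i s
    rw [measureReal_def, Measure.dirac_apply' _ (hms s)]
    by_cases hx : x i ∈ {y | s < f y} <;> simp [hx]
  have hint : ∀ i, IntegrableOn (fun s => (Measure.dirac (x i)).real {y | s < f y})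
      (Set.Ioc 0 c) := fun i => integrableOn_measureReal_lt _ f c
  have key : ∑ i ∈ S, w i * f (x i) - ∫ y, f y ∂ν = ∫ s in Set.Ioc 0 c,
      (∑ i ∈ S, w i * (Measure.dirac (x i)).real {y | s < f y} - ν.real {y | s < f y}) := by
    rw [integral_sub (integrable_finsetSum _ fun i _ => (hint i).const_mul _)
      (integrableOn_measureReal_lt ν f c), integral_finsetSum _ fun i _ => (hint i).const_mul _,
      integral_eq_integral_Ioc_measureReal_lt ν hf hf0 hfc]
    congr 1
    refine Finset.sum_congr rfl fun i _ => ?_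
    rw [integral_const_mul, ← hdirac]
  rw [key, ← Real.norm_eq_abs]
  refine (norm_setIntegral_le_of_norm_le_const (C := ε) (by simp) fun s hs => ?_).trans ?_
  · simp only [hval]
    exact hε s hs.1.le
  · simp [hc, mul_comm]

/-- For `g` of bounded variation on its support `[-1, 1]`, discrepancies on `g ((· - t) / h)` are
controlled by the discrepancies on the intervals inside `[t - h, t + h]`: up to a constant, `g` is
a difference of increasing functions on `[-1, 1]`, whose superlevel sets are intervals. -/
theorem exists_abs_sum_sub_integral_le {g : ℝ → ℝ} (hg : BoundedVariationOn g (Set.Icc (-1) 1))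
    (hsupp : ∀ x, x ∉ Set.Icc (-1 : ℝ) 1 → g x = 0) :
    ∃ C : ℝ, 0 ≤ C ∧ ∀ {ι : Type} (S : Finset ι) (w x : ι → ℝ) (ν : Measure ℝ) (t h ε : ℝ),
      IsFiniteMeasure ν → 0 < h →
      (∀ I : Set ℝ, I.OrdConnected → I ⊆ Set.Icc (t - h) (t + h) →
        |∑ i ∈ S, w i * I.indicator 1 (x i) - ν.real I| ≤ ε) →
      Integrable (fun y => g ((y - t) / h)) ν ∧
        |∑ i ∈ S, w i * g ((x i - t) / h) - ∫ y, g ((y - t) / h) ∂ν| ≤ C * ε := by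
  obtain ⟨p, q, hp, hq, hpq⟩ :=
    hg.locallyBoundedVariationOn.exists_monotoneOn_sub_monotoneOn
  have hm1 : (-1 : ℝ) ∈ Set.Icc (-1 : ℝ) 1 := by norm_num
  have h1 : (1 : ℝ) ∈ Set.Icc (-1 : ℝ) 1 := by norm_num
  have hp1 : p (-1) ≤ p 1 := hp hm1 h1 (by norm_num)
  have hq1 : q (-1) ≤ q 1 := hq hm1 h1 (by norm_num)
  refine ⟨(p 1 - p (-1)) + (q 1 - q (-1)) + |p (-1) - q (-1)|,
    add_nonneg (by linarith) (abs_nonneg _), ?_⟩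
  intro ι S w x ν t h ε hν hh hI
  have hwin : ∀ y, (y - t) / h ∈ Set.Icc (-1 : ℝ) 1 ↔ y ∈ Set.Icc (t - h) (t + h) := by
    intro y
    simp only [Set.mem_Icc, le_div_iff₀ hh, div_le_iff₀ hh]
    constructor <;> rintro ⟨_, _⟩ <;> constructor <;> linarith
  -- the increasing function `r`, recentred to vanish at `-1` and cut off outside `[-1, 1]`
  let F : (ℝ → ℝ) → ℝ → ℝ := fun r =>
    (Set.Icc (t - h) (t + h)).indicator (fun y => r ((y - t) / h) - r (-1))
  have hlev : ∀ r : ℝ → ℝ, MonotoneOn r (Set.Icc (-1) 1) → ∀ s, 0 ≤ s →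
      {y | s < F r y}.OrdConnected ∧ {y | s < F r y} ⊆ Set.Icc (t - h) (t + h) := by
    intro r hr s hs
    have hsub : {y | s < F r y} ⊆ Set.Icc (t - h) (t + h) := by
      intro y hy
      by_contra hn
      simp only [Set.mem_ofPred_eq, F, Set.indicator_of_notMem hn] at hy
      linarith
    refine ⟨⟨fun y hy z hz v hv => ?_⟩, hsub⟩
    have hyw := hsub hy
    have hvw : v ∈ Set.Icc (t - h) (t + h) :=
      ⟨hyw.1.trans hv.1, hv.2.trans (hsub hz).2⟩
    simp only [Set.mem_ofPred_eq, F, Set.indicator_of_mem hyw, Set.indicator_of_mem hvw] at hy ⊢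
    have := hr ((hwin y).2 hyw) ((hwin v).2 hvw) (by gcongr; exact hv.1)
    linarith
  have hF0 : ∀ r : ℝ → ℝ, MonotoneOn r (Set.Icc (-1) 1) → ∀ y, 0 ≤ F r y := by
    intro r hr y
    refine Set.indicator_nonneg (fun y hy => ?_) y
    have := hr hm1 ((hwin y).2 hy) ((hwin y).2 hy).1
    linarith
  have hFc : ∀ r : ℝ → ℝ, MonotoneOn r (Set.Icc (-1) 1) → ∀ y, F r y ≤ r 1 - r (-1) := by
    intro r hr y
    have h11 := hr hm1 h1 (by norm_num)
    simp only [F, Set.indicator_apply]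
    split_ifs with hy
    swap
    · linarith
    have := hr ((hwin y).2 hy) h1 ((hwin y).2 hy).2
    linarith
  have hFm : ∀ r : ℝ → ℝ, MonotoneOn r (Set.Icc (-1) 1) → Measurable (F r) := by
    intro r hr
    refine measurable_of_Ioi fun s => ?_
    by_cases hs : 0 ≤ s
    · exact (hlev r hr s hs).1.measurableSet
    · have : F r ⁻¹' Set.Ioi s = Set.univ := by
        ext y
        simp only [Set.mem_preimage, Set.mem_Ioi, Set.mem_univ, iff_true]
        exact lt_of_lt_of_le (not_le.1 hs) (hF0 r hr y)
      rw [this]; exact MeasurableSet.univ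
  have hFb : ∀ r : ℝ → ℝ, MonotoneOn r (Set.Icc (-1) 1) →
      |∑ i ∈ S, w i * F r (x i) - ∫ y, F r y ∂ν| ≤ (r 1 - r (-1)) * ε := by
    intro r hr
    refine abs_sum_sub_integral_le_of_superlevel S w x ν ?_ (hFm r hr) (hF0 r hr) (hFc r hr)
      fun s hs => hI _ (hlev r hr s hs).1 (hlev r hr s hs).2
    have := hr hm1 h1 (by norm_num)
    linarith
  have hFi : ∀ r : ℝ → ℝ, MonotoneOn r (Set.Icc (-1) 1) → Integrable (F r) ν := by
    intro r hr
    refine Integrable.of_bound (hFm r hr).aestronglyMeasurable (r 1 - r (-1))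
      (ae_of_all _ fun y => ?_)
    rw [Real.norm_of_nonneg (hF0 r hr y)]; exact hFc r hr y
  have hdec : ∀ y, g ((y - t) / h) = F p y - F q y +
      (p (-1) - q (-1)) * (Set.Icc (t - h) (t + h)).indicator 1 y := by
    intro y
    by_cases hy : y ∈ Set.Icc (t - h) (t + h)
    · simp only [F, Set.indicator_of_mem hy, hpq, Pi.sub_apply, Pi.one_apply]; ring
    · simp only [F, Set.indicator_of_notMem hy, hsupp _ (fun h' => hy ((hwin y).1 h'))]; ring
  have hind : Integrable ((Set.Icc (t - h) (t + h)).indicator (1 : ℝ → ℝ)) ν :=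
    (integrable_const (1 : ℝ)).indicator measurableSet_Icc
  have hsum : ∑ i ∈ S, w i * g ((x i - t) / h) - ∫ y, g ((y - t) / h) ∂ν =
      (∑ i ∈ S, w i * F p (x i) - ∫ y, F p y ∂ν) - (∑ i ∈ S, w i * F q (x i) - ∫ y, F q y ∂ν) +
      (p (-1) - q (-1)) * (∑ i ∈ S, w i * (Set.Icc (t - h) (t + h)).indicator 1 (x i) -
        ν.real (Set.Icc (t - h) (t + h))) := by
    have e1 : ∫ y, g ((y - t) / h) ∂ν = ∫ y, F p y ∂ν - ∫ y, F q y ∂ν +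
        (p (-1) - q (-1)) * ν.real (Set.Icc (t - h) (t + h)) := by
      simp_rw [hdec]
      rw [integral_add (f := fun y => F p y - F q y) ((hFi p hp).sub (hFi q hq)) (hind.const_mul _),
        integral_sub (hFi p hp) (hFi q hq), integral_const_mul,
        integral_indicator_one measurableSet_Icc]
    rw [e1]
    simp_rw [hdec, mul_add, mul_sub, Finset.sum_add_distrib, Finset.sum_sub_distrib, Finset.mul_sum]
    have : ∀ i, w i * ((p (-1) - q (-1)) * (Set.Icc (t - h) (t + h)).indicator 1 (x i)) =
      (p (-1) - q (-1)) * (w i * (Set.Icc (t - h) (t + h)).indicator 1 (x i)) := fun i => by ring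
    simp_rw [this]; ring
  refine ⟨?_, ?_⟩
  · simp_rw [hdec]
    exact ((hFi p hp).sub (hFi q hq)).add (hind.const_mul _)
  rw [hsum]
  refine (abs_add_le _ _).trans ?_
  rw [add_mul, add_mul, abs_mul]
  refine add_le_add ((abs_sub _ _).trans (add_le_add (hFb p hp) (hFb q hq))) ?_
  gcongr
  exact hI _ Set.ordConnected_Icc subset_rfl

/-! ### Weighted least squares on a line -/

theorem normal_equations_of_isMin {ι : Type*} (S : Finset ι) (w x y : ι → ℝ) (a₀ a₁ : ℝ)
    (hmin : ∀ c₀ c₁ : ℝ, ∑ i ∈ S, w i * (y i - a₀ - a₁ * x i) ^ 2 ≤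
      ∑ i ∈ S, w i * (y i - c₀ - c₁ * x i) ^ 2) :
    ∑ i ∈ S, w i * (y i - a₀ - a₁ * x i) = 0 ∧
      ∑ i ∈ S, w i * (y i - a₀ - a₁ * x i) * x i = 0 := by
  -- a parabola `s² B - 2 s A` that is nonnegative for every `s` has `A = 0`
  have key : ∀ A B : ℝ, (∀ s : ℝ, 0 ≤ s ^ 2 * B - 2 * s * A) → A = 0 := by
    intro A B H
    by_contra hA
    have h1 := H (A / (|B| + 1))
    have hB : 0 < |B| + 1 := by positivity
    have h2 : (A / (|B| + 1)) ^ 2 * B - 2 * (A / (|B| + 1)) * A =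
        A ^ 2 / (|B| + 1) ^ 2 * (B - 2 * (|B| + 1)) := by field_simp
    rw [h2] at h1
    have h3 : 0 < A ^ 2 / (|B| + 1) ^ 2 := by positivity
    have h4 : B - 2 * (|B| + 1) < 0 := by
      have := le_abs_self B
      have := abs_nonneg B
      linarith
    linarith [mul_neg_of_pos_of_neg h3 h4]
  constructor
  · refine key _ (∑ i ∈ S, w i) fun s => ?_
    have := hmin (a₀ + s) a₁
    rw [← sub_nonneg, ← Finset.sum_sub_distrib] at this
    rw [Finset.mul_sum, Finset.mul_sum, ← Finset.sum_sub_distrib]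
    refine this.trans_eq (Finset.sum_congr rfl fun i _ => ?_)
    ring
  · refine key _ (∑ i ∈ S, w i * x i ^ 2) fun s => ?_
    have := hmin a₀ (a₁ + s)
    rw [← sub_nonneg, ← Finset.sum_sub_distrib] at this
    rw [Finset.mul_sum, Finset.mul_sum, ← Finset.sum_sub_distrib]
    refine this.trans_eq (Finset.sum_congr rfl fun i _ => ?_)
    ring

/-- If the design is nondegenerate, in the sense that its quadratic form is at least `l` times the
Euclidean one, then the intercept of a weighted least squares line differs from any proposed
intercept `c₀` by no more than the weighted moments of the residuals of the proposed line. -/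
theorem abs_intercept_sub_le {ι : Type*} (S : Finset ι) (w u y : ι → ℝ) {h l : ℝ} (hh : h ≠ 0)
    (hl : 0 < l) (a₀ a₁ c₀ c₁ : ℝ)
    (hmin : ∀ d₀ d₁ : ℝ, ∑ i ∈ S, w i * (y i - a₀ - a₁ * (h * u i)) ^ 2 ≤
      ∑ i ∈ S, w i * (y i - d₀ - d₁ * (h * u i)) ^ 2)
    (hform : ∀ α β : ℝ, l * (α ^ 2 + β ^ 2) ≤ ∑ i ∈ S, w i * (α + β * u i) ^ 2) :
    |a₀ - c₀| ≤ (|∑ i ∈ S, w i * (y i - c₀ - c₁ * (h * u i))| +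
      |∑ i ∈ S, w i * u i * (y i - c₀ - c₁ * (h * u i))|) / l := by
  obtain ⟨h0, h1⟩ := normal_equations_of_isMin S w (fun i => h * u i) y a₀ a₁ hmin
  have h1' : ∑ i ∈ S, w i * (y i - a₀ - a₁ * (h * u i)) * u i = 0 := by
    have : h * ∑ i ∈ S, w i * (y i - a₀ - a₁ * (h * u i)) * u i = 0 := by
      rw [Finset.mul_sum, ← h1]
      exact Finset.sum_congr rfl fun i _ => by ring
    exact (mul_eq_zero.1 this).resolve_left hh
  set R₀ := ∑ i ∈ S, w i * (y i - c₀ - c₁ * (h * u i))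
  set R₁ := ∑ i ∈ S, w i * u i * (y i - c₀ - c₁ * (h * u i))
  set d₀ := a₀ - c₀ with hd₀
  set d₁ := (a₁ - c₁) * h with hd₁
  have hq : ∑ i ∈ S, w i * (d₀ + d₁ * u i) ^ 2 = R₀ * d₀ + R₁ * d₁ := by
    have : ∑ i ∈ S, w i * (d₀ + d₁ * u i) ^ 2 = R₀ * d₀ + R₁ * d₁ -
        (∑ i ∈ S, w i * (y i - a₀ - a₁ * (h * u i))) * d₀ -
        (∑ i ∈ S, w i * (y i - a₀ - a₁ * (h * u i)) * u i) * d₁ := by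
      simp only [R₀, R₁, Finset.sum_mul, ← Finset.sum_add_distrib, ← Finset.sum_sub_distrib]
      refine Finset.sum_congr rfl fun i _ => ?_
      rw [hd₀, hd₁]; ring
    rw [this, h0, h1']; ring
  have hf := hform d₀ d₁
  rw [hq] at hf
  set N := Real.sqrt (d₀ ^ 2 + d₁ ^ 2) with hN
  have hNsq : N ^ 2 = d₀ ^ 2 + d₁ ^ 2 := Real.sq_sqrt (by positivity)
  have hN0 : |d₀| ≤ N := Real.abs_le_sqrt (by nlinarith [sq_nonneg d₁])
  have hN1 : |d₁| ≤ N := Real.abs_le_sqrt (by nlinarith [sq_nonneg d₀])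
  have hb : R₀ * d₀ + R₁ * d₁ ≤ (|R₀| + |R₁|) * N := by
    have e0 : R₀ * d₀ ≤ |R₀| * N := (le_abs_self _).trans (by rw [abs_mul]; gcongr)
    have e1 : R₁ * d₁ ≤ |R₁| * N := (le_abs_self _).trans (by rw [abs_mul]; gcongr)
    linarith
  rw [← hNsq] at hf
  refine hN0.trans ?_
  rw [le_div_iff₀ hl]
  rcases (Real.sqrt_nonneg (d₀ ^ 2 + d₁ ^ 2)).eq_or_lt with hz | hpos
  · rw [← hN] at hz
    rw [← hz, zero_mul]; positivity
  · rw [← hN] at hpos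
    have : N * l * N ≤ (|R₀| + |R₁|) * N := by nlinarith
    exact le_of_mul_le_mul_right this hpos

/-! ### Taylor expansion of the mean function -/

theorem MeanCondition.taylor {a b : ℝ} {μ : ℝ → ℝ} (hab : a < b) (hμ : MeanCondition a b μ) :
    ∃ D : ℝ, 0 ≤ D ∧ ∀ t ∈ Set.Icc a b, ∀ x ∈ Set.Icc a b,
      |μ x - μ t - derivWithin μ (Set.Icc a b) t * (x - t)| ≤ D * (x - t) ^ 2 := by
  obtain ⟨h1, h2, D, hD⟩ := hμ
  have hD0 : 0 ≤ D := (abs_nonneg _).trans (hD a (Set.left_mem_Icc.2 hab.le))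
  have hlip : ∀ t ∈ Set.Icc a b, ∀ x ∈ Set.Icc a b,
      |derivWithin μ (Set.Icc a b) x - derivWithin μ (Set.Icc a b) t| ≤ D * |x - t| := by
    intro t ht x hx
    have := (convex_Icc a b).norm_image_sub_le_of_norm_derivWithin_le h2
      (C := D) (fun y hy => by simpa using hD y hy) ht hx
    simpa using this
  refine ⟨D, hD0, fun t ht x hx => ?_⟩
  set d := derivWithin μ (Set.Icc a b) t
  have hsub : Set.uIcc t x ⊆ Set.Icc a b := Set.uIcc_subset_Icc ht hx
  have hder : ∀ y ∈ Set.uIcc t x, HasDerivWithinAt (fun y => μ y - d * y)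
      (derivWithin μ (Set.Icc a b) y - d) (Set.uIcc t x) y := by
    intro y hy
    have e := ((h1 y (hsub hy)).hasDerivWithinAt.mono hsub).sub
      ((hasDerivWithinAt_id y (Set.uIcc t x)).const_mul d)
    rw [mul_one] at e
    exact e
  have := (convex_uIcc t x).norm_image_sub_le_of_norm_hasDerivWithin_le hder
    (C := D * |x - t|) (fun y hy => ?_) Set.left_mem_uIcc Set.right_mem_uIcc
  · simp only [Real.norm_eq_abs] at this
    rw [mul_assoc, abs_mul_abs_self] at this
    have e : μ x - μ t - d * (x - t) = μ x - d * x - (μ t - d * t) := by ring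
    rw [e, sq]; exact this
  · rw [Real.norm_eq_abs]
    refine (hlip t ht y (hsub hy)).trans ?_
    exact mul_le_mul_of_nonneg_left (Set.abs_sub_left_of_mem_uIcc hy) hD0

/-! ### Nondegeneracy of the kernel-weighted design -/

/-- A positive definite quadratic form in two variables dominates `det / trace` times the
Euclidean one. -/
theorem exists_pos_mul_le_of_posDef {p q r : ℝ}
    (h : ∀ α β : ℝ, (α, β) ≠ (0, 0) → 0 < p * α ^ 2 + 2 * q * α * β + r * β ^ 2) :
    ∃ l > 0, ∀ α β : ℝ, l * (α ^ 2 + β ^ 2) ≤ p * α ^ 2 + 2 * q * α * β + r * β ^ 2 := by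
  have hp : 0 < p := by simpa using h 1 0 (by simp)
  have hr : 0 < r := by simpa using h 0 1 (by simp)
  have hdet : 0 < p * r - q ^ 2 := by
    have := h (-q) p (by simp [hp.ne'])
    have e : p * (-q) ^ 2 + 2 * q * (-q) * p + r * p ^ 2 = p * (p * r - q ^ 2) := by ring
    rw [e] at this
    exact (pos_iff_pos_of_mul_pos this).1 hp
  refine ⟨(p * r - q ^ 2) / (p + r), by positivity, fun α β => ?_⟩
  rw [div_mul_eq_mul_div, div_le_iff₀ (by positivity)]
  nlinarith [sq_nonneg (p * α + q * β), sq_nonneg (q * α + r * β)]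

theorem KernelCondition.integrable {K : ℝ → ℝ} (hK : KernelCondition K) : Integrable K := by
  by_contra h
  have := hK.integral_eq_one
  rw [integral_undef h] at this
  norm_num at this

theorem KernelCondition.exists_bound {K : ℝ → ℝ} (hK : KernelCondition K) :
    ∃ C : ℝ, 0 < C ∧ ∀ x, K x ≤ C := by
  refine ⟨K 0 + (eVariationOn K (Set.Icc (-1) 1)).toReal + 1, ?_, fun x => ?_⟩
  · have := hK.nonneg 0
    positivity
  · by_cases hx : x ∈ Set.Icc (-1 : ℝ) 1
    · have := hK.boundedVariation.sub_le hx (show (0 : ℝ) ∈ Set.Icc (-1 : ℝ) 1 by norm_num)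
      linarith
    · rw [hK.support x hx]
      have := hK.nonneg 0
      positivity

theorem KernelCondition.integral_zero_one {K : ℝ → ℝ} (hK : KernelCondition K) :
    ∫ u in (0 : ℝ)..1, K u = 1 / 2 := by
  have hi : ∀ c d : ℝ, IntervalIntegrable K volume c d := fun c d =>
    hK.integrable.intervalIntegrable
  have h1 : ∫ u in (-1 : ℝ)..1, K u = 1 := by
    rw [intervalIntegral.integral_of_le (by norm_num), ← integral_Icc_eq_integral_Ioc,
      setIntegral_eq_integral_of_forall_compl_eq_zero hK.support, hK.integral_eq_one]
  have h2 : ∫ u in (-1 : ℝ)..0, K u = ∫ u in (0 : ℝ)..1, K u := by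
    have := intervalIntegral.integral_comp_neg (a := (0 : ℝ)) (b := 1) K
    simp only [hK.symm, neg_zero] at this
    exact this.symm
  have := intervalIntegral.integral_add_adjacent_intervals (hi (-1) 0) (hi 0 1)
  linarith

/-- One half of the kernel already determines a line: its weighted quadratic form is positive
definite. -/
theorem KernelCondition.exists_half_form {K : ℝ → ℝ} (hK : KernelCondition K) :
    ∃ l > 0, ∀ α β : ℝ, l * (α ^ 2 + β ^ 2) ≤ ∫ u in (0 : ℝ)..1, K u * (α + β * u) ^ 2 := by
  have hi : ∀ φ : ℝ → ℝ, Continuous φ →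
      IntervalIntegrable (fun u => K u * φ u) volume 0 1 := fun φ hφ =>
    hK.integrable.intervalIntegrable.mul_continuousOn hφ.continuousOn
  have hform : ∀ α β : ℝ, ∫ u in (0 : ℝ)..1, K u * (α + β * u) ^ 2 =
      (∫ u in (0 : ℝ)..1, K u) * α ^ 2 + 2 * (∫ u in (0 : ℝ)..1, K u * u) * α * β +
      (∫ u in (0 : ℝ)..1, K u * u ^ 2) * β ^ 2 := by
    intro α β
    have e : ∀ u, K u * (α + β * u) ^ 2 =
        α ^ 2 * (K u * 1) + 2 * α * β * (K u * u) + β ^ 2 * (K u * u ^ 2) := fun u => by ring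
    simp_rw [e]
    have i0 := (hi (fun _ => 1) continuous_const).const_mul (α ^ 2)
    have i1 := (hi (fun u => u) continuous_id).const_mul (2 * α * β)
    have i2 := (hi (fun u => u ^ 2) (continuous_pow 2)).const_mul (β ^ 2)
    rw [intervalIntegral.integral_add (i0.add i1) i2, intervalIntegral.integral_add i0 i1]
    simp only [intervalIntegral.integral_const_mul, mul_one]
    ring
  simp_rw [hform]
  refine exists_pos_mul_le_of_posDef fun α β hne => ?_
  rw [← hform]
  have hnn : ∀ u, 0 ≤ K u * (α + β * u) ^ 2 := fun u => mul_nonneg (hK.nonneg u) (sq_nonneg _)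
  refine (intervalIntegral.integral_nonneg zero_le_one fun u _ => hnn u).lt_of_ne fun h0 => ?_
  -- otherwise `K` would vanish almost everywhere on `[0, 1]`
  rw [intervalIntegral.integral_of_le zero_le_one] at h0
  have hae := (setIntegral_eq_zero_iff_of_nonneg_ae (ae_of_all _ hnn)
    ((intervalIntegrable_iff_integrableOn_Ioc_of_le zero_le_one).1
      (hi (fun u => (α + β * u) ^ 2) (by fun_prop)))).1 h0.symm
  have hroot : ∀ᵐ u ∂(volume.restrict (Set.Ioc (0 : ℝ) 1)), α + β * u ≠ 0 := by
    apply ae_restrict_of_ae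
    have hsub : {u : ℝ | ¬ (α + β * u ≠ 0)} ⊆ {-α / β} := by
      intro u hu
      simp only [Set.mem_ofPred_eq, not_not] at hu
      rw [Set.mem_singleton_iff]
      by_cases hβ : β = 0
      · subst hβ
        exact absurd (by simpa using hu) (fun h : α = 0 => hne (by simp [h]))
      · rw [eq_div_iff hβ]; linarith
    exact measure_mono_null hsub (by simp)
  have hK0 : ∫ u in (0 : ℝ)..1, K u = 0 := by
    rw [intervalIntegral.integral_of_le zero_le_one]
    refine integral_eq_zero_of_ae ?_
    filter_upwards [hae, hroot] with u hu hr
    have hu' : K u * (α + β * u) ^ 2 = 0 := hu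
    simpa [hr] using hu'
  rw [hK.integral_zero_one] at hK0
  norm_num at hK0

/-- The law on `[a, b]` with density `fT`. -/
noncomputable def timeLaw (a b : ℝ) (fT : ℝ → ℝ) : Measure ℝ :=
  (volume.restrict (Set.Icc a b)).withDensity (fun t => ENNReal.ofReal (fT t))

theorem DensityCondition.aemeasurable {a b : ℝ} {fT : ℝ → ℝ} (h : DensityCondition a b fT) :
    AEMeasurable fT (volume.restrict (Set.Icc a b)) :=
  h.2.1.continuousOn.aemeasurable measurableSet_Icc

/-- The kernel-weighted quadratic form of the law of the times is positive definite, uniformly in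
the location `t` and the bandwidth: within `[a, b]` there is always room for half of the window. -/
theorem exists_design_form {a b : ℝ} {fT K : ℝ → ℝ} (hfT : DensityCondition a b fT)
    (hK : KernelCondition K) :
    ∃ l > 0, ∀ h : ℝ, 0 < h → h ≤ (b - a) / 2 → ∀ t ∈ Set.Icc a b, ∀ α β : ℝ,
      l * (α ^ 2 + β ^ 2) ≤
        h⁻¹ * ∫ x, K ((x - t) / h) * (α + β * ((x - t) / h)) ^ 2 ∂(timeLaw a b fT) := by
  obtain ⟨l, hl, hform⟩ := hK.exists_half_form
  obtain ⟨C, hC, hKC⟩ := hK.exists_bound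
  have hfm := hfT.aemeasurable
  obtain ⟨⟨c, D, hc, hcD⟩, -, -⟩ := hfT
  refine ⟨c * l, by positivity, fun h hh hhb t ht α β => ?_⟩
  set φ : ℝ → ℝ := fun u => K u * (α + β * u) ^ 2 with hφ
  have hφ0 : ∀ u, 0 ≤ φ u := fun u => mul_nonneg (hK.nonneg u) (sq_nonneg _)
  have hφi : Integrable φ := by
    have hbd : ∀ u, ‖φ u‖ ≤ C * (|α| + |β|) ^ 2 := by
      intro u
      rw [Real.norm_of_nonneg (hφ0 u)]
      by_cases hu : u ∈ Set.Icc (-1 : ℝ) 1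
      · have : |α + β * u| ≤ |α| + |β| := by
          refine (abs_add_le _ _).trans ?_
          rw [abs_mul]
          have := abs_le.2 hu
          nlinarith [abs_nonneg β]
        have h2 : (α + β * u) ^ 2 ≤ (|α| + |β|) ^ 2 := by
          rw [← sq_abs (α + β * u)]; gcongr
        exact mul_le_mul (hKC u) h2 (sq_nonneg _) hC.le
      · simp only [φ, hK.support u hu, zero_mul]; positivity
    have hon : IntegrableOn φ (Set.Icc (-1) 1) :=
      Measure.integrableOn_of_bounded (by simp) ((hK.integrable.aestronglyMeasurable).mul
        (by fun_prop : Continuous fun u : ℝ => (α + β * u) ^ 2).aestronglyMeasurable)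
        (ae_of_all _ hbd)
    exact (integrableOn_iff_integrable_of_support_subset (fun u hu => by
      by_contra hn
      exact hu (by simp [φ, hK.support u hn]))).1 hon
  have hφh : Integrable (fun x => φ ((x - t) / h)) :=
    (hφi.comp_div hh.ne').comp_sub_right t
  -- a half window inside `[a, b]`
  have hhalf : ∃ y z : ℝ, y ≤ z ∧ Set.Ioc y z ⊆ Set.Icc a b ∧
      l * (α ^ 2 + β ^ 2) ≤ h⁻¹ * ∫ x in y..z, φ ((x - t) / h) := by
    have hcv : ∀ y z : ℝ, h⁻¹ * ∫ x in y..z, φ ((x - t) / h) =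
        ∫ u in (y - t) / h..(z - t) / h, φ u := by
      intro y z
      rw [intervalIntegral.integral_comp_sub_right (fun x => φ (x / h)) t,
        intervalIntegral.integral_comp_div _ hh.ne', smul_eq_mul, inv_mul_cancel_left₀ hh.ne']
    by_cases hmid : t ≤ (a + b) / 2
    · refine ⟨t, t + h, by linarith, fun x hx => ⟨ht.1.trans hx.1.le, by linarith [hx.2]⟩, ?_⟩
      rw [hcv, sub_self, zero_div, add_sub_cancel_left, div_self hh.ne']
      exact hform α β
    · refine ⟨t - h, t, by linarith, fun x hx => ⟨by linarith [hx.1], hx.2.trans ht.2⟩, ?_⟩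
      rw [hcv, sub_self, zero_div, sub_sub_cancel_left, neg_div, div_self hh.ne']
      have := intervalIntegral.integral_comp_neg (a := (0 : ℝ)) (b := 1) φ
      rw [neg_zero] at this
      rw [← this]
      have h2 := hform α (-β)
      rw [neg_sq] at h2
      refine h2.trans_eq (intervalIntegral.integral_congr fun u _ => ?_)
      simp only [φ, hK.symm]; ring
  obtain ⟨y, z, hyz, hsub, hle⟩ := hhalf
  have hlaw : ∫ x, φ ((x - t) / h) ∂(timeLaw a b fT) =
      ∫ x in Set.Icc a b, fT x * φ ((x - t) / h) := by
    rw [timeLaw, integral_withDensity_eq_integral_toReal_smul₀ hfm.ennreal_ofReal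
      (ae_of_all _ fun x => ENNReal.ofReal_lt_top)]
    refine setIntegral_congr_fun measurableSet_Icc fun x hx => ?_
    simp only [smul_eq_mul]
    rw [ENNReal.toReal_ofReal (hc.le.trans (hcD x hx).1)]
  have hfi : IntegrableOn (fun x => fT x * φ ((x - t) / h)) (Set.Icc a b) := by
    refine (hφh.integrableOn (s := Set.Icc a b)).bdd_mul (c := D) hfm.aestronglyMeasurable ?_
    filter_upwards [ae_restrict_mem measurableSet_Icc] with x hx
    rw [Real.norm_of_nonneg (hc.le.trans (hcD x hx).1)]
    exact (hcD x hx).2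
  rw [hlaw]
  have h3 : c * ∫ x in y..z, φ ((x - t) / h) ≤ ∫ x in Set.Icc a b, fT x * φ ((x - t) / h) := by
    rw [intervalIntegral.integral_of_le hyz, ← integral_const_mul]
    refine (setIntegral_mono_on (hφh.integrableOn.const_mul c) (hfi.mono_set hsub)
      measurableSet_Ioc fun x hx => ?_).trans ?_
    · exact mul_le_mul_of_nonneg_right (hcD x (hsub hx)).1 (hφ0 _)
    · refine setIntegral_mono_set hfi ?_ hsub.eventuallyLE
      filter_upwards [ae_restrict_mem measurableSet_Icc] with x hx
      exact mul_nonneg (hc.le.trans (hcD x hx).1) (hφ0 _)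
  calc c * l * (α ^ 2 + β ^ 2) = c * (l * (α ^ 2 + β ^ 2)) := by ring
    _ ≤ c * (h⁻¹ * ∫ x in y..z, φ ((x - t) / h)) := by gcongr
    _ = h⁻¹ * (c * ∫ x in y..z, φ ((x - t) / h)) := by ring
    _ ≤ _ := by gcongr

theorem timeLaw_le {a b D : ℝ} {fT : ℝ → ℝ} (hD : ∀ t ∈ Set.Icc a b, fT t ≤ D) (J : Set ℝ)
    (hJ : MeasurableSet J) : timeLaw a b fT J ≤ ENNReal.ofReal D * volume J := by
  rw [timeLaw, withDensity_apply _ hJ, Measure.restrict_restrict hJ]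
  calc ∫⁻ t in J ∩ Set.Icc a b, ENNReal.ofReal (fT t)
      ≤ ∫⁻ t in J ∩ Set.Icc a b, ENNReal.ofReal D := by
        refine setLIntegral_mono measurable_const fun t ht => ?_
        exact ENNReal.ofReal_le_ofReal (hD t ht.2)
    _ = ENNReal.ofReal D * volume (J ∩ Set.Icc a b) := by simp
    _ ≤ _ := by gcongr; exact Set.inter_subset_left

/-! ### A Bernstein bound, uniformly over intervals -/

theorem mgf_le_exp_sq {Ω : Type*} [MeasurableSpace Ω] {P : Measure Ω} [IsProbabilityMeasure P]
    {Y : Ω → ℝ} {lam : ℝ} (hY : Measurable Y) (hmean : ∫ ω, Y ω ∂P = 0)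
    (hb : ∀ ω, |lam * Y ω| ≤ 1) (hi : Integrable Y P) (hi2 : Integrable (fun ω => Y ω ^ 2) P) :
    Integrable (fun ω => Real.exp (lam * Y ω)) P ∧
      mgf Y P lam ≤ Real.exp (lam ^ 2 * ∫ ω, Y ω ^ 2 ∂P) := by
  have hint : Integrable (fun ω => Real.exp (lam * Y ω)) P := by
    refine Integrable.of_bound (by fun_prop) (Real.exp 1) (ae_of_all _ fun ω => ?_)
    rw [Real.norm_of_nonneg (Real.exp_pos _).le]
    exact Real.exp_le_exp.2 ((le_abs_self _).trans (hb ω))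
  refine ⟨hint, ?_⟩
  have h1 : mgf Y P lam ≤ ∫ ω, (1 + lam * Y ω + lam ^ 2 * Y ω ^ 2) ∂P := by
    refine integral_mono hint (((integrable_const _).add (hi.const_mul _)).add
      (hi2.const_mul _)) fun ω => ?_
    have := (abs_le.1 (Real.abs_exp_sub_one_sub_id_le (hb ω))).2
    simp only
    nlinarith
  have h2 : ∫ ω, (1 + lam * Y ω + lam ^ 2 * Y ω ^ 2) ∂P = lam ^ 2 * ∫ ω, Y ω ^ 2 ∂P + 1 := by
    rw [integral_add (f := fun ω => 1 + lam * Y ω) ((integrable_const _).add (hi.const_mul _))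
      (hi2.const_mul _), integral_add (integrable_const _) (hi.const_mul _), integral_const_mul,
      integral_const_mul, hmean]
    simp [add_comm]
  rw [h2] at h1
  exact h1.trans (Real.add_one_le_exp _)

theorem measureReal_le_abs_sum_sub {Ω β : Type*} [MeasurableSpace Ω] {P : Measure Ω}
    [IsProbabilityMeasure P] {V : β → Ω → ℝ} (hind : iIndepFun V P) (hm : ∀ b, Measurable (V b))
    (s : Finset β) {q lam v x : ℝ} (h0 : ∀ b ∈ s, ∀ ω, 0 ≤ V b ω) (hq : ∀ b ∈ s, ∀ ω, V b ω ≤ q)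
    (hlam : 0 ≤ lam) (hlq : lam * q ≤ 1) (hv : ∑ b ∈ s, ∫ ω, V b ω ^ 2 ∂P ≤ v) :
    P.real {ω | x ≤ |∑ b ∈ s, V b ω - ∑ b ∈ s, ∫ ω, V b ω ∂P|} ≤
      2 * Real.exp (-(lam * x) + lam ^ 2 * v) := by
  have hbd : ∀ b ∈ s, ∀ ω, ‖V b ω‖ ≤ q := fun b hb ω => by
    rw [Real.norm_of_nonneg (h0 b hb ω)]; exact hq b hb ω
  have hi : ∀ b ∈ s, Integrable (V b) P := fun b hb =>
    Integrable.of_bound (hm b).aestronglyMeasurable q (ae_of_all _ (hbd b hb))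
  have hi2 : ∀ b ∈ s, Integrable (fun ω => V b ω ^ 2) P := fun b hb => by
    refine Integrable.of_bound ((hm b).pow_const 2).aestronglyMeasurable (q ^ 2)
      (ae_of_all _ fun ω => ?_)
    rw [norm_pow]
    exact pow_le_pow_left₀ (norm_nonneg _) (hbd b hb ω) 2
  -- one side, for a sign `σ`
  have side : ∀ σ : ℝ, σ ^ 2 = 1 →
      P.real {ω | x ≤ σ * (∑ b ∈ s, V b ω - ∑ b ∈ s, ∫ ω, V b ω ∂P)} ≤
        Real.exp (-(lam * x) + lam ^ 2 * v) := by
    intro σ hσ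
    have hσ1 : |σ| = 1 := by
      rw [← abs_one, ← sq_eq_sq_iff_abs_eq_abs, hσ, one_pow]
    let Y : β → Ω → ℝ := fun b ω => σ * (V b ω - ∫ ω, V b ω ∂P)
    have hYm : ∀ b, Measurable (Y b) := fun b => ((hm b).sub_const _).const_mul σ
    have hYind : iIndepFun Y P :=
      hind.comp (fun b z => σ * (z - ∫ ω, V b ω ∂P)) fun b => by fun_prop
    have hYi : ∀ b ∈ s, Integrable (Y b) P := fun b hb =>
      ((hi b hb).sub (integrable_const _)).const_mul σ
    have hY2 : ∀ b ω, Y b ω ^ 2 = V b ω ^ 2 - 2 * (∫ ω, V b ω ∂P) * V b ω +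
        (∫ ω, V b ω ∂P) ^ 2 := fun b ω => by
      simp only [Y, mul_pow, hσ]; ring
    have hYi2 : ∀ b ∈ s, Integrable (fun ω => Y b ω ^ 2) P := fun b hb => by
      simp_rw [hY2]
      exact ((hi2 b hb).sub ((hi b hb).const_mul _)).add (integrable_const _)
    have hmgf : ∀ b ∈ s, Integrable (fun ω => Real.exp (lam * Y b ω)) P ∧
        mgf (Y b) P lam ≤ Real.exp (lam ^ 2 * ∫ ω, V b ω ^ 2 ∂P) := by
      intro b hb
      have hE0 : 0 ≤ ∫ ω, V b ω ∂P := integral_nonneg (h0 b hb)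
      have hEq : ∫ ω, V b ω ∂P ≤ q := by
        have := integral_mono (hi b hb) (integrable_const q) (hq b hb)
        simpa using this
      have := mgf_le_exp_sq (lam := lam) (hYm b) ?_ ?_ (hYi b hb) (hYi2 b hb)
      · refine ⟨this.1, this.2.trans (Real.exp_le_exp.2 ?_)⟩
        refine mul_le_mul_of_nonneg_left ?_ (sq_nonneg _)
        simp_rw [hY2]
        rw [integral_add (f := fun ω => V b ω ^ 2 - 2 * (∫ ω, V b ω ∂P) * V b ω)
          ((hi2 b hb).sub ((hi b hb).const_mul _)) (integrable_const _),
          integral_sub (hi2 b hb) ((hi b hb).const_mul _), integral_const_mul]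
        simp only [integral_const, probReal_univ, one_smul]
        nlinarith
      · simp only [Y]
        rw [integral_const_mul, integral_sub (hi b hb) (integrable_const _)]
        simp
      · intro ω
        have hd : |V b ω - ∫ ω, V b ω ∂P| ≤ q := by
          have := h0 b hb ω
          have := hq b hb ω
          rw [abs_le]; constructor <;> linarith
        simp only [Y]
        rw [abs_mul, abs_mul, hσ1, one_mul, abs_of_nonneg hlam]
        exact (mul_le_mul_of_nonneg_left hd hlam).trans hlq
    have hsum : ∀ ω, σ * (∑ b ∈ s, V b ω - ∑ b ∈ s, ∫ ω, V b ω ∂P) = (∑ b ∈ s, Y b) ω := by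
      intro ω
      simp only [Y, Finset.sum_apply, ← Finset.mul_sum, Finset.sum_sub_distrib]
    simp_rw [hsum]
    refine (measure_ge_le_exp_mul_mgf x hlam
      (hYind.integrable_exp_mul_sum hYm fun b hb => (hmgf b hb).1)).trans ?_
    rw [hYind.mgf_sum hYm]
    calc Real.exp (-lam * x) * ∏ b ∈ s, mgf (Y b) P lam
        ≤ Real.exp (-lam * x) * ∏ b ∈ s, Real.exp (lam ^ 2 * ∫ ω, V b ω ^ 2 ∂P) := by
          gcongr with b hb
          · exact fun b hb => mgf_nonneg
          · exact (hmgf b hb).2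
      _ = Real.exp (-(lam * x) + lam ^ 2 * ∑ b ∈ s, ∫ ω, V b ω ^ 2 ∂P) := by
          rw [← Real.exp_sum, ← Finset.mul_sum, Real.exp_add, neg_mul]
      _ ≤ _ := by gcongr
  calc P.real {ω | x ≤ |∑ b ∈ s, V b ω - ∑ b ∈ s, ∫ ω, V b ω ∂P|}
      ≤ P.real ({ω | x ≤ 1 * (∑ b ∈ s, V b ω - ∑ b ∈ s, ∫ ω, V b ω ∂P)} ∪
          {ω | x ≤ (-1) * (∑ b ∈ s, V b ω - ∑ b ∈ s, ∫ ω, V b ω ∂P)}) := by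
        refine measureReal_mono fun ω hω => ?_
        simp only [Set.mem_ofPred_eq, Set.mem_union, one_mul, neg_one_mul] at hω ⊢
        exact le_abs.1 hω
    _ ≤ _ := (measureReal_union_le _ _).trans
        ((add_le_add (side 1 (by norm_num)) (side (-1) (by norm_num))).trans_eq (by ring))

/-- Two monotone subadditive set functions that are close on the short intervals with endpoints in
`ℤ / n` are close on all intervals of a window, if one of them is Lipschitz. -/
theorem abs_sub_le_of_grid {N N' : Set ℝ → ℝ} {n : ℕ} (hn : 0 < n) {x₀ x₁ ε D : ℝ}
    (hN : ∀ I J, MeasurableSet I → MeasurableSet J → I ⊆ J → N I ≤ N J)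
    (hN' : ∀ I J, MeasurableSet I → MeasurableSet J → I ⊆ J → N' I ≤ N' J)
    (hN'sub : ∀ I J, MeasurableSet I → MeasurableSet J → N' (I ∪ J) ≤ N' I + N' J)
    (hD : ∀ x y, x ≤ y → N' (Set.Ioc x y) ≤ D * (y - x))
    (hgrid : ∀ k l : ℤ, k ≤ l → x₀ * n - 1 ≤ k → l ≤ x₁ * n + 1 →
      |N (Set.Ioc (k / n) (l / n)) - N' (Set.Ioc (k / n) (l / n))| ≤ ε)
    {I : Set ℝ} (hI : I.OrdConnected) (hIs : I ⊆ Set.Icc x₀ x₁) (hle : x₀ ≤ x₁) :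
    |N I - N' I| ≤ ε + 3 * D / n := by
  have hn' : (0 : ℝ) < n := Nat.cast_pos.2 hn
  have hD0 : 0 ≤ D := by
    have h1 := hD 0 1 zero_le_one
    have h2 := hD 0 0 le_rfl
    have h3 := hN' ∅ (Set.Ioc 0 1) MeasurableSet.empty measurableSet_Ioc (Set.empty_subset _)
    have h4 := hN'sub ∅ ∅ MeasurableSet.empty MeasurableSet.empty
    rw [Set.union_empty] at h4
    linarith
  rcases I.eq_empty_or_nonempty with rfl | hne
  · have := hgrid ⌈x₀ * n⌉ ⌈x₀ * n⌉ le_rfl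
      (by linarith [Int.le_ceil (x₀ * n)])
      (by nlinarith [Int.ceil_lt_add_one (x₀ * n)])
    rw [Set.Ioc_self] at this
    have : 0 ≤ 3 * D / n := by positivity
    linarith
  have hbb : BddBelow I := ⟨x₀, fun z hz => (hIs hz).1⟩
  have hba : BddAbove I := ⟨x₁, fun z hz => (hIs hz).2⟩
  set x := sInf I with hx
  set y := sSup I with hy
  have hx0 : x₀ ≤ x := le_csInf hne fun z hz => (hIs hz).1
  have hy1 : y ≤ x₁ := csSup_le hne fun z hz => (hIs hz).2
  have hxy : x ≤ y := by
    obtain ⟨z, hz⟩ := hne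
    exact (csInf_le hbb hz).trans (le_csSup hba hz)
  have hIcc : I ⊆ Set.Icc x y := fun z hz => ⟨csInf_le hbb hz, le_csSup hba hz⟩
  have hIoo : ∀ z, x < z → z < y → z ∈ I := by
    intro z hxz hzy
    obtain ⟨u, hu, huz⟩ := exists_lt_of_csInf_lt hne hxz
    obtain ⟨v, hv, hzv⟩ := exists_lt_of_lt_csSup hne hzy
    exact hI.out hu hv ⟨huz.le, hzv.le⟩
  have hIm : MeasurableSet I := hI.measurableSet
  set k : ℤ := ⌈x * n⌉ - 1 with hk
  set l : ℤ := ⌊y * n⌋ with hl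
  have hk1 : (k : ℝ) < x * n := by
    rw [hk]; push_cast; linarith [Int.ceil_lt_add_one (x * n)]
  have hk2 : x * n ≤ (k : ℝ) + 1 := by
    rw [hk]; push_cast; linarith [Int.le_ceil (x * n)]
  have hl1 : (l : ℝ) ≤ y * n := Int.floor_le _
  have hl2 : y * n < (l : ℝ) + 1 := Int.lt_floor_add_one _
  have hxyn : x * n ≤ y * n := by gcongr
  have hx0n : x₀ * n ≤ x * n := by gcongr
  have hy1n : y * n ≤ x₁ * n := by gcongr
  have hkl : k + 1 ≤ l + 1 := by
    have : (k : ℝ) < (l + 1 : ℤ) := by push_cast; linarith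
    have := Int.cast_lt.1 this
    omega
  -- the inner interval, possibly empty
  set l' : ℤ := max (k + 1) (l - 1) with hl'
  set inner := Set.Ioc (((k + 1 : ℤ) : ℝ) / n) ((l' : ℝ) / n) with hinner
  set outer := Set.Ioc ((k : ℝ) / n) (((l + 1 : ℤ) : ℝ) / n) with houter
  set left := Set.Ioc ((k : ℝ) / n) (((k + 1 : ℤ) : ℝ) / n) with hleft
  set right := Set.Ioc (((l - 1 : ℤ) : ℝ) / n) (((l + 1 : ℤ) : ℝ) / n) with hright
  have hIout : I ⊆ outer := by
    intro z hz
    have := hIcc hz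
    constructor
    · rw [div_lt_iff₀ hn']; nlinarith [this.1]
    · rw [le_div_iff₀ hn']; push_cast; nlinarith [this.2]
  have hinI : inner ⊆ I := by
    intro z hz
    rw [hinner, Set.mem_Ioc, div_lt_iff₀ hn', le_div_iff₀ hn'] at hz
    have hlt : ((k + 1 : ℤ) : ℝ) < (l' : ℤ) := hz.1.trans_le hz.2
    have hl'' : l' = l - 1 := by
      have := Int.cast_lt.1 hlt
      omega
    rw [hl''] at hz
    push_cast at hz
    exact hIoo z (lt_of_mul_lt_mul_right (by linarith) hn'.le)
      (lt_of_mul_lt_mul_right (by linarith) hn'.le)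
  have hcover : outer ⊆ (left ∪ inner) ∪ right := by
    intro z hz
    by_cases h1 : z ≤ ((k + 1 : ℤ) : ℝ) / n
    · exact Or.inl (Or.inl ⟨hz.1, h1⟩)
    · by_cases h2 : z ≤ (l' : ℝ) / n
      · exact Or.inl (Or.inr ⟨not_le.1 h1, h2⟩)
      · refine Or.inr ⟨lt_of_le_of_lt ?_ (not_le.1 h2), hz.2⟩
        gcongr
        exact le_max_right _ _
  have hms : MeasurableSet left ∧ MeasurableSet inner ∧ MeasurableSet right :=
    ⟨measurableSet_Ioc, measurableSet_Ioc, measurableSet_Ioc⟩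
  have hlen : N' outer ≤ N' inner + 3 * D / n := by
    have h1 := hN' _ _ measurableSet_Ioc ((hms.1.union hms.2.1).union hms.2.2) hcover
    have h2 := hN'sub _ _ (hms.1.union hms.2.1) hms.2.2
    have h3 := hN'sub _ _ hms.1 hms.2.1
    have h4 : N' left ≤ D * (1 / n) := by
      refine (hD _ _ (by gcongr; omega)).trans_eq ?_
      push_cast; ring
    have h5 : N' right ≤ D * (2 / n) := by
      refine (hD _ _ (by gcongr; omega)).trans_eq ?_
      push_cast; ring
    have h6 : 3 * D / n = D * (1 / n) + D * (2 / n) := by ring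
    linarith
  have ho := hgrid k (l + 1) (by omega) (by linarith) (by push_cast; linarith)
  have hl'n : (l' : ℝ) ≤ x₁ * n + 1 := by
    rw [hl']; push_cast
    refine max_le (by linarith) (by linarith)
  have hin := hgrid (k + 1) l' (le_max_left _ _) (by push_cast; linarith) hl'n
  rw [abs_le] at ho hin ⊢
  have a1 := hN _ _ hIm measurableSet_Ioc hIout
  have a2 := hN' _ _ hIm measurableSet_Ioc hIout
  have a3 := hN _ _ hms.2.1 hIm hinI
  have a4 := hN' _ _ hms.2.1 hIm hinI
  have a5 : N outer - N' outer ≤ ε := ho.2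
  have a6 : -ε ≤ N inner - N' inner := hin.1
  constructor <;> linarith

/-- Uniform deviation of independent random masses. `V n b J` is the mass that block `b` puts on `J`
at stage `n`. If the masses are at most `A n / log n` and have second moments of total order
`A n ^ 2 / log n` on intervals of length `O(h n)`, then almost surely the total mass of every
interval in every window `[t - h n, t + h n]` is within `O(A n)` of its mean. -/
theorem exists_ae_eventually_abs_sum_sub_le {Ω β : Type*} [MeasurableSpace Ω] {P : Measure Ω}
    [IsProbabilityMeasure P] (s : ℕ → Finset β) (V : ℕ → β → Set ℝ → Ω → ℝ) (A h : ℕ → ℝ)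
    (a b B D : ℝ)
    (hmono : ∀ n b I J ω, I ⊆ J → V n b I ω ≤ V n b J ω)
    (hsub : ∀ n b I J ω, V n b (I ∪ J) ω ≤ V n b I ω + V n b J ω)
    (hmeas : ∀ n b J, MeasurableSet J → Measurable (V n b J))
    (hind : ∀ n x y, iIndepFun (fun b => V n b (Set.Ioc x y)) P)
    (h0 : ∀ n, ∀ b ∈ s n, ∀ J ω, 0 ≤ V n b J ω)
    (hA : ∀ᶠ n : ℕ in atTop, (1 : ℝ) / n ≤ A n)
    (hh : ∀ᶠ n : ℕ in atTop, (1 : ℝ) / n ≤ h n ∧ h n ≤ 1)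
    (hV : ∀ᶠ n in atTop, ∀ b ∈ s n, ∀ J ω, V n b J ω ≤ A n / Real.log n)
    (hB : ∀ᶠ n in atTop, ∀ x y, x ≤ y → y - x ≤ 4 * h n →
      ∑ b ∈ s n, ∫ ω, V n b (Set.Ioc x y) ω ^ 2 ∂P ≤ B * (A n ^ 2 / Real.log n))
    (hD : ∀ᶠ n in atTop, ∀ x y, x ≤ y →
      ∑ b ∈ s n, ∫ ω, V n b (Set.Ioc x y) ω ∂P ≤ D * (y - x)) :
    ∃ C : ℝ, ∀ᵐ ω ∂P, ∀ᶠ n in atTop, ∀ t ∈ Set.Icc a b, ∀ I : Set ℝ, I.OrdConnected →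
      I ⊆ Set.Icc (t - h n) (t + h n) →
      |∑ b ∈ s n, V n b I ω - ∑ b ∈ s n, ∫ ω, V n b I ω ∂P| ≤ C * A n := by
  obtain ⟨R, hR⟩ := exists_nat_ge (|a| + |b| + 2)
  have hR1 : (1 : ℝ) ≤ R := by have := abs_nonneg a; have := abs_nonneg b; linarith
  have hall := hA.and (hh.and (hV.and (hB.and (hD.and (eventually_ge_atTop 2)))))
  obtain ⟨n₀, hn₀⟩ := eventually_atTop.1 hall
  let grid : ℕ → Finset (ℤ × ℤ) := fun n =>
    ((Finset.Icc (-(R * n : ℤ)) (R * n)) ×ˢ (Finset.Icc (-(R * n : ℤ)) (R * n))).filter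
      fun p => p.1 ≤ p.2 ∧ (p.2 - p.1 : ℝ) ≤ 4 * h n * n
  let bad : ℕ → Set Ω := fun n => if n₀ ≤ n then ⋃ p ∈ grid n,
    {ω | (B + 4) * A n ≤ |∑ b ∈ s n, V n b (Set.Ioc (p.1 / n) (p.2 / n)) ω -
      ∑ b ∈ s n, ∫ ω, V n b (Set.Ioc (p.1 / n) (p.2 / n)) ω ∂P|} else ∅
  have hbad : ∀ n, P (bad n) ≤ ENNReal.ofReal (18 * R ^ 2 * (1 / (n : ℝ) ^ 2)) := by
    intro n
    by_cases hn : n₀ ≤ n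
    swap
    · simp [bad, hn]
    obtain ⟨hA1, ⟨hh1, hh2⟩, hV1, hB1, hD1, hn2⟩ := hn₀ n hn
    have hn2' : (2 : ℝ) ≤ n := by exact_mod_cast hn2
    have hnpos : (0 : ℝ) < n := by linarith
    have hlog : 0 < Real.log n := Real.log_pos (by linarith)
    have hApos : 0 < A n := lt_of_lt_of_le (by positivity) hA1
    have hone : ∀ p ∈ grid n, P {ω | (B + 4) * A n ≤
        |∑ b ∈ s n, V n b (Set.Ioc (p.1 / n) (p.2 / n)) ω -
          ∑ b ∈ s n, ∫ ω, V n b (Set.Ioc (p.1 / n) (p.2 / n)) ω ∂P|} ≤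
        ENNReal.ofReal (2 * ((n : ℝ) ^ 4)⁻¹) := by
      intro p hp
      have hp' := (Finset.mem_filter.1 hp).2
      have hpp : ((p.1 : ℝ) / n) ≤ p.2 / n := by gcongr; exact hp'.1
      have hplen : (p.2 : ℝ) / n - p.1 / n ≤ 4 * h n := by
        rw [← sub_div, div_le_iff₀ hnpos]; exact hp'.2
      rw [← ofReal_measureReal]
      refine ENNReal.ofReal_le_ofReal ?_
      refine (measureReal_le_abs_sum_sub (lam := Real.log n / A n) (hind n _ _)
        (fun b => hmeas n b _ measurableSet_Ioc) (s n) (fun b hb ω => h0 n b hb _ ω)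
        (fun b hb ω => hV1 b hb _ ω) (by positivity) ?_ (hB1 _ _ hpp hplen)).trans_eq ?_
      · rw [div_mul_div_comm, mul_comm, div_self (by positivity)]
      · have e : -(Real.log n / A n * ((B + 4) * A n)) +
            (Real.log n / A n) ^ 2 * (B * (A n ^ 2 / Real.log n)) = -((4 : ℕ) * Real.log n) := by
          field_simp
          push_cast
          ring
        rw [e, Real.exp_neg, ← Real.log_pow, Real.exp_log (by positivity)]
    have hcard : ((grid n).card : ℝ) ≤ 9 * R ^ 2 * n ^ 2 := by
      have h1 : (grid n).card ≤ (2 * (R * n) + 1) * (2 * (R * n) + 1) := by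
        refine (Finset.card_filter_le _ _).trans ?_
        rw [Finset.card_product, Int.card_Icc]
        apply le_of_eq
        congr 1 <;> omega
      have h2 : ((grid n).card : ℝ) ≤ (2 * (R * n) + 1) * (2 * (R * n) + 1) := by
        exact_mod_cast h1
      have h3 : (1 : ℝ) ≤ R * n := by nlinarith
      nlinarith
    simp only [bad, hn, if_true]
    calc P _ ≤ ∑ p ∈ grid n, ENNReal.ofReal (2 * ((n : ℝ) ^ 4)⁻¹) :=
          (measure_biUnion_finset_le _ _).trans (Finset.sum_le_sum hone)
      _ = ENNReal.ofReal ((grid n).card * (2 * ((n : ℝ) ^ 4)⁻¹)) := by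
          rw [Finset.sum_const, nsmul_eq_mul,
            ENNReal.ofReal_mul (p := ((grid n).card : ℝ)) (by positivity),
            ENNReal.ofReal_natCast]
      _ ≤ _ := by
          refine ENNReal.ofReal_le_ofReal ?_
          calc ((grid n).card : ℝ) * (2 * ((n : ℝ) ^ 4)⁻¹)
              ≤ 9 * R ^ 2 * n ^ 2 * (2 * ((n : ℝ) ^ 4)⁻¹) := by gcongr
            _ = _ := by field_simp; ring
  have hsummable : ∑' n, P (bad n) ≠ ∞ := by
    have hs : Summable fun n : ℕ => 18 * (R : ℝ) ^ 2 * (1 / (n : ℝ) ^ 2) :=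
      (Real.summable_one_div_nat_pow.2 (by norm_num)).mul_left _
    refine ne_top_of_le_ne_top ?_ (ENNReal.tsum_le_tsum hbad)
    exact hs.tsum_ofReal_ne_top
  refine ⟨B + 4 + 3 * |D|, ?_⟩
  filter_upwards [ae_eventually_notMem hsummable] with ω hω
  filter_upwards [hω, eventually_ge_atTop n₀] with n hωn hn t ht I hI hIs
  obtain ⟨hA1, ⟨hh1, hh2⟩, hV1, hB1, hD1, hn2⟩ := hn₀ n hn
  have hn2' : (2 : ℝ) ≤ n := by exact_mod_cast hn2
  have hnpos : (0 : ℝ) < n := by linarith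
  have hhpos : 0 < h n := lt_of_lt_of_le (by positivity) hh1
  have hnn : (1 : ℝ) ≤ h n * n := by rwa [div_le_iff₀ hnpos] at hh1
  simp only [bad, hn, if_true, Set.mem_iUnion, Set.mem_ofPred_eq, not_exists, not_le] at hωn
  have hint : ∀ b ∈ s n, ∀ J, MeasurableSet J → Integrable (V n b J) P := fun b hb J hJ =>
    Integrable.of_bound (hmeas n b J hJ).aestronglyMeasurable (A n / Real.log n)
      (ae_of_all _ fun ω => by rw [Real.norm_of_nonneg (h0 n b hb J ω)]; exact hV1 b hb J ω)
  have hfin : (B + 4) * A n + 3 * D / n ≤ (B + 4 + 3 * |D|) * A n := by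
    have h1 : 3 * D / n ≤ 3 * |D| * (1 / n) := by
      rw [mul_one_div]; gcongr; exact le_abs_self D
    have h2 : 3 * |D| * (1 / n) ≤ 3 * |D| * A n := by gcongr
    linarith
  refine le_trans ?_ hfin
  have h2n := neg_abs_le a
  have h3n := le_abs_self b
  have h4n := abs_nonneg a
  have h5n := abs_nonneg b
  refine abs_sub_le_of_grid (N := fun J => ∑ b ∈ s n, V n b J ω)
    (N' := fun J => ∑ b ∈ s n, ∫ ω, V n b J ω ∂P) (by omega : 0 < n)
    (fun J J' _ _ hJ => Finset.sum_le_sum fun b _ => hmono n b J J' ω hJ)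
    (fun J J' hJm hJm' hJ => Finset.sum_le_sum fun b hb =>
      integral_mono (hint b hb J hJm) (hint b hb J' hJm') fun ω => hmono n b J J' ω hJ)
    (fun J J' hJm hJm' => ?_) hD1 (fun k l hkl hk hl => ?_) hI hIs (by linarith)
  · rw [← Finset.sum_add_distrib]
    refine Finset.sum_le_sum fun b hb => ?_
    rw [← integral_add (hint b hb J hJm) (hint b hb J' hJm')]
    exact integral_mono (hint b hb _ (hJm.union hJm')) ((hint b hb J hJm).add (hint b hb J' hJm'))
      fun ω => hsub n b J J' ω
  · have hmem : ((k, l) : ℤ × ℤ) ∈ grid n := by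
      have hk' : (-(R * n : ℤ) : ℝ) ≤ k := by
        push_cast
        nlinarith [ht.1]
      have hl' : (l : ℝ) ≤ (R * n : ℤ) := by
        push_cast
        nlinarith [ht.2]
      have hk'' : (-(R * n : ℤ)) ≤ k := by exact_mod_cast hk'
      have hl'' : l ≤ R * n := by exact_mod_cast hl'
      simp only [grid, Finset.mem_filter, Finset.mem_product, Finset.mem_Icc]
      refine ⟨⟨⟨hk'', by omega⟩, ⟨by omega, hl''⟩⟩, hkl, ?_⟩
      nlinarith
    exact (hωn (k, l) hmem).le

/-! ### Independence of curves and of observations -/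

theorem iIndep_iSup_of_pairwise_disjoint {Ω ι κ : Type*} {mΩ : MeasurableSpace Ω}
    {P : Measure Ω} [IsProbabilityMeasure P] {m : ι → MeasurableSpace Ω} (hle : ∀ i, m i ≤ mΩ)
    (hind : iIndep m P) {S : κ → Set ι} (hS : Pairwise fun k l => Disjoint (S k) (S l)) :
    iIndep (fun k => ⨆ i ∈ S k, m i) P := by
  classical
  rw [iIndep_iff]
  intro s
  induction s using Finset.induction_on with
  | empty => intro f _; simp
  | insert k s hk ih =>
    intro f hf
    rw [Finset.prod_insert hk, Finset.set_biInter_insert,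
      ← ih fun i hi => hf i (Finset.mem_insert_of_mem hi)]
    have hdisj : Disjoint (S k) (⋃ l ∈ s, S l) := by
      rw [Set.disjoint_iUnion₂_right]
      exact fun l hl => hS fun h => hk (h ▸ hl)
    have := indep_iSup_of_disjoint hle hind hdisj
    rw [Indep_iff] at this
    refine this _ _ (hf k (Finset.mem_insert_self _ _)) ?_
    refine Finset.measurableSet_biInter _ fun l hl => ?_
    refine (?_ : (⨆ i ∈ S l, m i) ≤ ⨆ i ∈ ⋃ l ∈ s, S l, m i) _
      (hf l (Finset.mem_insert_of_mem hl))
    exact biSup_mono fun i hi => Set.mem_biUnion hl hi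

section Sources

variable {Ω Ξ : Type*} [MeasurableSpace Ξ] {ζ : ℕ → Ω → Ξ} {T U : ℕ → ℕ → Ω → ℝ}

/-- The σ-algebras generated by the curves, by the observation times and by the errors, as one
family. -/
abbrev source (ζ : ℕ → Ω → Ξ) (T U : ℕ → ℕ → Ω → ℝ) :
    ℕ ⊕ ((ℕ × ℕ) ⊕ (ℕ × ℕ)) → MeasurableSpace Ω :=
  Sum.elim (fun i : ℕ => MeasurableSpace.comap (ζ i) inferInstance)
    (Sum.elim (fun p : ℕ × ℕ => MeasurableSpace.comap (T p.1 p.2) inferInstance)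
      (fun p : ℕ × ℕ => MeasurableSpace.comap (U p.1 p.2) inferInstance))

/-- The σ-algebra of all sources with index in `S`. -/
abbrev sources (ζ : ℕ → Ω → Ξ) (T U : ℕ → ℕ → Ω → ℝ) (S : Set (ℕ ⊕ ((ℕ × ℕ) ⊕ (ℕ × ℕ)))) :
    MeasurableSpace Ω :=
  ⨆ k ∈ S, source ζ T U k

theorem measurable_curve_sources {S : Set (ℕ ⊕ ((ℕ × ℕ) ⊕ (ℕ × ℕ)))} {i : ℕ}
    (h : Sum.inl i ∈ S) : Measurable[sources ζ T U S] (ζ i) :=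
  (comap_measurable (ζ i)).mono (le_biSup (source ζ T U) h) le_rfl

theorem measurable_time_sources {S : Set (ℕ ⊕ ((ℕ × ℕ) ⊕ (ℕ × ℕ)))} {i j : ℕ}
    (h : Sum.inr (Sum.inl (i, j)) ∈ S) : Measurable[sources ζ T U S] (T i j) :=
  (comap_measurable (T i j)).mono (le_biSup (source ζ T U) h) le_rfl

theorem measurable_error_sources {S : Set (ℕ ⊕ ((ℕ × ℕ) ⊕ (ℕ × ℕ)))} {i j : ℕ}
    (h : Sum.inr (Sum.inr (i, j)) ∈ S) : Measurable[sources ζ T U S] (U i j) :=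
  (comap_measurable (U i j)).mono (le_biSup (source ζ T U) h) le_rfl

end Sources

section Model

variable {Ω Ξ : Type*} [mΩ : MeasurableSpace Ω] [MeasurableSpace Ξ] {P : Measure Ω}
  {Q : Measure Ξ} {a b : ℝ} {X : Ξ → ℝ → ℝ} {ζ : ℕ → Ω → Ξ} {fT : ℝ → ℝ}
  {T U : ℕ → ℕ → Ω → ℝ} {m : ℕ → ℕ → ℕ}

theorem IsModel.source_le (hM : IsModel P Q a b X ζ fT T U m) (k) : source ζ T U k ≤ mΩ := by
  rcases k with i | p | p
  · exact (hM.realization i).measurable.comap_le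
  · exact (hM.measurable_time p.1 p.2).comap_le
  · exact (hM.measurable_error p.1 p.2).comap_le

theorem IsModel.indepFun_of_disjoint (hM : IsModel P Q a b X ζ fT T U m) {β γ : Type*}
    [MeasurableSpace β] [MeasurableSpace γ] {f : Ω → β} {g : Ω → γ}
    (S S' : Set (ℕ ⊕ ((ℕ × ℕ) ⊕ (ℕ × ℕ)))) (hS : Disjoint S S')
    (hf : Measurable[sources ζ T U S] f) (hg : Measurable[sources ζ T U S'] g) :
    IndepFun f g P := by
  rw [IndepFun_iff_Indep]
  exact indep_of_indep_of_le (indep_iSup_of_disjoint hM.source_le hM.independent hS)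
    hf.comap_le hg.comap_le

theorem IsModel.iIndepFun_of_disjoint [IsProbabilityMeasure P]
    (hM : IsModel P Q a b X ζ fT T U m) {κ : Type*} {V : κ → Ω → ℝ}
    {S : κ → Set (ℕ ⊕ ((ℕ × ℕ) ⊕ (ℕ × ℕ)))} (hS : Pairwise fun k l => Disjoint (S k) (S l))
    (hV : ∀ k, Measurable[sources ζ T U (S k)] (V k)) : iIndepFun V P := by
  rw [iIndepFun_iff_iIndep]
  exact iIndep_of_iIndep_of_le (iIndep_iSup_of_pairwise_disjoint hM.source_le hM.independent hS)
    fun k => (hV k).comap_le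

theorem IsModel.map_time (hM : IsModel P Q a b X ζ fT T U m) (i j : ℕ) :
    P.map (T i j) = timeLaw a b fT := hM.law_time i j

theorem IsModel.isProbabilityMeasure_timeLaw [IsProbabilityMeasure P]
    (hM : IsModel P Q a b X ζ fT T U m) : IsProbabilityMeasure (timeLaw a b fT) := by
  rw [← hM.map_time 0 0]
  exact Measure.isProbabilityMeasure_map (hM.measurable_time 0 0).aemeasurable

theorem ae_mem_timeLaw : ∀ᵐ t ∂(timeLaw a b fT), t ∈ Set.Icc a b :=
  (withDensity_absolutelyContinuous _ _).ae_le (ae_restrict_mem measurableSet_Icc)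

theorem IsModel.ae_time_mem (hM : IsModel P Q a b X ζ fT T U m) :
    ∀ᵐ ω ∂P, ∀ i j, T i j ω ∈ Set.Icc a b := by
  rw [ae_all_iff]; intro i; rw [ae_all_iff]; intro j
  have := ae_mem_timeLaw (a := a) (b := b) (fT := fT)
  rw [← hM.map_time i j] at this
  exact ae_of_ae_map (hM.measurable_time i j).aemeasurable this

theorem IsModel.integral_time (hM : IsModel P Q a b X ζ fT T U m) (i j : ℕ) {J : Set ℝ}
    (hJ : MeasurableSet J) :
    ∫ ω, J.indicator (1 : ℝ → ℝ) (T i j ω) ∂P = (timeLaw a b fT).real J := by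
  rw [← hM.map_time i j, ← integral_indicator_one hJ,
    integral_map (hM.measurable_time i j).aemeasurable
      (measurable_one.indicator hJ).aestronglyMeasurable]

theorem IsModel.integral_curve (hM : IsModel P Q a b X ζ fT T U m) (i : ℕ) {f : Ξ → ℝ}
    (hf : Measurable f) : ∫ ω, f (ζ i ω) ∂P = ∫ ξ, f ξ ∂Q := by
  rw [← (hM.realization i).map_eq,
    integral_map (hM.realization i).measurable.aemeasurable hf.aestronglyMeasurable]

theorem IsModel.indepFun_curve_time (hM : IsModel P Q a b X ζ fT T U m) (i j : ℕ) :
    IndepFun (ζ i) (T i j) P :=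
  hM.indepFun_of_disjoint {Sum.inl i} {Sum.inr (Sum.inl (i, j))} (by simp)
    (measurable_curve_sources rfl) (measurable_time_sources rfl)

theorem IsModel.map_curve_time [IsProbabilityMeasure P] (hM : IsModel P Q a b X ζ fT T U m)
    (i j : ℕ) : P.map (fun ω => (ζ i ω, T i j ω)) = Q.prod (timeLaw a b fT) := by
  have h := (indepFun_iff_map_prod_eq_prod_map_map (hM.realization i).measurable.aemeasurable
    (hM.measurable_time i j).aemeasurable).1 (hM.indepFun_curve_time i j)
  rw [h, (hM.realization i).map_eq, hM.map_time]

/-- For two distinct observations on one curve, the curve and the two times are independent. -/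
theorem IsModel.integral_curve_time_time [IsProbabilityMeasure P]
    (hM : IsModel P Q a b X ζ fT T U m) (i : ℕ) {j k : ℕ} (hjk : j ≠ k) {f : Ξ → ℝ}
    (hf : Measurable f) {J : Set ℝ} (hJ : MeasurableSet J) :
    ∫ ω, f (ζ i ω) * (J.indicator (1 : ℝ → ℝ) (T i j ω) * J.indicator (1 : ℝ → ℝ) (T i k ω)) ∂P =
      (∫ ξ, f ξ ∂Q) * ((timeLaw a b fT).real J * (timeLaw a b fT).real J) := by
  have hJm : Measurable (J.indicator (1 : ℝ → ℝ)) :=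
    measurable_one.indicator hJ
  have hζ := (hM.realization i).measurable
  have h1 : IndepFun (fun ω => f (ζ i ω)) (fun ω => J.indicator (1 : ℝ → ℝ) (T i j ω) *
      J.indicator (1 : ℝ → ℝ) (T i k ω)) P :=
    hM.indepFun_of_disjoint {Sum.inl i} {Sum.inr (Sum.inl (i, j)), Sum.inr (Sum.inl (i, k))}
      (by simp) (hf.comp (measurable_curve_sources rfl))
      ((hJm.comp (measurable_time_sources (by simp))).mul
        (hJm.comp (measurable_time_sources (by simp))))
  have h2 : IndepFun (fun ω => J.indicator (1 : ℝ → ℝ) (T i j ω))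
      (fun ω => J.indicator (1 : ℝ → ℝ) (T i k ω)) P :=
    hM.indepFun_of_disjoint {Sum.inr (Sum.inl (i, j))} {Sum.inr (Sum.inl (i, k))}
      (by simpa using hjk) (hJm.comp (measurable_time_sources rfl))
      (hJm.comp (measurable_time_sources rfl))
  have mj := hJm.comp (hM.measurable_time i j)
  have mk := hJm.comp (hM.measurable_time i k)
  rw [h1.integral_fun_mul_eq_mul_integral (hf.comp hζ).aestronglyMeasurable
      (mj.mul mk).aestronglyMeasurable,
    h2.integral_fun_mul_eq_mul_integral mj.aestronglyMeasurable mk.aestronglyMeasurable,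
    hM.integral_time i j hJ, hM.integral_time i k hJ, hM.integral_curve i hf]

theorem IsModel.integral_curve_time [IsProbabilityMeasure P]
    (hM : IsModel P Q a b X ζ fT T U m) (i j : ℕ) {f : Ξ → ℝ} (hf : Measurable f) {J : Set ℝ}
    (hJ : MeasurableSet J) :
    ∫ ω, f (ζ i ω) * J.indicator (1 : ℝ → ℝ) (T i j ω) ∂P =
      (∫ ξ, f ξ ∂Q) * (timeLaw a b fT).real J := by
  have hJm : Measurable (J.indicator (1 : ℝ → ℝ)) :=
    measurable_one.indicator hJ
  have hζ := (hM.realization i).measurable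
  have h : IndepFun (fun ω => f (ζ i ω)) (fun ω => J.indicator (1 : ℝ → ℝ) (T i j ω)) P :=
    (hM.indepFun_curve_time i j).comp hf hJm
  rw [h.integral_fun_mul_eq_mul_integral (hf.comp hζ).aestronglyMeasurable
    (hJm.comp (hM.measurable_time i j)).aestronglyMeasurable,
    hM.integral_time i j hJ, hM.integral_curve i hf]

theorem IsModel.integral_error_time [IsProbabilityMeasure P]
    (hM : IsModel P Q a b X ζ fT T U m) (i j : ℕ) {f : ℝ → ℝ} (hf : Measurable f) {J : Set ℝ}
    (hJ : MeasurableSet J) :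
    ∫ ω, f (U i j ω) * J.indicator (1 : ℝ → ℝ) (T i j ω) ∂P =
      (∫ ω, f (U 0 0 ω) ∂P) * (timeLaw a b fT).real J := by
  have hJm : Measurable (J.indicator (1 : ℝ → ℝ)) := measurable_one.indicator hJ
  have h : IndepFun (fun ω => f (U i j ω)) (fun ω => J.indicator (1 : ℝ → ℝ) (T i j ω)) P :=
    hM.indepFun_of_disjoint {Sum.inr (Sum.inr (i, j))} {Sum.inr (Sum.inl (i, j))} (by simp)
      (hf.comp (measurable_error_sources rfl)) (hJm.comp (measurable_time_sources rfl))
  rw [h.integral_fun_mul_eq_mul_integral (hf.comp (hM.measurable_error i j)).aestronglyMeasurable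
    (hJm.comp (hM.measurable_time i j)).aestronglyMeasurable, hM.integral_time i j hJ]
  congr 1
  exact ((hM.identDistrib_error i j).comp hf).integral_eq

theorem IsModel.timeLaw_real_Ioc_le [IsProbabilityMeasure P]
    (hM : IsModel P Q a b X ζ fT T U m) {D : ℝ} (hD0 : 0 ≤ D)
    (hD : ∀ t ∈ Set.Icc a b, fT t ≤ D) {x y : ℝ} (hxy : x ≤ y) :
    (timeLaw a b fT).real (Set.Ioc x y) ≤ D * (y - x) := by
  have := hM.isProbabilityMeasure_timeLaw
  have h := timeLaw_le hD (Set.Ioc x y) measurableSet_Ioc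
  rw [Real.volume_Ioc, ← ENNReal.ofReal_mul hD0] at h
  exact ENNReal.toReal_le_of_le_ofReal (mul_nonneg hD0 (sub_nonneg.2 hxy)) h

end Model

/-! ### Rates -/

/-- `h² + h / γ`, the order of the second moment of the mass that a curve puts on a window. -/
noncomputable def spread (h : ℕ → ℝ) (m : ℕ → ℕ → ℕ) (n : ℕ) : ℝ :=
  h n ^ 2 + h n / harmonicMean n (m n)

/-- The order of the uniform deviations of the interval masses, `(log n / n * (h² + h / γ))^{1/2}`.
-/
noncomputable def devRate (h : ℕ → ℝ) (m : ℕ → ℕ → ℕ) (n : ℕ) : ℝ :=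
  Real.sqrt (Real.log n / n * spread h m n)

/-- The level at which curves and errors are truncated. -/
noncomputable def truncLevel (h : ℕ → ℝ) (m : ℕ → ℕ → ℕ) (n : ℕ) : ℝ :=
  n * devRate h m n / Real.log n

theorem div_harmonicMean (x : ℝ) (n : ℕ) (m : ℕ → ℕ) :
    x / harmonicMean n m = x * ((n : ℝ)⁻¹ * ∑ i ∈ Finset.range n, (m i : ℝ)⁻¹) := by
  rw [harmonicMean, div_inv_eq_mul]

theorem inv_harmonicMean_le_one {n : ℕ} {m : ℕ → ℕ} :
    (n : ℝ)⁻¹ * ∑ i ∈ Finset.range n, (m i : ℝ)⁻¹ ≤ 1 := by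
  have h1 : ∑ i ∈ Finset.range n, (m i : ℝ)⁻¹ ≤ n := by
    have : ∑ i ∈ Finset.range n, (m i : ℝ)⁻¹ ≤ ∑ i ∈ Finset.range n, (1 : ℝ) :=
      Finset.sum_le_sum fun i _ => Nat.cast_inv_le_one _
    simpa using this
  calc (n : ℝ)⁻¹ * ∑ i ∈ Finset.range n, (m i : ℝ)⁻¹ ≤ (n : ℝ)⁻¹ * n := by gcongr
    _ ≤ 1 := inv_mul_le_one

theorem sq_le_spread {h : ℕ → ℝ} {m : ℕ → ℕ → ℕ} {n : ℕ} (hh : 0 < h n) :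
    h n ^ 2 ≤ spread h m n := by
  rw [spread, div_harmonicMean]
  have : 0 ≤ h n * ((n : ℝ)⁻¹ * ∑ i ∈ Finset.range n, (m n i : ℝ)⁻¹) := by positivity
  linarith

theorem spread_pos {h : ℕ → ℝ} {m : ℕ → ℕ → ℕ} {n : ℕ} (hh : 0 < h n) : 0 < spread h m n :=
  lt_of_lt_of_le (by positivity) (sq_le_spread hh)

theorem spread_le_sq_add {h : ℕ → ℝ} {m : ℕ → ℕ → ℕ} {n : ℕ} (hh : 0 < h n) :
    spread h m n ≤ h n ^ 2 + h n := by
  rw [spread, div_harmonicMean]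
  have := mul_le_mul_of_nonneg_left (inv_harmonicMean_le_one (n := n) (m := m n)) hh.le
  linarith

theorem devRate_sq {h : ℕ → ℝ} {m : ℕ → ℕ → ℕ} {n : ℕ} (hh : 0 < h n) :
    devRate h m n ^ 2 = Real.log n / n * spread h m n :=
  Real.sq_sqrt (mul_nonneg (div_nonneg (Real.log_natCast_nonneg n) n.cast_nonneg)
    (spread_pos hh).le)

theorem tendsto_log_div_self : Tendsto (fun n : ℕ => Real.log n / n) atTop (𝓝 0) :=
  (Real.isLittleO_log_id_atTop.tendsto_div_nhds_zero).comp tendsto_natCast_atTop_atTop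

theorem eventually_one_le_log : ∀ᶠ n : ℕ in atTop, 1 ≤ Real.log n :=
  (Real.tendsto_log_atTop.comp tendsto_natCast_atTop_atTop).eventually_ge_atTop 1

section Rates

variable {h : ℕ → ℝ} {m : ℕ → ℕ → ℕ} {p : ℝ}

theorem BandwidthCondition.eventually_le_spread (hh : BandwidthCondition h m p) {c : ℝ}
    (hc : 0 < c) :
    ∀ᶠ n : ℕ in atTop, c * (Real.log n / n) ^ (1 - 2 / p) ≤ spread h m n := by
  filter_upwards [hh.rate.eventually (gt_mem_nhds (inv_pos.2 hc))] with n hn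
  have hs : 0 < spread h m n := spread_pos (hh.pos n)
  change (spread h m n)⁻¹ * (Real.log n / n) ^ (1 - 2 / p) < c⁻¹ at hn
  rw [inv_mul_lt_iff₀ hs, lt_mul_inv_iff₀ hc] at hn
  linarith

/-- `x ^ s ≥ x` for `0 ≤ x ≤ 1` and `s ≤ 1`, along `x = log n / n`. -/
theorem eventually_log_div_le_rpow {s : ℝ} (hs : s ≤ 1) :
    ∀ᶠ n : ℕ in atTop, Real.log n / n ≤ (Real.log n / n) ^ s := by
  filter_upwards [eventually_one_le_log, tendsto_log_div_self.eventually (gt_mem_nhds one_pos),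
    eventually_gt_atTop 0] with n h1 h2 h3
  have h3' : (0 : ℝ) < n := Nat.cast_pos.2 h3
  have hx : 0 < Real.log n / n := by positivity
  calc Real.log n / n = (Real.log n / n) ^ (1 : ℝ) := (Real.rpow_one _).symm
    _ ≤ _ := Real.rpow_le_rpow_of_exponent_ge hx h2.le hs

theorem BandwidthCondition.eventually_log_div_le_spread (hh : BandwidthCondition h m p)
    (hp : 2 < p) {c : ℝ} (hc : 0 < c) :
    ∀ᶠ n : ℕ in atTop, c * (Real.log n / n) ≤ spread h m n := by
  have h1 : 1 - 2 / p ≤ 1 := by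
    have : 0 < 2 / p := by positivity
    linarith
  filter_upwards [hh.eventually_le_spread hc, eventually_log_div_le_rpow h1] with n h2 h3
  exact (mul_le_mul_of_nonneg_left h3 hc.le).trans h2

theorem BandwidthCondition.eventually_log_div_le (hh : BandwidthCondition h m p) (hp : 2 < p)
    {c : ℝ} (hc : 0 < c) : ∀ᶠ n : ℕ in atTop, c * (Real.log n / n) ≤ h n := by
  filter_upwards [hh.eventually_log_div_le_spread hp (c := 2 * c) (by positivity),
    hh.tendsto_zero.eventually (gt_mem_nhds one_pos)] with n h1 h2
  have := hh.pos n
  have h3 := spread_le_sq_add (m := m) this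
  nlinarith

theorem BandwidthCondition.eventually_bandwidth (hh : BandwidthCondition h m p) (hp : 2 < p) :
    ∀ᶠ n : ℕ in atTop, (1 : ℝ) / n ≤ h n ∧ h n ≤ 1 := by
  filter_upwards [hh.eventually_log_div_le hp one_pos, eventually_one_le_log,
    hh.tendsto_zero.eventually (gt_mem_nhds one_pos)] with n h1 h2 h3
  refine ⟨le_trans ?_ h1, h3.le⟩
  rw [one_mul]
  gcongr

theorem BandwidthCondition.eventually_one_div_le_devRate (hh : BandwidthCondition h m p)
    (hp : 2 < p) : ∀ᶠ n : ℕ in atTop, (1 : ℝ) / n ≤ devRate h m n := by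
  filter_upwards [hh.eventually_log_div_le_spread hp one_pos, eventually_one_le_log] with n h1 h2
  refine Real.le_sqrt_of_sq_le ?_
  have h3 : (1 : ℝ) / n ≤ Real.log n / n := by gcongr
  have h4 : (0 : ℝ) ≤ 1 / n := by positivity
  rw [sq]
  exact mul_le_mul h3 (by linarith) h4 (h4.trans h3)

/-- The truncation error `Q ^ (1 - p)` at level `Q` is of no larger order than the deviations: this
is what the bandwidth condition is for. -/
theorem BandwidthCondition.eventually_truncLevel_rpow_le (hh : BandwidthCondition h m p)
    (hp : 2 < p) : ∀ᶠ n : ℕ in atTop,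
      0 < truncLevel h m n ∧ truncLevel h m n ^ (1 - p) ≤ devRate h m n := by
  filter_upwards [hh.eventually_le_spread one_pos, eventually_one_le_log,
    eventually_gt_atTop 0] with n h1 h2 h3
  have h3' : (0 : ℝ) < n := Nat.cast_pos.2 h3
  have hlog : 0 < Real.log n := by linarith
  have hs : 0 < spread h m n := spread_pos (hh.pos n)
  set x := Real.log n / n with hx
  have hx0 : 0 < x := by positivity
  set g := spread h m n with hg
  have hA : devRate h m n = (x * g) ^ (1 / 2 : ℝ) := Real.sqrt_eq_rpow _
  have hQ : truncLevel h m n = x⁻¹ * devRate h m n := by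
    rw [truncLevel, hx]; field_simp
  have hA0 : 0 < devRate h m n := by rw [hA]; positivity
  refine ⟨by rw [hQ]; positivity, ?_⟩
  rw [one_mul] at h1
  -- `Q = x^{-1/2} g^{1/2}`, so the claim says `x^{p/2 - 1} ≤ g^{p/2}`
  have key : x ^ (p / 2 - 1) ≤ g ^ (p / 2) := by
    have h4 := Real.rpow_le_rpow (by positivity) h1 (by linarith : 0 ≤ p / 2)
    rw [← Real.rpow_mul hx0.le] at h4
    convert! h4 using 2
    field_simp
  have e1 : truncLevel h m n ^ (1 - p) = x ^ (p / 2 - 1) * x ^ (1 / 2 : ℝ) * g ^ ((1 - p) / 2) := by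
    rw [hQ, hA, Real.mul_rpow (by positivity) (by positivity), ← Real.rpow_mul (by positivity),
      Real.mul_rpow hx0.le hs.le, Real.inv_rpow hx0.le, ← Real.rpow_neg hx0.le, ← mul_assoc,
      ← Real.rpow_add hx0, ← Real.rpow_add hx0]
    congr 2 <;> ring
  have e2 : devRate h m n = g ^ (p / 2) * x ^ (1 / 2 : ℝ) * g ^ ((1 - p) / 2) := by
    rw [hA, Real.mul_rpow hx0.le hs.le, mul_comm (g ^ (p / 2)), mul_assoc, ← Real.rpow_add hs]
    congr 2; ring
  rw [e1, e2]
  gcongr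

theorem sub_min_le_rpow {x B q : ℝ} (hp : 1 ≤ p) (hx : 0 ≤ x) (hxB : x ≤ B) (hq : 0 < q) :
    x - min x q ≤ B ^ p * q ^ (1 - p) := by
  have hB : 0 ≤ B := hx.trans hxB
  rcases le_total x q with h | h
  · rw [min_eq_left h, sub_self]; positivity
  · have hBq : q ≤ B := h.trans hxB
    have hB0 : 0 < B := hq.trans_le hBq
    calc x - min x q ≤ B := by rw [min_eq_right h]; linarith
      _ = B ^ p * B ^ (1 - p) := by
        rw [← Real.rpow_add hB0]; simp
      _ ≤ B ^ p * q ^ (1 - p) := by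
        refine mul_le_mul_of_nonneg_left ?_ (by positivity)
        exact Real.rpow_le_rpow_of_nonpos hq hBq (by linarith)

end Rates

/-! ### Empirical averages over the observations -/

/-- The indices `(i, j)`, `i < n`, `j < m i`, of the observations. -/
def pairs (n : ℕ) (m : ℕ → ℕ) : Finset ((_ : ℕ) × ℕ) :=
  (Finset.range n).sigma fun i => Finset.range (m i)

/-- The weight `1 / (n m i)` of an observation on curve `i`. -/
noncomputable def pairWeight (n : ℕ) (m : ℕ → ℕ) (q : (_ : ℕ) × ℕ) : ℝ :=
  (n : ℝ)⁻¹ * (m q.1 : ℝ)⁻¹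

theorem pairWeight_nonneg (n : ℕ) (m : ℕ → ℕ) (q : (_ : ℕ) × ℕ) : 0 ≤ pairWeight n m q := by
  unfold pairWeight; positivity

theorem sum_pairs (n : ℕ) (m : ℕ → ℕ) (f : ((_ : ℕ) × ℕ) → ℝ) :
    ∑ q ∈ pairs n m, pairWeight n m q * f q =
      ∑ i ∈ Finset.range n, (n : ℝ)⁻¹ * (m i : ℝ)⁻¹ * ∑ j ∈ Finset.range (m i), f ⟨i, j⟩ := by
  rw [pairs, Finset.sum_sigma]
  exact Finset.sum_congr rfl fun i _ => by rw [Finset.mul_sum]; rfl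

theorem sum_pairWeight_mul_const {n : ℕ} {m : ℕ → ℕ} (hn : 0 < n) (hm : ∀ i < n, 0 < m i)
    (c : ℝ) : ∑ q ∈ pairs n m, pairWeight n m q * c = c := by
  have hn' : (n : ℝ) ≠ 0 := by positivity
  rw [sum_pairs]
  have : ∀ i ∈ Finset.range n, (n : ℝ)⁻¹ * (m i : ℝ)⁻¹ * ∑ j ∈ Finset.range (m i), c =
      (n : ℝ)⁻¹ * c := by
    intro i hi
    have : (m i : ℝ) ≠ 0 := by
      have := hm i (Finset.mem_range.1 hi)
      positivity
    simp only [Finset.sum_const, Finset.card_range, nsmul_eq_mul]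
    field_simp
  rw [Finset.sum_congr rfl this]
  simp only [Finset.sum_const, Finset.card_range, nsmul_eq_mul]
  field_simp

theorem indicator_one_mono {I J : Set ℝ} (h : I ⊆ J) (x : ℝ) :
    I.indicator (1 : ℝ → ℝ) x ≤ J.indicator 1 x :=
  Set.indicator_le_indicator_of_subset h (fun _ => zero_le_one) x

theorem indicator_one_union_le (I J : Set ℝ) (x : ℝ) :
    (I ∪ J).indicator (1 : ℝ → ℝ) x ≤ I.indicator 1 x + J.indicator 1 x := by
  classical
  by_cases h1 : x ∈ I <;> by_cases h2 : x ∈ J <;> simp [h1, h2]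

theorem indicator_one_nonneg (I : Set ℝ) (x : ℝ) : 0 ≤ I.indicator (1 : ℝ → ℝ) x :=
  Set.indicator_nonneg (fun _ _ => zero_le_one) x

theorem indicator_one_le_one (I : Set ℝ) (x : ℝ) : I.indicator (1 : ℝ → ℝ) x ≤ 1 := by
  classical
  by_cases h : x ∈ I <;> simp [h]

theorem truncLevel_nonneg (h : ℕ → ℝ) (m : ℕ → ℕ → ℕ) (n : ℕ) : 0 ≤ truncLevel h m n := by
  have := Real.log_natCast_nonneg n
  unfold truncLevel devRate
  positivity

/-! ### Deviations of averages over the curves -/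

section Curves

variable {Ω Ξ : Type*} [mΩ : MeasurableSpace Ω] [MeasurableSpace Ξ] {P : Measure Ω}
  {Q : Measure Ξ} {a b : ℝ} {X : Ξ → ℝ → ℝ} {ζ : ℕ → Ω → Ξ} {fT : ℝ → ℝ}
  {T U : ℕ → ℕ → Ω → ℝ} {m : ℕ → ℕ → ℕ}

theorem IsModel.ae_curve_le (hM : IsModel P Q a b X ζ fT T U m) {Ψ : Ξ → ℝ → ℝ} {B : Ξ → ℝ}
    (hB : ∀ᵐ ξ ∂Q, ∀ t ∈ Set.Icc a b, Ψ ξ t ≤ B ξ) :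
    ∀ᵐ ω ∂P, ∀ i j, Ψ (ζ i ω) (T i j ω) ≤ B (ζ i ω) := by
  have h1 : ∀ᵐ ω ∂P, ∀ i, ∀ t ∈ Set.Icc a b, Ψ (ζ i ω) t ≤ B (ζ i ω) :=
    ae_all_iff.2 fun i => (hM.realization i).quasiMeasurePreserving.ae hB
  filter_upwards [h1, hM.ae_time_mem] with ω hω hT i j
  exact hω i _ (hT i j)

theorem ae_prod_timeLaw_le [IsProbabilityMeasure (timeLaw a b fT)] {Ψ : Ξ → ℝ → ℝ} {B : Ξ → ℝ}
    (hB : ∀ᵐ ξ ∂Q, ∀ t ∈ Set.Icc a b, Ψ ξ t ≤ B ξ) :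
    ∀ᵐ z ∂(Q.prod (timeLaw a b fT)), Ψ z.1 z.2 ≤ B z.1 := by
  filter_upwards [Measure.quasiMeasurePreserving_fst.ae hB,
    Measure.quasiMeasurePreserving_snd.ae (ae_mem_timeLaw (a := a) (b := b) (fT := fT))]
    with z hz1 hz2
  exact hz1 _ hz2

/-- Second moment of the mass of one curve: `k` diagonal terms of order `ν J` and at most `k ^ 2`
off-diagonal terms of order `(ν J) ^ 2`. -/
theorem IsModel.integral_sum_curve_sq_le [IsProbabilityMeasure P]
    (hM : IsModel P Q a b X ζ fT T U m) {B : Ξ → ℝ}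
    (hBm : Measurable B) (hB2 : Integrable (fun ξ => B ξ ^ 2) Q) (i k : ℕ)
    {φ : ℕ → Ω → ℝ} {J : Set ℝ} (hJ : MeasurableSet J) (hφ0 : ∀ j ω, 0 ≤ φ j ω)
    (hφ : ∀ᵐ ω ∂P, ∀ j, φ j ω ≤ B (ζ i ω) * J.indicator 1 (T i j ω)) :
    ∫ ω, (∑ j ∈ Finset.range k, φ j ω) ^ 2 ∂P ≤
      (∫ ξ, B ξ ^ 2 ∂Q) * (k * (timeLaw a b fT).real J + k ^ 2 * (timeLaw a b fT).real J ^ 2) := by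
  set ν := timeLaw a b fT
  have hJm : Measurable (J.indicator (1 : ℝ → ℝ)) := measurable_one.indicator hJ
  have hB2ζ : Integrable (fun ω => B (ζ i ω) ^ 2) P :=
    ((hM.realization i).integrable_comp hB2.aestronglyMeasurable).2 hB2
  have hint : ∀ j l, Integrable (fun ω => B (ζ i ω) ^ 2 *
      (J.indicator (1 : ℝ → ℝ) (T i j ω) * J.indicator (1 : ℝ → ℝ) (T i l ω))) P := by
    intro j l
    refine hB2ζ.mul_bdd (c := 1) ((hJm.comp (hM.measurable_time i j)).mul
      (hJm.comp (hM.measurable_time i l))).aestronglyMeasurable (ae_of_all _ fun ω => ?_)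
    rw [Real.norm_of_nonneg (mul_nonneg (indicator_one_nonneg _ _) (indicator_one_nonneg _ _))]
    exact mul_le_one₀ (indicator_one_le_one _ _) (indicator_one_nonneg _ _)
      (indicator_one_le_one _ _)
  have hexp : ∀ ω, (∑ j ∈ Finset.range k, B (ζ i ω) * J.indicator (1 : ℝ → ℝ) (T i j ω)) ^ 2 =
      ∑ j ∈ Finset.range k, ∑ l ∈ Finset.range k, B (ζ i ω) ^ 2 *
        (J.indicator (1 : ℝ → ℝ) (T i j ω) * J.indicator (1 : ℝ → ℝ) (T i l ω)) := by
    intro ω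
    rw [sq, Finset.sum_mul_sum]
    exact Finset.sum_congr rfl fun j _ => Finset.sum_congr rfl fun l _ => by ring
  have hβ : 0 ≤ ∫ ξ, B ξ ^ 2 ∂Q := integral_nonneg fun ξ => sq_nonneg _
  have hterm : ∀ j l, ∫ ω, B (ζ i ω) ^ 2 *
      (J.indicator (1 : ℝ → ℝ) (T i j ω) * J.indicator (1 : ℝ → ℝ) (T i l ω)) ∂P ≤
      (if j = l then (∫ ξ, B ξ ^ 2 ∂Q) * ν.real J else 0) +
        (∫ ξ, B ξ ^ 2 ∂Q) * ν.real J ^ 2 := by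
    intro j l
    split_ifs with hjl
    · subst hjl
      have e : ∀ ω, J.indicator (1 : ℝ → ℝ) (T i j ω) * J.indicator (1 : ℝ → ℝ) (T i j ω) =
          J.indicator (1 : ℝ → ℝ) (T i j ω) := fun ω => by
        by_cases h : T i j ω ∈ J <;> simp [h]
      simp_rw [e]
      rw [hM.integral_curve_time i j (f := fun ξ => B ξ ^ 2) (hBm.pow_const 2) hJ]
      have : 0 ≤ (∫ ξ, B ξ ^ 2 ∂Q) * ν.real J ^ 2 := by positivity
      linarith
    · rw [hM.integral_curve_time_time i hjl (f := fun ξ => B ξ ^ 2) (hBm.pow_const 2) hJ]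
      exact le_of_eq (by ring)
  calc ∫ ω, (∑ j ∈ Finset.range k, φ j ω) ^ 2 ∂P
      ≤ ∫ ω, (∑ j ∈ Finset.range k, B (ζ i ω) * J.indicator (1 : ℝ → ℝ) (T i j ω)) ^ 2 ∂P := by
        refine integral_mono_of_nonneg (ae_of_all _ fun ω => sq_nonneg _) ?_ ?_
        · simp_rw [hexp]
          exact integrable_finsetSum _ fun j _ => integrable_finsetSum _ fun l _ => hint j l
        · filter_upwards [hφ] with ω hω
          exact pow_le_pow_left₀ (Finset.sum_nonneg fun j _ => hφ0 j ω)
            (Finset.sum_le_sum fun j _ => hω j) 2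
    _ = ∑ j ∈ Finset.range k, ∑ l ∈ Finset.range k, ∫ ω, B (ζ i ω) ^ 2 *
        (J.indicator (1 : ℝ → ℝ) (T i j ω) * J.indicator (1 : ℝ → ℝ) (T i l ω)) ∂P := by
        simp_rw [hexp]
        rw [integral_finsetSum _ fun j _ => integrable_finsetSum _ fun l _ => hint j l]
        exact Finset.sum_congr rfl fun j _ => integral_finsetSum _ fun l _ => hint j l
    _ ≤ ∑ j ∈ Finset.range k, ∑ l ∈ Finset.range k,
        ((if j = l then (∫ ξ, B ξ ^ 2 ∂Q) * ν.real J else 0) +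
        (∫ ξ, B ξ ^ 2 ∂Q) * ν.real J ^ 2) :=
        Finset.sum_le_sum fun j _ => Finset.sum_le_sum fun l _ => hterm j l
    _ = _ := by
        simp only [Finset.sum_add_distrib, Finset.sum_ite_eq, Finset.sum_const, Finset.card_range,
          nsmul_eq_mul]
        rw [Finset.sum_congr rfl (g := fun _ => (∫ ξ, B ξ ^ 2 ∂Q) * ν.real J)
          fun j hj => by rw [if_pos hj]]
        simp only [Finset.sum_const, Finset.card_range, nsmul_eq_mul]
        ring

/-- Averages of `p`-th powers of an envelope over the curves stay bounded, by the strong law. -/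
theorem IsModel.ae_eventually_average_le (hM : IsModel P Q a b X ζ fT T U m) {f : Ξ → ℝ}
    (hf : Measurable f) (hfi : Integrable f Q) :
    ∀ᵐ ω ∂P, ∀ᶠ n : ℕ in atTop,
      (n : ℝ)⁻¹ * ∑ i ∈ Finset.range n, f (ζ i ω) ≤ (∫ ξ, f ξ ∂Q) + 1 := by
  have hid : ∀ i, IdentDistrib (fun ω => f (ζ i ω)) (fun ω => f (ζ 0 ω)) P P := by
    intro i
    have : IdentDistrib (ζ i) (ζ 0) P P :=
      ⟨(hM.realization i).measurable.aemeasurable, (hM.realization 0).measurable.aemeasurable,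
        by rw [(hM.realization i).map_eq, (hM.realization 0).map_eq]⟩
    exact this.comp hf
  have hind : Pairwise fun i j => IndepFun (fun ω => f (ζ i ω)) (fun ω => f (ζ j ω)) P := by
    intro i j hij
    exact hM.indepFun_of_disjoint {Sum.inl i} {Sum.inl j} (by simpa using hij)
      (hf.comp (measurable_curve_sources rfl)) (hf.comp (measurable_curve_sources rfl))
  have := strong_law_ae_real (fun i ω => f (ζ i ω))
    (((hM.realization 0).integrable_comp hfi.aestronglyMeasurable).2 hfi) hind hid
  filter_upwards [this] with ω hω
  rw [hM.integral_curve 0 hf] at hω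
  filter_upwards [hω.eventually (gt_mem_nhds (lt_add_one _))] with n hn
  rw [← div_eq_inv_mul]
  exact hn.le

/-- **Uniform deviations over the curves.** For a nonnegative functional `Ψ` of curve and time with
an envelope in `L^p`, the empirical masses of all intervals in all windows are almost surely within
`O(devRate)` of their means. -/
theorem IsModel.ae_curve_deviation [IsProbabilityMeasure P] [IsProbabilityMeasure Q]
    (hM : IsModel P Q a b X ζ fT T U m)
    (hfT : DensityCondition a b fT) {h : ℕ → ℝ} {p : ℝ} (hp : 2 < p)
    (hh : BandwidthCondition h m p) {Ψ : Ξ → ℝ → ℝ} {B : Ξ → ℝ}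
    (hΨ : Measurable (Function.uncurry Ψ)) (hΨ0 : ∀ ξ t, 0 ≤ Ψ ξ t) (hBm : Measurable B)
    (hB0 : ∀ ξ, 0 ≤ B ξ) (hBp : MemLp B (ENNReal.ofReal p) Q)
    (hB : ∀ᵐ ξ ∂Q, ∀ t ∈ Set.Icc a b, Ψ ξ t ≤ B ξ) :
    ∃ C : ℝ, ∀ᵐ ω ∂P, ∀ᶠ n in atTop, ∀ t ∈ Set.Icc a b, ∀ I : Set ℝ, I.OrdConnected →
      I ⊆ Set.Icc (t - h n) (t + h n) →
      |∑ q ∈ pairs n (m n), pairWeight n (m n) q *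
          (Ψ (ζ q.1 ω) (T q.1 q.2 ω) * I.indicator 1 (T q.1 q.2 ω)) -
        ∫ z, Ψ z.1 z.2 * I.indicator 1 z.2 ∂(Q.prod (timeLaw a b fT))| ≤ C * devRate h m n := by
  have hνp := hM.isProbabilityMeasure_timeLaw
  obtain ⟨⟨c, D, hc, hcD⟩, -, -⟩ := hfT
  have hD0 : 0 ≤ D := hc.le.trans ((hcD a ⟨le_rfl, hM.lt.le⟩).1.trans (hcD a ⟨le_rfl, hM.lt.le⟩).2)
  have hνI : ∀ {x y : ℝ}, x ≤ y → (timeLaw a b fT).real (Set.Ioc x y) ≤ D * (y - x) := fun hxy =>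
    hM.timeLaw_real_Ioc_le hD0 (fun t ht => (hcD t ht).2) hxy
  set ν := timeLaw a b fT with hν
  have hp0 : ENNReal.ofReal p ≠ 0 := by simp; linarith
  have hB2 : Integrable (fun ξ => B ξ ^ 2) Q := by
    refine (hBp.mono_exponent ?_).integrable_sq
    rw [← ENNReal.ofReal_ofNat]
    exact ENNReal.ofReal_le_ofReal hp.le
  have hB1 : Integrable B Q := by
    refine memLp_one_iff_integrable.1 (hBp.mono_exponent ?_)
    rw [← ENNReal.ofReal_one]
    exact ENNReal.ofReal_le_ofReal (by linarith)
  have hBpi : Integrable (fun ξ => B ξ ^ p) Q := by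
    have := hBp.integrable_norm_rpow hp0 ENNReal.ofReal_ne_top
    rw [ENNReal.toReal_ofReal (by linarith)] at this
    simpa only [Real.norm_of_nonneg (hB0 _)] using this
  have hBpm : Measurable (fun ξ => B ξ ^ p) := hBm.pow_const p
  set β := ∫ ξ, B ξ ^ 2 ∂Q with hβdef
  have hβ0 : 0 ≤ β := integral_nonneg fun ξ => sq_nonneg _
  -- truncated masses
  let φ : ℕ → ℕ → ℕ → Set ℝ → Ω → ℝ := fun n i j J ω =>
    min (Ψ (ζ i ω) (T i j ω)) (truncLevel h m n) * J.indicator 1 (T i j ω)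
  let V : ℕ → ℕ → Set ℝ → Ω → ℝ := fun n i J ω =>
    (n : ℝ)⁻¹ * (m n i : ℝ)⁻¹ * ∑ j ∈ Finset.range (m n i), φ n i j J ω
  have hmin0 : ∀ n i j ω, 0 ≤ min (Ψ (ζ i ω) (T i j ω)) (truncLevel h m n) := fun n i j ω =>
    le_min (hΨ0 _ _) (truncLevel_nonneg h m n)
  have hφ0 : ∀ n i j J ω, 0 ≤ φ n i j J ω := fun n i j J ω =>
    mul_nonneg (hmin0 n i j ω) (indicator_one_nonneg _ _)
  have hφm : ∀ (mΩ' : MeasurableSpace Ω) n i j J, MeasurableSet J → Measurable[mΩ'] (ζ i) →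
      Measurable[mΩ'] (T i j) → Measurable[mΩ'] (φ n i j J) := by
    intro mΩ' n i j J hJ hζ hT
    have h1 : Measurable[mΩ'] fun ω => Ψ (ζ i ω) (T i j ω) := hΨ.comp (hζ.prodMk hT)
    exact (h1.min measurable_const).mul ((measurable_one.indicator hJ).comp hT)
  have hVm : ∀ (mΩ' : MeasurableSpace Ω) n i J, MeasurableSet J → Measurable[mΩ'] (ζ i) →
      (∀ j, Measurable[mΩ'] (T i j)) → Measurable[mΩ'] (V n i J) := by
    intro mΩ' n i J hJ hζ hT
    exact (Finset.measurable_sum _ fun j _ => hφm mΩ' n i j J hJ hζ (hT j)).const_mul _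
  have hφB : ∀ᵐ ω ∂P, ∀ n i j J, φ n i j J ω ≤ B (ζ i ω) * J.indicator 1 (T i j ω) := by
    filter_upwards [hM.ae_curve_le hB] with ω hω n i j J
    exact mul_le_mul_of_nonneg_right ((min_le_left _ _).trans (hω i j)) (indicator_one_nonneg _ _)
  have hφi : ∀ n i j J, MeasurableSet J → Integrable (φ n i j J) P := by
    intro n i j J hJ
    refine Integrable.of_bound (hφm _ n i j J hJ (hM.realization i).measurable
      (hM.measurable_time i j)).aestronglyMeasurable (truncLevel h m n) (ae_of_all _ fun ω => ?_)
    rw [Real.norm_of_nonneg (hφ0 _ _ _ _ _)]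
    exact (mul_le_of_le_one_right (hmin0 _ _ _ _) (indicator_one_le_one _ _)).trans
      (min_le_right _ _)
  have hVi : ∀ n i J, MeasurableSet J →
      ∫ ω, V n i J ω ∂P =
        (n : ℝ)⁻¹ * (m n i : ℝ)⁻¹ * ∑ j ∈ Finset.range (m n i), ∫ ω, φ n i j J ω ∂P := by
    intro n i J hJ
    rw [integral_const_mul, integral_finsetSum _ fun j _ => hφi n i j J hJ]
  have hmpos : ∀ n i, i < n → (0 : ℝ) < m n i := fun n i hi => by
    have := hM.two_le n i hi
    exact_mod_cast (by omega : 0 < m n i)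
  obtain ⟨C, hC⟩ : ∃ C : ℝ, ∀ᵐ ω ∂P, ∀ᶠ n in atTop, ∀ t ∈ Set.Icc a b, ∀ I : Set ℝ,
      I.OrdConnected → I ⊆ Set.Icc (t - h n) (t + h n) →
      |∑ i ∈ Finset.range n, V n i I ω - ∑ i ∈ Finset.range n, ∫ ω, V n i I ω ∂P| ≤
        C * devRate h m n := by
    refine exists_ae_eventually_abs_sum_sub_le (P := P) (fun n => Finset.range n) V
      (devRate h m) h a b (β * (4 * D + 16 * D ^ 2)) ((∫ ξ, B ξ ∂Q) * D) ?_ ?_ ?_ ?_ ?_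
      (hh.eventually_one_div_le_devRate hp) (hh.eventually_bandwidth hp) ?_ ?_ ?_
    · intro n i I J ω hIJ
      refine mul_le_mul_of_nonneg_left (Finset.sum_le_sum fun j _ => ?_) (by positivity)
      exact mul_le_mul_of_nonneg_left (indicator_one_mono hIJ _) (hmin0 _ _ _ _)
    · intro n i I J ω
      simp only [V]
      rw [← mul_add, ← Finset.sum_add_distrib]
      refine mul_le_mul_of_nonneg_left (Finset.sum_le_sum fun j _ => ?_) (by positivity)
      simp only [φ]
      rw [← mul_add]
      exact mul_le_mul_of_nonneg_left (indicator_one_union_le _ _ _) (hmin0 _ _ _ _)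
    · exact fun n i J hJ => hVm _ n i J hJ (hM.realization i).measurable (hM.measurable_time i)
    · intro n x y
      refine hM.iIndepFun_of_disjoint (S := fun i : ℕ =>
        {k | k = Sum.inl i ∨ ∃ j, k = Sum.inr (Sum.inl (i, j))}) ?_ fun i => ?_
      · intro i i' hii'
        rw [Set.disjoint_left]
        rintro k (rfl | ⟨j, rfl⟩) <;> simp [hii']
      · exact hVm _ n i _ measurableSet_Ioc (measurable_curve_sources (Or.inl rfl))
          fun j => measurable_time_sources (Or.inr ⟨j, rfl⟩)
    · exact fun n i _ J ω => mul_nonneg (by positivity) (Finset.sum_nonneg fun j _ => hφ0 _ _ _ _ _)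
    · filter_upwards [eventually_gt_atTop 0] with n hn i hi J ω
      have hmi := hmpos n i (Finset.mem_range.1 hi)
      have hn' : (0 : ℝ) < n := Nat.cast_pos.2 hn
      calc V n i J ω ≤ (n : ℝ)⁻¹ * (m n i : ℝ)⁻¹ * ∑ j ∈ Finset.range (m n i), truncLevel h m n := by
            refine mul_le_mul_of_nonneg_left (Finset.sum_le_sum fun j _ => ?_) (by positivity)
            exact (mul_le_of_le_one_right (hmin0 _ _ _ _) (indicator_one_le_one _ _)).trans
              (min_le_right _ _)
        _ = devRate h m n / Real.log n := by
            simp only [Finset.sum_const, Finset.card_range, nsmul_eq_mul, truncLevel]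
            field_simp
    · filter_upwards [eventually_gt_atTop 0, eventually_one_le_log, hh.eventually_bandwidth hp]
        with n hn hlog hbw x y hxy hlen
      have hn' : (0 : ℝ) < n := Nat.cast_pos.2 hn
      have hh0 := hh.pos n
      set r := ν.real (Set.Ioc x y) with hr
      have hr0 : 0 ≤ r := measureReal_nonneg
      have hrle : r ≤ 4 * D * h n := (hνI hxy).trans (by nlinarith)
      have hone : ∀ i ∈ Finset.range n, ∫ ω, V n i (Set.Ioc x y) ω ^ 2 ∂P ≤
          β * ((n : ℝ)⁻¹ ^ 2 * ((m n i : ℝ)⁻¹ * r + r ^ 2)) := by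
        intro i hi
        have hmi := hmpos n i (Finset.mem_range.1 hi)
        simp only [V, mul_pow]
        rw [integral_const_mul]
        have := hM.integral_sum_curve_sq_le hBm hB2 i (m n i) (J := Set.Ioc x y)
          measurableSet_Ioc (φ := fun j => φ n i j (Set.Ioc x y)) (fun j ω => hφ0 _ _ _ _ _)
          (by filter_upwards [hφB] with ω hω j; exact hω n i j _)
        change _ ≤ β * ((m n i : ℝ) * r + (m n i : ℝ) ^ 2 * r ^ 2) at this
        refine (mul_le_mul_of_nonneg_left this (by positivity)).trans_eq ?_
        field_simp
      refine (Finset.sum_le_sum hone).trans ?_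
      rw [devRate_sq hh0, ← Finset.mul_sum, ← Finset.mul_sum, Finset.sum_add_distrib,
        ← Finset.sum_mul, spread, div_harmonicMean, mul_assoc β]
      simp only [Finset.sum_const, Finset.card_range, nsmul_eq_mul]
      refine mul_le_mul_of_nonneg_left ?_ hβ0
      set σ := ∑ i ∈ Finset.range n, (m n i : ℝ)⁻¹ with hσ
      have hσ0 : 0 ≤ σ := by positivity
      have e1 : (n : ℝ)⁻¹ ^ 2 * (σ * r + n * r ^ 2) = (n : ℝ)⁻¹ * ((n : ℝ)⁻¹ * σ * r + r ^ 2) := by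
        field_simp
      have e2 : Real.log n / n * (h n ^ 2 + h n * ((n : ℝ)⁻¹ * σ)) / Real.log n =
          (n : ℝ)⁻¹ * (h n ^ 2 + h n * ((n : ℝ)⁻¹ * σ)) := by
        field_simp
      rw [e1, e2, mul_left_comm]
      refine mul_le_mul_of_nonneg_left ?_ (by positivity)
      have hs1 : 0 ≤ (n : ℝ)⁻¹ * σ := by positivity
      have h1 : (n : ℝ)⁻¹ * σ * r ≤ (n : ℝ)⁻¹ * σ * (4 * D * h n) := by gcongr
      have h2 : r ^ 2 ≤ (4 * D * h n) ^ 2 := by gcongr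
      have h3 : 0 ≤ 4 * D * h n ^ 2 := by positivity
      have h4 : 0 ≤ 16 * D ^ 2 * (h n * ((n : ℝ)⁻¹ * σ)) := by positivity
      nlinarith
    · filter_upwards [eventually_gt_atTop 0] with n hn x y hxy
      have hn' : (0 : ℝ) < n := Nat.cast_pos.2 hn
      have hB1' : 0 ≤ ∫ ξ, B ξ ∂Q := integral_nonneg hB0
      have hone : ∀ i ∈ Finset.range n, ∫ ω, V n i (Set.Ioc x y) ω ∂P ≤
          (n : ℝ)⁻¹ * ((∫ ξ, B ξ ∂Q) * (D * (y - x))) := by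
        intro i hi
        have hmi := hmpos n i (Finset.mem_range.1 hi)
        rw [hVi n i _ measurableSet_Ioc]
        have : ∀ j ∈ Finset.range (m n i), ∫ ω, φ n i j (Set.Ioc x y) ω ∂P ≤
            (∫ ξ, B ξ ∂Q) * (D * (y - x)) := by
          intro j _
          calc ∫ ω, φ n i j (Set.Ioc x y) ω ∂P
              ≤ ∫ ω, B (ζ i ω) * (Set.Ioc x y).indicator (1 : ℝ → ℝ) (T i j ω) ∂P := by
                refine integral_mono_of_nonneg (ae_of_all _ fun ω => hφ0 _ _ _ _ _) ?_ ?_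
                · refine (((hM.realization i).integrable_comp hB1.aestronglyMeasurable).2
                    hB1).mul_bdd (c := 1) ((measurable_one.indicator measurableSet_Ioc).comp
                    (hM.measurable_time i j)).aestronglyMeasurable (ae_of_all _ fun ω => ?_)
                  rw [Real.norm_of_nonneg (indicator_one_nonneg _ _)]
                  exact indicator_one_le_one _ _
                · filter_upwards [hφB] with ω hω
                  exact hω n i j _
            _ = (∫ ξ, B ξ ∂Q) * ν.real (Set.Ioc x y) :=
                hM.integral_curve_time i j hBm measurableSet_Ioc
            _ ≤ _ := by gcongr; exact hνI hxy
        refine (mul_le_mul_of_nonneg_left (Finset.sum_le_sum this) (by positivity)).trans_eq ?_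
        simp only [Finset.sum_const, Finset.card_range, nsmul_eq_mul]
        field_simp
      refine (Finset.sum_le_sum hone).trans_eq ?_
      simp only [Finset.sum_const, Finset.card_range, nsmul_eq_mul]
      field_simp
  -- the truncation is of no consequence
  set κ := ∫ ξ, B ξ ^ p ∂Q with hκ
  have hκ0 : 0 ≤ κ := integral_nonneg fun ξ => Real.rpow_nonneg (hB0 ξ) _
  refine ⟨C + (κ + 1) + κ, ?_⟩
  filter_upwards [hC, hM.ae_curve_le hB, hM.ae_eventually_average_le hBpm hBpi] with ω hω hωB havg
  filter_upwards [hω, havg, hh.eventually_truncLevel_rpow_le hp, eventually_gt_atTop 0]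
    with n h1 h2 ⟨h3, h3'⟩ hn t ht I hI hIs
  have hn' : (0 : ℝ) < n := Nat.cast_pos.2 hn
  have hIm : MeasurableSet I := hI.measurableSet
  have hA0 : 0 ≤ devRate h m n := Real.sqrt_nonneg _
  have hdev := h1 t ht I hI hIs
  set Q' := truncLevel h m n with hQ'
  -- empirical part
  have hemp : |∑ q ∈ pairs n (m n), pairWeight n (m n) q *
      (Ψ (ζ q.1 ω) (T q.1 q.2 ω) * I.indicator 1 (T q.1 q.2 ω)) -
      ∑ i ∈ Finset.range n, V n i I ω| ≤ (κ + 1) * devRate h m n := by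
    rw [sum_pairs, ← Finset.sum_sub_distrib]
    refine (Finset.abs_sum_le_sum_abs _ _).trans ?_
    have hone : ∀ i ∈ Finset.range n,
        |(n : ℝ)⁻¹ * (m n i : ℝ)⁻¹ * ∑ j ∈ Finset.range (m n i),
          Ψ (ζ i ω) (T i j ω) * I.indicator 1 (T i j ω) - V n i I ω| ≤
        (n : ℝ)⁻¹ * B (ζ i ω) ^ p * Q' ^ (1 - p) := by
      intro i hi
      have hmi := hmpos n i (Finset.mem_range.1 hi)
      simp only [V]
      rw [← mul_sub, ← Finset.sum_sub_distrib, abs_mul, abs_of_nonneg (by positivity)]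
      have : ∀ j ∈ Finset.range (m n i), |Ψ (ζ i ω) (T i j ω) * I.indicator 1 (T i j ω) -
          φ n i j I ω| ≤ B (ζ i ω) ^ p * Q' ^ (1 - p) := by
        intro j _
        simp only [φ]
        rw [← sub_mul, abs_of_nonneg (mul_nonneg (sub_nonneg.2 (min_le_left _ _))
          (indicator_one_nonneg _ _))]
        exact (mul_le_of_le_one_right (sub_nonneg.2 (min_le_left _ _))
          (indicator_one_le_one _ _)).trans
          (sub_min_le_rpow (by linarith) (hΨ0 _ _) (hωB i j) h3)
      refine (mul_le_mul_of_nonneg_left ((Finset.abs_sum_le_sum_abs _ _).trans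
        (Finset.sum_le_sum this)) (by positivity)).trans_eq ?_
      simp only [Finset.sum_const, Finset.card_range, nsmul_eq_mul]
      field_simp
    refine (Finset.sum_le_sum hone).trans ?_
    rw [← Finset.sum_mul, ← Finset.mul_sum]
    exact mul_le_mul h2 h3' (by positivity) (by positivity)
  -- mean part
  have hmean : |∑ i ∈ Finset.range n, ∫ ω, V n i I ω ∂P -
      ∫ z, Ψ z.1 z.2 * I.indicator 1 z.2 ∂(Q.prod ν)| ≤ κ * devRate h m n := by
    have hΨm : Measurable fun z : Ξ × ℝ => Ψ z.1 z.2 := hΨ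
    have hIz : Measurable fun z : Ξ × ℝ => I.indicator (1 : ℝ → ℝ) z.2 :=
      (measurable_one.indicator hIm).comp measurable_snd
    have hGm : Measurable fun z : Ξ × ℝ => min (Ψ z.1 z.2) Q' * I.indicator 1 z.2 :=
      (hΨm.min measurable_const).mul hIz
    have hφint : ∀ i j, ∫ ω, φ n i j I ω ∂P =
        ∫ z, min (Ψ z.1 z.2) Q' * I.indicator 1 z.2 ∂(Q.prod ν) := by
      intro i j
      rw [← hM.map_curve_time i j, integral_map ((hM.realization i).measurable.prodMk
        (hM.measurable_time i j)).aemeasurable hGm.aestronglyMeasurable]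
    have hsum : ∑ i ∈ Finset.range n, ∫ ω, V n i I ω ∂P =
        ∫ z, min (Ψ z.1 z.2) Q' * I.indicator 1 z.2 ∂(Q.prod ν) := by
      rw [← sum_pairWeight_mul_const hn (m := m n) (fun i hi => by
        have := hM.two_le n i hi; omega)
        (∫ z, min (Ψ z.1 z.2) Q' * I.indicator 1 z.2 ∂(Q.prod ν)), sum_pairs]
      refine Finset.sum_congr rfl fun i _ => ?_
      rw [hVi n i I hIm]
      simp only [hφint]
    have hbdd : ∀ z : Ξ × ℝ, ‖min (Ψ z.1 z.2) Q' * I.indicator 1 z.2‖ ≤ Q' := fun z => by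
      have h0 : 0 ≤ min (Ψ z.1 z.2) Q' := le_min (hΨ0 _ _) h3.le
      rw [Real.norm_of_nonneg (mul_nonneg h0 (indicator_one_nonneg _ _))]
      exact (mul_le_of_le_one_right h0 (indicator_one_le_one _ _)).trans (min_le_right _ _)
    have hi1 : Integrable (fun z : Ξ × ℝ => min (Ψ z.1 z.2) Q' * I.indicator 1 z.2)
        (Q.prod ν) := Integrable.of_bound hGm.aestronglyMeasurable Q' (ae_of_all _ hbdd)
    have hBz : ∀ᵐ z ∂(Q.prod ν), Ψ z.1 z.2 ≤ B z.1 := ae_prod_timeLaw_le hB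
    have hi2 : Integrable (fun z : Ξ × ℝ => Ψ z.1 z.2 * I.indicator 1 z.2) (Q.prod ν) := by
      refine (hB1.comp_fst ν).mono' (hΨm.mul hIz).aestronglyMeasurable ?_
      filter_upwards [hBz] with z hz
      rw [Real.norm_of_nonneg (mul_nonneg (hΨ0 _ _) (indicator_one_nonneg _ _))]
      exact (mul_le_of_le_one_right (hΨ0 _ _) (indicator_one_le_one _ _)).trans hz
    have hi3 : Integrable (fun z : Ξ × ℝ => B z.1 ^ p * Q' ^ (1 - p)) (Q.prod ν) :=
      (hBpi.comp_fst ν).mul_const _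
    rw [hsum, abs_sub_comm, ← integral_sub hi2 hi1]
    calc |∫ z, (Ψ z.1 z.2 * I.indicator 1 z.2 - min (Ψ z.1 z.2) Q' * I.indicator 1 z.2)
          ∂(Q.prod ν)|
        ≤ ∫ z, B z.1 ^ p * Q' ^ (1 - p) ∂(Q.prod ν) := by
          refine norm_integral_le_of_norm_le (f := fun z : Ξ × ℝ => Ψ z.1 z.2 * I.indicator 1 z.2 -
            min (Ψ z.1 z.2) Q' * I.indicator 1 z.2) hi3 ?_
          filter_upwards [hBz] with z hz
          rw [← sub_mul, Real.norm_of_nonneg (mul_nonneg (sub_nonneg.2 (min_le_left _ _))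
            (indicator_one_nonneg _ _))]
          exact (mul_le_of_le_one_right (sub_nonneg.2 (min_le_left _ _))
            (indicator_one_le_one _ _)).trans (sub_min_le_rpow (by linarith) (hΨ0 _ _) hz h3)
      _ = κ * Q' ^ (1 - p) := by
          rw [integral_mul_const, integral_fun_fst (fun ξ => B ξ ^ p)]
          simp [hκ]
      _ ≤ κ * devRate h m n := by gcongr
  have htri : ∀ x y z w : ℝ, x - w = (x - y) + (y - z) + (z - w) := fun x y z w => by ring
  rw [htri _ (∑ i ∈ Finset.range n, V n i I ω) (∑ i ∈ Finset.range n, ∫ ω, V n i I ω ∂P)]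
  refine (abs_add_three _ _ _).trans ?_
  linarith

end Curves

/-! ### Deviations of averages over the errors -/

section Errors

variable {Ω Ξ : Type*} [mΩ : MeasurableSpace Ω] [MeasurableSpace Ξ] {P : Measure Ω}
  {Q : Measure Ξ} {a b : ℝ} {X : Ξ → ℝ → ℝ} {ζ : ℕ → Ω → Ξ} {fT : ℝ → ℝ}
  {T U : ℕ → ℕ → Ω → ℝ} {m : ℕ → ℕ → ℕ} {h : ℕ → ℝ} {p : ℝ}

/-- The weighted excess of the errors over the truncation level (which grows with the number of
observations on the curve). -/
noncomputable def errorExcess (h : ℕ → ℝ) (m : ℕ → ℕ → ℕ) (U : ℕ → ℕ → Ω → ℝ) (n : ℕ) (ω : Ω) :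
    ℝ :=
  ∑ q ∈ pairs n (m n), pairWeight n (m n) q *
    (|U q.1 q.2 ω| - min |U q.1 q.2 ω| (truncLevel h m n * m n q.1))

theorem MomentCondition.integrable_error [IsProbabilityMeasure P]
    (hM : IsModel P Q a b X ζ fT T U m) (hp : 2 < p) (hU : MomentCondition P Q a b X U p)
    (i j : ℕ) : Integrable (fun ω => |U i j ω| ^ p) P := by
  have hp0 : ENNReal.ofReal p ≠ 0 := by simp; linarith
  have hmem : MemLp (U i j) (ENNReal.ofReal p) P := by
    refine ⟨(hM.measurable_error i j).aestronglyMeasurable, ?_⟩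
    rw [eLpNorm_lt_top_iff_lintegral_rpow_enorm_lt_top hp0 ENNReal.ofReal_ne_top,
      ENNReal.toReal_ofReal (by linarith)]
    exact hU.error i j
  have := hmem.integrable_norm_rpow hp0 ENNReal.ofReal_ne_top
  rwa [ENNReal.toReal_ofReal (by linarith)] at this

/-- **Uniform deviations over the errors.** The blocks are the single observations. -/
theorem IsModel.ae_error_deviation [IsProbabilityMeasure P] (hM : IsModel P Q a b X ζ fT T U m)
    (hfT : DensityCondition a b fT) (hp : 2 < p) (hh : BandwidthCondition h m p)
    (hU : MomentCondition P Q a b X U p)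
    (hexc : ∀ᵐ ω ∂P, ∃ C : ℝ, ∀ᶠ n in atTop, errorExcess h m U n ω ≤ C * devRate h m n)
    {ψ : ℝ → ℝ} (hψ : Measurable ψ) (hψ0 : ∀ u, 0 ≤ ψ u) (hψle : ∀ u, ψ u ≤ |u|) :
    ∀ᵐ ω ∂P, ∃ C : ℝ, ∀ᶠ n in atTop, ∀ t ∈ Set.Icc a b, ∀ I : Set ℝ, I.OrdConnected →
      I ⊆ Set.Icc (t - h n) (t + h n) →
      |∑ q ∈ pairs n (m n), pairWeight n (m n) q *
          (ψ (U q.1 q.2 ω) * I.indicator 1 (T q.1 q.2 ω)) -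
        (∫ ω, ψ (U 0 0 ω) ∂P) * (timeLaw a b fT).real I| ≤ C * devRate h m n := by
  have hνp := hM.isProbabilityMeasure_timeLaw
  obtain ⟨⟨c, D, hc, hcD⟩, -, -⟩ := hfT
  have hD0 : 0 ≤ D := hc.le.trans ((hcD a ⟨le_rfl, hM.lt.le⟩).1.trans (hcD a ⟨le_rfl, hM.lt.le⟩).2)
  have hνI : ∀ {x y : ℝ}, x ≤ y → (timeLaw a b fT).real (Set.Ioc x y) ≤ D * (y - x) := fun hxy =>
    hM.timeLaw_real_Ioc_le hD0 (fun t ht => (hcD t ht).2) hxy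
  set ν := timeLaw a b fT with hν
  have hU2 : ∀ i j, Integrable (fun ω => U i j ω ^ 2) P := fun i j =>
    (hM.memLp_error i j).integrable_sq
  have hU1 : ∀ i j, Integrable (fun ω => |U i j ω|) P := fun i j =>
    ((hM.memLp_error i j).integrable (by norm_num)).abs
  have hψi : ∀ i j, Integrable (fun ω => ψ (U i j ω)) P := fun i j =>
    (hU1 i j).mono' (hψ.comp (hM.measurable_error i j)).aestronglyMeasurable
      (ae_of_all _ fun ω => by rw [Real.norm_of_nonneg (hψ0 _)]; exact hψle _)
  set β := ∫ ω, U 0 0 ω ^ 2 ∂P with hβ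
  have hβ0 : 0 ≤ β := integral_nonneg fun ω => sq_nonneg _
  set α := ∫ ω, |U 0 0 ω| ∂P with hα
  have hα0 : 0 ≤ α := integral_nonneg fun ω => abs_nonneg _
  set κ := ∫ ω, |U 0 0 ω| ^ p ∂P with hκ
  have hκ0 : 0 ≤ κ := integral_nonneg fun ω => Real.rpow_nonneg (abs_nonneg _) _
  let lev : ℕ → ((_ : ℕ) × ℕ) → ℝ := fun n q => truncLevel h m n * m n q.1
  have hlev0 : ∀ n q, 0 ≤ lev n q := fun n q =>
    mul_nonneg (truncLevel_nonneg h m n) (Nat.cast_nonneg _)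
  let φ : ℕ → ((_ : ℕ) × ℕ) → Set ℝ → Ω → ℝ := fun n q J ω =>
    min (ψ (U q.1 q.2 ω)) (lev n q) * J.indicator 1 (T q.1 q.2 ω)
  let V : ℕ → ((_ : ℕ) × ℕ) → Set ℝ → Ω → ℝ := fun n q J ω =>
    pairWeight n (m n) q * φ n q J ω
  have hmin0 : ∀ n q ω, 0 ≤ min (ψ (U q.1 q.2 ω)) (lev n q) := fun n q ω =>
    le_min (hψ0 _) (hlev0 n q)
  have hφ0 : ∀ n q J ω, 0 ≤ φ n q J ω := fun n q J ω =>
    mul_nonneg (hmin0 n q ω) (indicator_one_nonneg _ _)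
  have hVm : ∀ (mΩ' : MeasurableSpace Ω) n q J, MeasurableSet J →
      Measurable[mΩ'] (U q.1 q.2) → Measurable[mΩ'] (T q.1 q.2) → Measurable[mΩ'] (V n q J) := by
    intro mΩ' n q J hJ hU hT
    exact (((hψ.comp hU).min measurable_const).mul ((measurable_one.indicator hJ).comp hT)).const_mul
      _
  have hφi : ∀ n q J, MeasurableSet J → Integrable (φ n q J) P := by
    intro n q J hJ
    refine Integrable.of_bound (((hψ.comp (hM.measurable_error _ _)).min measurable_const).mul
      ((measurable_one.indicator hJ).comp (hM.measurable_time _ _))).aestronglyMeasurable (lev n q)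
      (ae_of_all _ fun ω => ?_)
    rw [Real.norm_of_nonneg (hφ0 _ _ _ _)]
    exact (mul_le_of_le_one_right (hmin0 _ _ _) (indicator_one_le_one _ _)).trans (min_le_right _ _)
  have hmpos : ∀ n i, i < n → (0 : ℝ) < m n i := fun n i hi => by
    have := hM.two_le n i hi
    exact_mod_cast (by omega : 0 < m n i)
  have hqmem : ∀ n, ∀ q ∈ pairs n (m n), q.1 < n := fun n q hq =>
    Finset.mem_range.1 (Finset.mem_sigma.1 hq).1
  have hmulI : ∀ i j (J : Set ℝ) (f : Ω → ℝ), MeasurableSet J → Integrable f P → Integrable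
      (fun ω => f ω * J.indicator (1 : ℝ → ℝ) (T i j ω)) P := fun i j J f hJ hf => by
    refine hf.mul_bdd (c := 1) ((measurable_one.indicator hJ).comp
      (hM.measurable_time i j)).aestronglyMeasurable (ae_of_all _ fun ω => ?_)
    rw [Real.norm_of_nonneg (indicator_one_nonneg _ _)]
    exact indicator_one_le_one _ _
  obtain ⟨C, hC⟩ : ∃ C : ℝ, ∀ᵐ ω ∂P, ∀ᶠ n in atTop, ∀ t ∈ Set.Icc a b, ∀ I : Set ℝ,
      I.OrdConnected → I ⊆ Set.Icc (t - h n) (t + h n) →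
      |∑ q ∈ pairs n (m n), V n q I ω - ∑ q ∈ pairs n (m n), ∫ ω, V n q I ω ∂P| ≤
        C * devRate h m n := by
    refine exists_ae_eventually_abs_sum_sub_le (P := P) (fun n => pairs n (m n)) V
      (devRate h m) h a b (β * (4 * D)) (α * D) ?_ ?_ ?_ ?_ ?_
      (hh.eventually_one_div_le_devRate hp) (hh.eventually_bandwidth hp) ?_ ?_ ?_
    · intro n q I J ω hIJ
      exact mul_le_mul_of_nonneg_left (mul_le_mul_of_nonneg_left (indicator_one_mono hIJ _)
        (hmin0 _ _ _)) (pairWeight_nonneg _ _ _)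
    · intro n q I J ω
      simp only [V, φ]
      rw [← mul_add, ← mul_add]
      exact mul_le_mul_of_nonneg_left (mul_le_mul_of_nonneg_left (indicator_one_union_le _ _ _)
        (hmin0 _ _ _)) (pairWeight_nonneg _ _ _)
    · exact fun n q J hJ => hVm _ n q J hJ (hM.measurable_error _ _) (hM.measurable_time _ _)
    · intro n x y
      refine hM.iIndepFun_of_disjoint (S := fun q : (_ : ℕ) × ℕ =>
        {Sum.inr (Sum.inl (q.1, q.2)), Sum.inr (Sum.inr (q.1, q.2))}) ?_ fun q => ?_
      · rintro ⟨i, j⟩ ⟨i', j'⟩ hq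
        have hne : ¬ (i = i' ∧ j = j') := fun hij => hq (by rw [hij.1, hij.2])
        rw [Set.disjoint_left]
        rintro k (rfl | rfl) <;> simpa using hne
      · exact hVm _ n q _ measurableSet_Ioc (measurable_error_sources (by simp))
          (measurable_time_sources (by simp))
    · exact fun n q _ J ω => mul_nonneg (pairWeight_nonneg _ _ _) (hφ0 _ _ _ _)
    · filter_upwards [eventually_gt_atTop 0] with n hn q hq J ω
      have hmi := hmpos n q.1 (hqmem n q hq)
      have hn' : (0 : ℝ) < n := Nat.cast_pos.2 hn
      calc V n q J ω ≤ pairWeight n (m n) q * lev n q := by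
            refine mul_le_mul_of_nonneg_left ?_ (pairWeight_nonneg _ _ _)
            exact (mul_le_of_le_one_right (hmin0 _ _ _) (indicator_one_le_one _ _)).trans
              (min_le_right _ _)
        _ = devRate h m n / Real.log n := by
            simp only [pairWeight, lev, truncLevel]
            field_simp
    · filter_upwards [eventually_gt_atTop 0, eventually_one_le_log, hh.eventually_bandwidth hp]
        with n hn hlog hbw x y hxy hlen
      have hn' : (0 : ℝ) < n := Nat.cast_pos.2 hn
      have hh0 := hh.pos n
      set r := ν.real (Set.Ioc x y) with hr
      have hr0 : 0 ≤ r := measureReal_nonneg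
      have hrle : r ≤ 4 * D * h n := (hνI hxy).trans (by nlinarith)
      have hone : ∀ q ∈ pairs n (m n), ∫ ω, V n q (Set.Ioc x y) ω ^ 2 ∂P ≤
          pairWeight n (m n) q * (pairWeight n (m n) q * (β * r)) := by
        intro q hq
        simp only [V, mul_pow]
        rw [integral_const_mul, sq, mul_assoc]
        refine mul_le_mul_of_nonneg_left (mul_le_mul_of_nonneg_left ?_ (pairWeight_nonneg _ _ _))
          (pairWeight_nonneg _ _ _)
        calc ∫ ω, φ n q (Set.Ioc x y) ω ^ 2 ∂P
            ≤ ∫ ω, U q.1 q.2 ω ^ 2 * (Set.Ioc x y).indicator (1 : ℝ → ℝ) (T q.1 q.2 ω) ∂P := by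
              refine integral_mono_of_nonneg (ae_of_all _ fun ω => sq_nonneg _)
                (hmulI _ _ _ _ measurableSet_Ioc (hU2 _ _)) (ae_of_all _ fun ω => ?_)
              have h1 : min (ψ (U q.1 q.2 ω)) (lev n q) ^ 2 ≤ U q.1 q.2 ω ^ 2 := by
                rw [← sq_abs (U q.1 q.2 ω)]
                exact pow_le_pow_left₀ (hmin0 _ _ _) ((min_le_left _ _).trans (hψle _)) 2
              simp only [φ, mul_pow]
              by_cases hT : T q.1 q.2 ω ∈ Set.Ioc x y
              · simpa [hT] using h1
              · simp [hT]
          _ = β * r := hM.integral_error_time q.1 q.2 (f := fun u => u ^ 2) (by fun_prop)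
              measurableSet_Ioc
      refine (Finset.sum_le_sum hone).trans ?_
      rw [sum_pairs, devRate_sq hh0, spread, div_harmonicMean]
      have e0 : ∀ i ∈ Finset.range n, (n : ℝ)⁻¹ * (m n i : ℝ)⁻¹ * ∑ j ∈ Finset.range (m n i),
          pairWeight n (m n) ⟨i, j⟩ * (β * r) = (n : ℝ)⁻¹ ^ 2 * (β * r) * (m n i : ℝ)⁻¹ := by
        intro i hi
        have hmi := hmpos n i (Finset.mem_range.1 hi)
        simp only [pairWeight, Finset.sum_const, Finset.card_range, nsmul_eq_mul]
        field_simp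
      rw [Finset.sum_congr rfl e0, ← Finset.mul_sum]
      set σ := ∑ i ∈ Finset.range n, (m n i : ℝ)⁻¹ with hσ
      have hσ0 : 0 ≤ σ := by positivity
      have e1 : (n : ℝ)⁻¹ ^ 2 * (β * r) * σ = β * (n : ℝ)⁻¹ * (r * ((n : ℝ)⁻¹ * σ)) := by ring
      have e2 : β * (4 * D) * (Real.log n / n * (h n ^ 2 + h n * ((n : ℝ)⁻¹ * σ)) / Real.log n) =
          β * (n : ℝ)⁻¹ * (4 * D * (h n ^ 2 + h n * ((n : ℝ)⁻¹ * σ))) := by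
        field_simp
      rw [e1, e2]
      refine mul_le_mul_of_nonneg_left ?_ (by positivity)
      have hs1 : 0 ≤ (n : ℝ)⁻¹ * σ := by positivity
      have h1 : r * ((n : ℝ)⁻¹ * σ) ≤ 4 * D * h n * ((n : ℝ)⁻¹ * σ) := by gcongr
      have h3 : 0 ≤ 4 * D * h n ^ 2 := by positivity
      nlinarith
    · filter_upwards [eventually_gt_atTop 0] with n hn x y hxy
      have hone : ∀ q ∈ pairs n (m n), ∫ ω, V n q (Set.Ioc x y) ω ∂P ≤
          pairWeight n (m n) q * (α * D * (y - x)) := by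
        intro q hq
        simp only [V]
        rw [integral_const_mul]
        refine mul_le_mul_of_nonneg_left ?_ (pairWeight_nonneg _ _ _)
        calc ∫ ω, φ n q (Set.Ioc x y) ω ∂P
            ≤ ∫ ω, |U q.1 q.2 ω| * (Set.Ioc x y).indicator (1 : ℝ → ℝ) (T q.1 q.2 ω) ∂P := by
              refine integral_mono_of_nonneg (ae_of_all _ fun ω => hφ0 _ _ _ _)
                (hmulI _ _ _ _ measurableSet_Ioc (hU1 _ _)) (ae_of_all _ fun ω => ?_)
              exact mul_le_mul_of_nonneg_right ((min_le_left _ _).trans (hψle _))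
                (indicator_one_nonneg _ _)
          _ = α * ν.real (Set.Ioc x y) := hM.integral_error_time q.1 q.2 (f := fun u => |u|)
              (by fun_prop) measurableSet_Ioc
          _ ≤ α * (D * (y - x)) := by gcongr; exact hνI hxy
          _ = _ := by ring
      refine (Finset.sum_le_sum hone).trans_eq (sum_pairWeight_mul_const hn (fun i hi => ?_) _)
      have := hM.two_le n i hi
      omega
  filter_upwards [hC, hexc] with ω hω ⟨C', hC'⟩
  refine ⟨C' + C + κ, ?_⟩
  filter_upwards [hω, hC', hh.eventually_truncLevel_rpow_le hp, eventually_gt_atTop 0]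
    with n h1 h2 ⟨h3, h3'⟩ hn t ht I hI hIs
  have hIm : MeasurableSet I := hI.measurableSet
  have hdev := h1 t ht I hI hIs
  have hmp : ∀ i < n, 0 < m n i := fun i hi => by have := hM.two_le n i hi; omega
  -- `u - min u q` increases with `u`
  have hsubmin : ∀ u q : ℝ, ψ u - min (ψ u) q ≤ |u| - min |u| q := by
    intro u q
    have := hψle u
    rcases le_total (ψ u) q with h4 | h4 <;> rcases le_total |u| q with h5 | h5 <;>
      simp only [min_eq_left, min_eq_right, h4, h5] <;> linarith
  have hemp : |∑ q ∈ pairs n (m n), pairWeight n (m n) q *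
      (ψ (U q.1 q.2 ω) * I.indicator 1 (T q.1 q.2 ω)) - ∑ q ∈ pairs n (m n), V n q I ω| ≤
      C' * devRate h m n := by
    refine le_trans ?_ h2
    rw [← Finset.sum_sub_distrib]
    refine (Finset.abs_sum_le_sum_abs _ _).trans (Finset.sum_le_sum fun q _ => ?_)
    simp only [V, φ]
    rw [← mul_sub, ← sub_mul, abs_mul, abs_of_nonneg (pairWeight_nonneg _ _ _),
      abs_of_nonneg (mul_nonneg (sub_nonneg.2 (min_le_left _ _)) (indicator_one_nonneg _ _))]
    refine mul_le_mul_of_nonneg_left ?_ (pairWeight_nonneg _ _ _)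
    exact (mul_le_of_le_one_right (sub_nonneg.2 (min_le_left _ _))
      (indicator_one_le_one _ _)).trans (hsubmin _ _)
  have hmean : |∑ q ∈ pairs n (m n), ∫ ω, V n q I ω ∂P - (∫ ω, ψ (U 0 0 ω) ∂P) * ν.real I| ≤
      κ * devRate h m n := by
    rw [← sum_pairWeight_mul_const hn hmp ((∫ ω, ψ (U 0 0 ω) ∂P) * ν.real I),
      ← Finset.sum_sub_distrib]
    refine (Finset.abs_sum_le_sum_abs _ _).trans ?_
    rw [← sum_pairWeight_mul_const hn hmp (κ * devRate h m n)]
    refine Finset.sum_le_sum fun q hq => ?_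
    simp only [V]
    rw [integral_const_mul, ← mul_sub, abs_mul, abs_of_nonneg (pairWeight_nonneg _ _ _)]
    refine mul_le_mul_of_nonneg_left ?_ (pairWeight_nonneg _ _ _)
    rw [← hM.integral_error_time q.1 q.2 hψ hIm, abs_sub_comm,
      ← integral_sub (hmulI _ _ _ _ hIm (hψi _ _)) (hφi n q I hIm)]
    have hm1 : (1 : ℝ) ≤ m n q.1 := by exact_mod_cast hmp _ (hqmem n q hq)
    have hlevpos : truncLevel h m n ≤ lev n q := le_mul_of_one_le_right h3.le hm1
    calc |∫ ω, (ψ (U q.1 q.2 ω) * I.indicator 1 (T q.1 q.2 ω) - φ n q I ω) ∂P|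
        ≤ ∫ ω, |U q.1 q.2 ω| ^ p * truncLevel h m n ^ (1 - p) ∂P := by
          refine norm_integral_le_of_norm_le (f := fun ω => ψ (U q.1 q.2 ω) *
            I.indicator 1 (T q.1 q.2 ω) - φ n q I ω)
            ((MomentCondition.integrable_error hM hp hU _ _).mul_const _) (ae_of_all _ fun ω => ?_)
          simp only [φ]
          rw [← sub_mul, Real.norm_of_nonneg (mul_nonneg (sub_nonneg.2 (min_le_left _ _))
            (indicator_one_nonneg _ _))]
          refine (mul_le_of_le_one_right (sub_nonneg.2 (min_le_left _ _))
            (indicator_one_le_one _ _)).trans ((sub_min_le_rpow (by linarith : 1 ≤ p) (hψ0 _) (hψle _)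
              (h3.trans_le hlevpos)).trans ?_)
          exact mul_le_mul_of_nonneg_left (Real.rpow_le_rpow_of_nonpos h3 hlevpos (by linarith))
            (by positivity)
      _ = κ * truncLevel h m n ^ (1 - p) := by
          rw [integral_mul_const]
          congr 1
          exact ((hM.identDistrib_error q.1 q.2).comp
            (u := fun u => |u| ^ p) (by fun_prop)).integral_eq
      _ ≤ κ * devRate h m n := by gcongr
  have htri : ∀ x y z w : ℝ, x - w = (x - y) + (y - z) + (z - w) := fun x y z w => by ring
  rw [htri _ (∑ q ∈ pairs n (m n), V n q I ω) (∑ q ∈ pairs n (m n), ∫ ω, V n q I ω ∂P)]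
  refine (abs_add_three _ _ _).trans ?_
  linarith

/-- With boundedly many observations per curve the strong law controls the excess. -/
theorem IsModel.ae_errorExcess_le_of_le [IsProbabilityMeasure P]
    (hM : IsModel P Q a b X ζ fT T U m) (hp : 2 < p) (hh : BandwidthCondition h m p)
    (hU : MomentCondition P Q a b X U p) {M : ℕ} (hmM : ∀ n i, i < n → m n i ≤ M) :
    ∀ᵐ ω ∂P, ∃ C : ℝ, ∀ᶠ n in atTop, errorExcess h m U n ω ≤ C * devRate h m n := by
  have hslln : ∀ j, ∀ᵐ ω ∂P, ∀ᶠ n : ℕ in atTop,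
      (n : ℝ)⁻¹ * ∑ i ∈ Finset.range n, |U i j ω| ^ p ≤ (∫ ω, |U 0 j ω| ^ p ∂P) + 1 := by
    intro j
    have hf : Measurable fun u : ℝ => |u| ^ p := by fun_prop
    have hid : ∀ i, IdentDistrib (fun ω => |U i j ω| ^ p) (fun ω => |U 0 j ω| ^ p) P P := fun i =>
      ((hM.identDistrib_error i j).trans (hM.identDistrib_error 0 j).symm).comp hf
    have hind : Pairwise fun i i' => IndepFun (fun ω => |U i j ω| ^ p)
        (fun ω => |U i' j ω| ^ p) P := by
      intro i i' hii'
      exact hM.indepFun_of_disjoint {Sum.inr (Sum.inr (i, j))} {Sum.inr (Sum.inr (i', j))}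
        (by simpa using hii') (hf.comp (measurable_error_sources rfl))
        (hf.comp (measurable_error_sources rfl))
    filter_upwards [strong_law_ae_real (fun i ω => |U i j ω| ^ p)
      (MomentCondition.integrable_error hM hp hU 0 j) hind hid] with ω hω
    filter_upwards [hω.eventually (gt_mem_nhds (lt_add_one _))] with n hn
    rw [← div_eq_inv_mul]
    exact hn.le
  filter_upwards [ae_all_iff.2 hslln] with ω hω
  have hall : ∀ᶠ n : ℕ in atTop, ∀ j ∈ Finset.range M,
      (n : ℝ)⁻¹ * ∑ i ∈ Finset.range n, |U i j ω| ^ p ≤ (∫ ω, |U 0 j ω| ^ p ∂P) + 1 :=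
    (eventually_all_finset _).2 fun j _ => hω j
  refine ⟨∑ j ∈ Finset.range M, ((∫ ω, |U 0 j ω| ^ p ∂P) + 1), ?_⟩
  filter_upwards [hall, hh.eventually_truncLevel_rpow_le hp] with n h1 ⟨h3, h3'⟩
  have hexc : errorExcess h m U n ω ≤ ∑ q ∈ pairs n (m n), pairWeight n (m n) q *
      (|U q.1 q.2 ω| ^ p * truncLevel h m n ^ (1 - p)) := by
    refine Finset.sum_le_sum fun q hq => mul_le_mul_of_nonneg_left ?_ (pairWeight_nonneg _ _ _)
    have hq1 : q.1 < n := Finset.mem_range.1 (Finset.mem_sigma.1 hq).1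
    have hm1 : (1 : ℝ) ≤ m n q.1 := by
      have := hM.two_le n _ hq1
      exact_mod_cast (by omega : 1 ≤ m n q.1)
    have hlev : truncLevel h m n ≤ truncLevel h m n * m n q.1 := le_mul_of_one_le_right h3.le hm1
    refine (sub_min_le_rpow (by linarith : 1 ≤ p) (abs_nonneg _) le_rfl
      (h3.trans_le hlev)).trans ?_
    exact mul_le_mul_of_nonneg_left (Real.rpow_le_rpow_of_nonpos h3 hlev (by linarith))
      (by positivity)
  refine hexc.trans ?_
  rw [sum_pairs]
  have hone : ∀ i ∈ Finset.range n, (n : ℝ)⁻¹ * (m n i : ℝ)⁻¹ * ∑ j ∈ Finset.range (m n i),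
      |U i j ω| ^ p * truncLevel h m n ^ (1 - p) ≤
      (∑ j ∈ Finset.range M, (n : ℝ)⁻¹ * |U i j ω| ^ p) * truncLevel h m n ^ (1 - p) := by
    intro i hi
    rw [← Finset.sum_mul, ← mul_assoc, ← Finset.mul_sum]
    refine mul_le_mul_of_nonneg_right (mul_le_mul ?_ ?_ (by positivity) (by positivity))
      (by positivity)
    · exact mul_le_of_le_one_right (by positivity) (Nat.cast_inv_le_one _)
    · exact Finset.sum_le_sum_of_subset_of_nonneg
        (Finset.range_subset_range.2 (hmM n i (Finset.mem_range.1 hi)))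
        fun j _ _ => by positivity
  refine (Finset.sum_le_sum hone).trans ?_
  rw [← Finset.sum_mul, Finset.sum_comm]
  refine mul_le_mul (Finset.sum_le_sum fun j hj => ?_) h3' (by positivity)
    (Finset.sum_nonneg fun j _ => ?_)
  · rw [← Finset.mul_sum]; exact h1 j hj
  · have : 0 ≤ ∫ ω, |U 0 j ω| ^ p ∂P := integral_nonneg fun ω => by positivity
    positivity

/-- If more than the fourth moment is finite, then `|U i j| ≤ ((i + 1) (j + 1)) ^ (1 / 4)` for all
but finitely many pairs `(i, j)`, by the Borel–Cantelli lemma over all pairs. The random constant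
`C` takes care of the exceptions. -/
theorem IsModel.ae_error_le [IsProbabilityMeasure P] (hM : IsModel P Q a b X ζ fT T U m)
    (hp : 4 < p) (hU : MomentCondition P Q a b X U p) :
    ∀ᵐ ω ∂P, ∃ C : ℝ, 0 < C ∧ ∀ i j, |U i j ω| ≤ C * (((i : ℝ) + 1) * (j + 1)) ^ (1 / 4 : ℝ) := by
  set κ := ∫ ω, |U 0 0 ω| ^ p ∂P with hκ
  have hκ0 : 0 ≤ κ := integral_nonneg fun ω => Real.rpow_nonneg (abs_nonneg _) _
  have hprob : ∀ q : ℕ × ℕ, P {ω | (((q.1 : ℝ) + 1) * (q.2 + 1)) ^ (1 / 4 : ℝ) < |U q.1 q.2 ω|} ≤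
      ENNReal.ofReal (κ * (((q.1 : ℝ) + 1) ^ (-(p / 4)) * ((q.2 : ℝ) + 1) ^ (-(p / 4)))) := by
    rintro ⟨i, j⟩
    simp only
    set x := ((i : ℝ) + 1) * (j + 1) with hx
    have hx0 : 0 < x := by positivity
    have hmk := mul_meas_ge_le_integral_of_nonneg (μ := P) (f := fun ω => |U i j ω| ^ p)
      (ae_of_all _ fun ω => by positivity)
      (MomentCondition.integrable_error hM (by linarith) hU i j) (x ^ (p / 4))
    have hid : ∫ ω, |U i j ω| ^ p ∂P = κ :=
      ((hM.identDistrib_error i j).comp (u := fun u => |u| ^ p) (by fun_prop)).integral_eq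
    rw [hid] at hmk
    rw [← ofReal_measureReal]
    refine ENNReal.ofReal_le_ofReal ?_
    rw [← Real.mul_rpow (by positivity) (by positivity), ← hx, Real.rpow_neg hx0.le,
      ← div_eq_mul_inv, le_div_iff₀ (by positivity), mul_comm]
    refine le_trans (mul_le_mul_of_nonneg_left (measureReal_mono fun ω hω => ?_) (by positivity)) hmk
    have hω' : x ^ (1 / 4 : ℝ) < |U i j ω| := hω
    have := Real.rpow_le_rpow (by positivity) hω'.le (by linarith : 0 ≤ p)
    rw [← Real.rpow_mul hx0.le] at this
    change x ^ (p / 4) ≤ |U i j ω| ^ p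
    convert! this using 2
    ring
  have hsum : Summable fun q : ℕ × ℕ =>
      κ * (((q.1 : ℝ) + 1) ^ (-(p / 4)) * ((q.2 : ℝ) + 1) ^ (-(p / 4))) := by
    have h1 : Summable fun i : ℕ => ((i : ℝ) + 1) ^ (-(p / 4)) := by
      have := (summable_nat_add_iff 1).2 (Real.summable_nat_rpow.2 (by linarith : -(p / 4) < -1))
      simpa using this
    exact (h1.mul_of_nonneg h1 (fun i => by positivity) fun i => by positivity).mul_left κ
  have hne : ∑' q : ℕ × ℕ, P {ω | (((q.1 : ℝ) + 1) * (q.2 + 1)) ^ (1 / 4 : ℝ) < |U q.1 q.2 ω|} ≠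
      ∞ := ne_top_of_le_ne_top hsum.tsum_ofReal_ne_top (ENNReal.tsum_le_tsum hprob)
  filter_upwards [ae_finite_setOfPred_mem hne] with ω hω
  refine ⟨1 + ∑ q ∈ hω.toFinset, |U q.1 q.2 ω|, by positivity, fun i j => ?_⟩
  have hx1 : (1 : ℝ) ≤ ((i : ℝ) + 1) * (j + 1) := by
    have : (0 : ℝ) ≤ i := i.cast_nonneg
    have : (0 : ℝ) ≤ j := j.cast_nonneg
    nlinarith
  have hx2 := Real.one_le_rpow hx1 (by norm_num : (0 : ℝ) ≤ 1 / 4)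
  have hS : 0 ≤ ∑ q ∈ hω.toFinset, |U q.1 q.2 ω| := Finset.sum_nonneg fun _ _ => abs_nonneg _
  by_cases hij : (((i : ℝ) + 1) * (j + 1)) ^ (1 / 4 : ℝ) < |U i j ω|
  · have hmem : (i, j) ∈ hω.toFinset := by simpa using hij
    have := Finset.single_le_sum (f := fun q : ℕ × ℕ => |U q.1 q.2 ω|)
      (fun q _ => abs_nonneg _) hmem
    simp only at this
    nlinarith
  · nlinarith [not_lt.1 hij]

end Errors

/-! ### Densely observed curves -/

section Dense

variable {m : ℕ → ℕ → ℕ} {h : ℕ → ℝ} {p : ℝ}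

theorem inv_harmonicMean_le_of_le {n : ℕ} {M : ℝ} {m : ℕ → ℕ} (hM0 : 0 < M)
    (hM : ∀ i < n, M ≤ m i) : (n : ℝ)⁻¹ * ∑ i ∈ Finset.range n, (m i : ℝ)⁻¹ ≤ M⁻¹ := by
  have h1 : ∑ i ∈ Finset.range n, (m i : ℝ)⁻¹ ≤ ∑ i ∈ Finset.range n, M⁻¹ :=
    Finset.sum_le_sum fun i hi => inv_anti₀ hM0 (hM i (Finset.mem_range.1 hi))
  rw [Finset.sum_const, Finset.card_range, nsmul_eq_mul] at h1
  calc (n : ℝ)⁻¹ * ∑ i ∈ Finset.range n, (m i : ℝ)⁻¹ ≤ (n : ℝ)⁻¹ * (n * M⁻¹) := by gcongr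
    _ = (n : ℝ)⁻¹ * n * M⁻¹ := by ring
    _ ≤ 1 * M⁻¹ := by gcongr; exact inv_mul_le_one
    _ = M⁻¹ := one_mul _

theorem BandwidthCondition.exists_dense (hh : BandwidthCondition h m p) {M : ℕ → ℝ}
    (hM0 : ∀ n, 0 < M n) (hM : ∀ n i, i < n → M n ≤ m n i)
    (hMh : (fun n => (M n)⁻¹) =O[atTop] h) :
    ∃ c : ℝ, 0 < c ∧ ∀ᶠ n in atTop, (∀ i < n, 1 ≤ c * h n * m n i) ∧
      spread h m n ≤ (1 + c) * h n ^ 2 := by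
  obtain ⟨c, hc, hcb⟩ := hMh.exists_pos
  refine ⟨c, hc, ?_⟩
  filter_upwards [hcb.bound] with n hn
  have hh0 := hh.pos n
  rw [Real.norm_of_nonneg (inv_nonneg.2 (hM0 n).le), Real.norm_of_nonneg hh0.le] at hn
  refine ⟨fun i hi => ?_, ?_⟩
  · have h1 : 1 ≤ c * h n * M n := by
      rw [inv_eq_one_div, div_le_iff₀ (hM0 n)] at hn; exact hn
    exact h1.trans (by gcongr; exact hM n i hi)
  · rw [spread, div_harmonicMean]
    have := (inv_harmonicMean_le_of_le (hM0 n) (hM n)).trans hn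
    nlinarith [mul_le_mul_of_nonneg_left this hh0.le]

/-- The rate conditions for dense designs leave room only for `p > 4`. -/
theorem BandwidthCondition.four_lt (hh : BandwidthCondition h m p) (hp : 2 < p) {c : ℝ}
    (hc : 0 < c) (hspread : ∀ᶠ n in atTop, spread h m n ≤ (1 + c) * h n ^ 2)
    (hO : h =O[atTop] (fun n : ℕ => (Real.log n / n) ^ (1 / 4 : ℝ))) : 4 < p := by
  obtain ⟨d, hd, hdb⟩ := hO.exists_pos
  by_contra! hp4
  have hev := hspread.and (hdb.bound.and ((hh.eventually_le_spread
    (c := (1 + c) * d ^ 2 + 1) (by positivity)).and (eventually_one_le_log.and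
    ((tendsto_log_div_self.eventually (gt_mem_nhds one_pos)).and (eventually_gt_atTop 0)))))
  obtain ⟨n, h1, h2, h3, h4, h5, h6⟩ := hev.exists
  have hn : (0 : ℝ) < n := Nat.cast_pos.2 h6
  set x := Real.log n / n with hx
  have hx0 : 0 < x := by positivity
  rw [Real.norm_of_nonneg (hh.pos n).le, Real.norm_of_nonneg (by positivity)] at h2
  have h7 : h n ^ 2 ≤ d ^ 2 * x ^ (1 / 2 : ℝ) := by
    have := pow_le_pow_left₀ (hh.pos n).le h2 2
    rw [mul_pow, ← Real.rpow_natCast (x ^ (1 / 4 : ℝ)) 2, ← Real.rpow_mul hx0.le] at this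
    convert! this using 3
    norm_num
  have h8 : x ^ (1 / 2 : ℝ) ≤ x ^ (1 - 2 / p) := by
    refine Real.rpow_le_rpow_of_exponent_ge hx0 h5.le ?_
    have : 2 / 4 ≤ 2 / p := by gcongr
    linarith
  have h9 : 0 < x ^ (1 / 2 : ℝ) := by positivity
  have h10 : (1 + c) * h n ^ 2 ≤ (1 + c) * (d ^ 2 * x ^ (1 / 2 : ℝ)) := by gcongr
  have h11 : ((1 + c) * d ^ 2 + 1) * x ^ (1 / 2 : ℝ) ≤ ((1 + c) * d ^ 2 + 1) * x ^ (1 - 2 / p) := by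
    gcongr
  nlinarith

end Dense

section DenseErrors

variable {Ω Ξ : Type*} [mΩ : MeasurableSpace Ω] [MeasurableSpace Ξ] {P : Measure Ω}
  {Q : Measure Ξ} {a b : ℝ} {X : Ξ → ℝ → ℝ} {ζ : ℕ → Ω → Ξ} {fT : ℝ → ℝ}
  {T U : ℕ → ℕ → Ω → ℝ} {m : ℕ → ℕ → ℕ} {h : ℕ → ℝ} {p : ℝ}

/-- With many observations per curve the truncation level of a single error is so high that
eventually no error exceeds it. No law of large numbers for `|U i j| ^ p` is available here, since
the numbers of observations may vary arbitrarily with `n`. -/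
theorem IsModel.ae_errorExcess_le_of_dense [IsProbabilityMeasure P]
    (hM : IsModel P Q a b X ζ fT T U m) (hp : 4 < p) (hh : BandwidthCondition h m p)
    (hU : MomentCondition P Q a b X U p) {c : ℝ} (hc : 0 < c)
    (hdense : ∀ᶠ n in atTop, (∀ i < n, 1 ≤ c * h n * m n i) ∧
      spread h m n ≤ (1 + c) * h n ^ 2) :
    ∀ᵐ ω ∂P, ∃ C : ℝ, ∀ᶠ n in atTop, errorExcess h m U n ω ≤ C * devRate h m n := by
  filter_upwards [hM.ae_error_le hp hU] with ω ⟨C, hC, hCU⟩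
  refine ⟨0, ?_⟩
  have hlog3 : ∀ᶠ n : ℕ in atTop, (C ^ 4 * c ^ 3) ^ 2 * Real.log n ^ 3 ≤ n := by
    have ho := (Real.isLittleO_pow_log_id_atTop (n := 3)).comp_tendsto tendsto_natCast_atTop_atTop
    have hK : 0 < ((C ^ 4 * c ^ 3) ^ 2)⁻¹ := by positivity
    filter_upwards [ho.bound hK, eventually_one_le_log] with n hn hl
    simp only [Function.comp_apply, id, Real.norm_natCast] at hn
    rw [Real.norm_of_nonneg (by positivity)] at hn
    rwa [← le_inv_mul_iff₀ (by positivity)]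
  filter_upwards [hdense, hlog3, hh.eventually_log_div_le_spread (by linarith)
    (c := 1 + c) (by positivity), eventually_one_le_log, eventually_gt_atTop 0,
    hh.eventually_truncLevel_rpow_le (by linarith)] with n ⟨h1, h2⟩ h3 h4 h5 h6 ⟨h7, _⟩
  have hn : (0 : ℝ) < n := Nat.cast_pos.2 h6
  have hh0 := hh.pos n
  have hL : 0 < Real.log n := by linarith
  set L := Real.log n with hLdef
  -- `h² ≥ log n / n`
  have h8 : L / n ≤ h n ^ 2 := by
    have := h4.trans h2
    exact le_of_mul_le_mul_left this (by positivity)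
  have hhn : C ^ 4 * c ^ 3 * L ^ 2 ≤ h n * n := by
    refine le_of_sq_le_sq ?_ (by positivity)
    have e1 : (C ^ 4 * c ^ 3 * L ^ 2) ^ 2 = (C ^ 4 * c ^ 3) ^ 2 * L ^ 3 * L := by ring
    have e2 : L / n * n ^ 2 ≤ h n ^ 2 * n ^ 2 := by gcongr
    have e3 : L / n * (n : ℝ) ^ 2 = n * L := by field_simp
    rw [e1, mul_pow]
    have e4 : (C ^ 4 * c ^ 3) ^ 2 * L ^ 3 * L ≤ n * L := by gcongr
    linarith
  have hQ2 : truncLevel h m n ^ 2 = n * spread h m n / L := by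
    rw [truncLevel, div_pow, mul_pow, devRate_sq hh0, ← hLdef]
    field_simp
  have hQ4 : h n ^ 4 * n ^ 2 / L ^ 2 ≤ truncLevel h m n ^ 4 := by
    have e1 : truncLevel h m n ^ 4 = (truncLevel h m n ^ 2) ^ 2 := by ring
    rw [e1, hQ2, div_pow]
    have e2 : h n ^ 4 * (n : ℝ) ^ 2 = (n * h n ^ 2) ^ 2 := by ring
    rw [e2]
    gcongr
    exact sq_le_spread hh0
  rw [zero_mul]
  refine Finset.sum_nonpos fun q hq => ?_
  obtain ⟨hq1, hq2⟩ := Finset.mem_sigma.1 hq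
  rw [Finset.mem_range] at hq1 hq2
  set k : ℝ := (m n q.1 : ℝ) with hk
  have hk0 : 0 < k := by
    have := hM.two_le n q.1 hq1
    exact Nat.cast_pos.2 (by omega : 0 < m n q.1)
  have hchk : 1 ≤ c * h n * k := h1 q.1 hq1
  have hbound : |U q.1 q.2 ω| ≤ truncLevel h m n * k := by
    refine (hCU q.1 q.2).trans ?_
    have e1 : ((q.1 : ℝ) + 1) * (q.2 + 1) ≤ n * k := by
      have a1 : (q.1 : ℝ) + 1 ≤ n := by exact_mod_cast hq1
      have a2 : (q.2 : ℝ) + 1 ≤ k := by rw [hk]; exact_mod_cast hq2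
      gcongr
    refine le_trans (mul_le_mul_of_nonneg_left (Real.rpow_le_rpow (by positivity) e1
      (by norm_num)) hC.le) ?_
    refine le_of_pow_le_pow_left₀ (n := 4) (by norm_num) (by positivity) ?_
    rw [mul_pow, ← Real.rpow_natCast ((n * k) ^ (1 / 4 : ℝ)) 4, ← Real.rpow_mul (by positivity)]
    norm_num
    -- it remains to see `C⁴ n ≤ k³ Q⁴`, and `k³ Q⁴ ≥ k³ h⁴ n² / log² n ≥ c⁻³ h n² / log² n`
    have e2 : C ^ 4 * n ≤ k ^ 3 * (h n ^ 4 * n ^ 2 / L ^ 2) := by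
      rw [← mul_div_assoc, le_div_iff₀ (by positivity)]
      have e3 : 1 ≤ (c * h n * k) ^ 3 := one_le_pow₀ hchk
      have e4 : C ^ 4 * c ^ 3 * L ^ 2 * n ≤ (c * h n * k) ^ 3 * (h n * n * n) := by
        calc C ^ 4 * c ^ 3 * L ^ 2 * n ≤ h n * n * n := by gcongr
          _ = 1 * (h n * n * n) := (one_mul _).symm
          _ ≤ _ := by gcongr
      have e5 : c ^ 3 * (C ^ 4 * n * L ^ 2) ≤ c ^ 3 * (k ^ 3 * (h n ^ 4 * n ^ 2)) := by
        calc c ^ 3 * (C ^ 4 * n * L ^ 2) = C ^ 4 * c ^ 3 * L ^ 2 * n := by ring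
          _ ≤ (c * h n * k) ^ 3 * (h n * n * n) := e4
          _ = _ := by ring
      exact le_of_mul_le_mul_left e5 (by positivity)
    calc C ^ 4 * (n * k) = C ^ 4 * n * k := by ring
      _ ≤ k ^ 3 * (h n ^ 4 * n ^ 2 / L ^ 2) * k := by gcongr
      _ ≤ k ^ 3 * truncLevel h m n ^ 4 * k := by gcongr
      _ = (truncLevel h m n * k) ^ 4 := by ring
  rw [min_eq_left hbound, sub_self, mul_zero]

end DenseErrors

/-! ### The noise in the observations -/

section Noise

variable {Ω Ξ : Type*} [mΩ : MeasurableSpace Ω] [MeasurableSpace Ξ] {P : Measure Ω}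
  {Q : Measure Ξ} {a b : ℝ} {X : Ξ → ℝ → ℝ} {ζ : ℕ → Ω → Ξ} {fT : ℝ → ℝ}
  {T U : ℕ → ℕ → Ω → ℝ} {m : ℕ → ℕ → ℕ} {h : ℕ → ℝ} {p : ℝ}

/-- A measurable envelope of the sample paths, with finite `p`-th moment. -/
theorem MomentCondition.exists_envelope (hp : 2 < p) (hX : MomentCondition P Q a b X U p) :
    ∃ B : Ξ → ℝ, Measurable B ∧ (∀ ξ, 0 ≤ B ξ) ∧ MemLp B (ENNReal.ofReal p) Q ∧
      ∀ᵐ ξ ∂Q, ∀ t ∈ Set.Icc a b, |X ξ t| ≤ B ξ := by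
  have hp0 : ENNReal.ofReal p ≠ 0 := by simp; linarith
  have hp' : 0 < p := by linarith
  set E' := hX.aemeasurable_sup.mk with hE'
  have hE'm : Measurable E' := hX.aemeasurable_sup.measurable_mk
  have hae := hX.aemeasurable_sup.ae_eq_mk
  have hlt : ∫⁻ ξ, E' ξ ∂Q < ∞ := by
    rw [← lintegral_congr_ae hae]; exact hX.process
  have hBm : Measurable fun ξ => (E' ξ).toReal ^ (1 / p) := hE'm.ennreal_toReal.pow_const _
  refine ⟨fun ξ => (E' ξ).toReal ^ (1 / p), hBm, fun ξ => by positivity, ?_, ?_⟩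
  · refine ⟨hBm.aestronglyMeasurable, ?_⟩
    rw [eLpNorm_lt_top_iff_lintegral_rpow_enorm_lt_top hp0 ENNReal.ofReal_ne_top,
      ENNReal.toReal_ofReal hp'.le]
    refine lt_of_le_of_lt (lintegral_mono fun ξ => ?_) hlt
    rw [Real.enorm_of_nonneg (by positivity), ENNReal.ofReal_rpow_of_nonneg (by positivity) hp'.le,
      ← Real.rpow_mul ENNReal.toReal_nonneg, one_div_mul_cancel hp'.ne', Real.rpow_one]
    exact ENNReal.ofReal_toReal_le
  · filter_upwards [hae, ae_lt_top hE'm hlt.ne] with ξ h1 h2 t ht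
    have h3 : ‖X ξ t‖ₑ ^ p ≤ E' ξ := by
      refine le_of_le_of_eq ?_ h1
      exact le_iSup₂ (f := fun t (_ : t ∈ Set.Icc a b) => ‖X ξ t‖ₑ ^ p) t ht
    have h4 : |X ξ t| ^ p ≤ (E' ξ).toReal := by
      have := ENNReal.toReal_mono h2.ne h3
      rwa [← ENNReal.toReal_rpow, toReal_enorm, Real.norm_eq_abs] at this
    have h5 := Real.rpow_le_rpow (by positivity) h4 (by positivity : 0 ≤ 1 / p)
    rwa [← Real.rpow_mul (abs_nonneg _), mul_one_div_cancel hp'.ne', Real.rpow_one] at h5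

theorem measurable_meanFun [SFinite Q] (hX : Measurable (Function.uncurry X)) :
    Measurable (meanFun Q X) := by
  have : StronglyMeasurable (fun z : ℝ × Ξ => X z.2 z.1) :=
    (hX.comp measurable_swap).stronglyMeasurable
  exact (this.integral_prod_right' (ν := Q)).measurable

/-- The weighted sums of the centred curves over all intervals in all windows. -/
theorem IsModel.ae_signal_deviation [IsProbabilityMeasure P] [IsProbabilityMeasure Q]
    (hM : IsModel P Q a b X ζ fT T U m) (hfT : DensityCondition a b fT) (hp : 2 < p)
    (hh : BandwidthCondition h m p) (hX : MomentCondition P Q a b X U p) :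
    ∃ C : ℝ, ∀ᵐ ω ∂P, ∀ᶠ n in atTop, ∀ t ∈ Set.Icc a b, ∀ I : Set ℝ, I.OrdConnected →
      I ⊆ Set.Icc (t - h n) (t + h n) →
      |∑ q ∈ pairs n (m n), pairWeight n (m n) q *
          ((X (ζ q.1 ω) (T q.1 q.2 ω) - meanFun Q X (T q.1 q.2 ω)) *
            I.indicator 1 (T q.1 q.2 ω))| ≤ C * devRate h m n := by
  have hνp := hM.isProbabilityMeasure_timeLaw
  obtain ⟨B, hBm, hB0, hBp, hB⟩ := hX.exists_envelope hp
  have hXm := hM.measurable_process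
  have hXm' : Measurable fun z : Ξ × ℝ => X z.1 z.2 := hXm
  have hμm : Measurable (meanFun Q X) := measurable_meanFun hXm
  have hB1 : Integrable B Q := by
    refine memLp_one_iff_integrable.1 (hBp.mono_exponent ?_)
    rw [← ENNReal.ofReal_one]
    exact ENNReal.ofReal_le_ofReal (by linarith)
  have hXi : ∀ t ∈ Set.Icc a b, Integrable (fun ξ => X ξ t) Q := fun t ht =>
    hB1.mono' (hXm'.comp (measurable_id.prodMk measurable_const)).aestronglyMeasurable
      (by filter_upwards [hB] with ξ hξ using hξ t ht)
  set M := ∫ ξ, B ξ ∂Q with hMdef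
  have hM0 : 0 ≤ M := integral_nonneg hB0
  have hμM : ∀ t ∈ Set.Icc a b, |meanFun Q X t| ≤ M := fun t ht =>
    norm_integral_le_of_norm_le (f := fun ξ => X ξ t) hB1
      (by filter_upwards [hB] with ξ hξ using hξ t ht)
  have hBM : ∀ᵐ ξ ∂Q, ∀ t ∈ Set.Icc a b, |X ξ t - meanFun Q X t| ≤ B ξ + M := by
    filter_upwards [hB] with ξ hξ t ht
    exact (abs_sub _ _).trans (add_le_add (hξ t ht) (hμM t ht))
  have hBMm : Measurable fun ξ => B ξ + M := hBm.add_const M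
  have hBM0 : ∀ ξ, 0 ≤ B ξ + M := fun ξ => add_nonneg (hB0 ξ) hM0
  have hBMp : MemLp (fun ξ => B ξ + M) (ENNReal.ofReal p) Q := hBp.add (memLp_const M)
  let Φ : Ξ → ℝ → ℝ := fun ξ t => X ξ t - meanFun Q X t
  have hΦm : Measurable fun z : Ξ × ℝ => Φ z.1 z.2 := hXm'.sub (hμm.comp measurable_snd)
  obtain ⟨C₁, hC₁⟩ := hM.ae_curve_deviation hfT hp hh (Ψ := fun ξ t => max (Φ ξ t) 0)
    (B := fun ξ => B ξ + M) (hΦm.max measurable_const) (fun _ _ => le_max_right _ _) hBMm hBM0 hBMp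
    (by
      filter_upwards [hBM] with ξ hξ t ht
      exact max_le ((le_abs_self _).trans (hξ t ht)) (hBM0 ξ))
  obtain ⟨C₂, hC₂⟩ := hM.ae_curve_deviation hfT hp hh (Ψ := fun ξ t => max (-Φ ξ t) 0)
    (B := fun ξ => B ξ + M) (hΦm.neg.max measurable_const) (fun _ _ => le_max_right _ _) hBMm hBM0
    hBMp
    (by
      filter_upwards [hBM] with ξ hξ t ht
      exact max_le ((neg_le_abs _).trans (hξ t ht)) (hBM0 ξ))
  set ν := timeLaw a b fT with hν
  have hΦle : ∀ᵐ z ∂(Q.prod ν), |Φ z.1 z.2| ≤ B z.1 + M :=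
    ae_prod_timeLaw_le (Ψ := fun ξ t => |Φ ξ t|) hBM
  have hBMi : Integrable (fun z : Ξ × ℝ => B z.1 + M) (Q.prod ν) :=
    (hB1.comp_fst ν).add (integrable_const M)
  -- positive and negative parts have the same mean, because the curves are centred
  have hmean : ∀ I : Set ℝ, MeasurableSet I →
      ∫ z, max (Φ z.1 z.2) 0 * I.indicator 1 z.2 ∂(Q.prod ν) =
        ∫ z, max (-Φ z.1 z.2) 0 * I.indicator 1 z.2 ∂(Q.prod ν) := by
    intro I hI
    have hIz : Measurable fun z : Ξ × ℝ => I.indicator (1 : ℝ → ℝ) z.2 :=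
      (measurable_one.indicator hI).comp measurable_snd
    have hint : ∀ Ψ : Ξ × ℝ → ℝ, Measurable Ψ → (∀ z, |Ψ z| ≤ |Φ z.1 z.2|) →
        Integrable (fun z => Ψ z * I.indicator 1 z.2) (Q.prod ν) := by
      intro Ψ hΨ hle
      refine hBMi.mono' (hΨ.mul hIz).aestronglyMeasurable ?_
      filter_upwards [hΦle] with z hz
      rw [norm_mul, Real.norm_of_nonneg (indicator_one_nonneg _ _)]
      exact (mul_le_of_le_one_right (norm_nonneg _) (indicator_one_le_one _ _)).trans
        ((hle z).trans hz)
    have hi1 := hint (fun z => max (Φ z.1 z.2) 0) (hΦm.max measurable_const) fun z => by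
      rw [abs_of_nonneg (le_max_right _ _)]
      exact max_le (le_abs_self _) (abs_nonneg _)
    have hi2 := hint (fun z => max (-Φ z.1 z.2) 0) (hΦm.neg.max measurable_const) fun z => by
      rw [abs_of_nonneg (le_max_right _ _)]
      exact max_le (neg_le_abs _) (abs_nonneg _)
    have hi3 := hint (fun z => Φ z.1 z.2) hΦm fun z => le_rfl
    rw [← sub_eq_zero, ← integral_sub hi1 hi2]
    have e : ∀ z : Ξ × ℝ, max (Φ z.1 z.2) 0 * I.indicator 1 z.2 -
        max (-Φ z.1 z.2) 0 * I.indicator 1 z.2 = Φ z.1 z.2 * I.indicator (1 : ℝ → ℝ) z.2 := by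
      intro z
      rw [← sub_mul]
      congr 1
      rcases le_total 0 (Φ z.1 z.2) with h | h
      · rw [max_eq_left h, max_eq_right (by linarith), sub_zero]
      · rw [max_eq_right h, max_eq_left (by linarith)]; ring
    simp_rw [e]
    rw [integral_prod_symm _ hi3]
    refine integral_eq_zero_of_ae ?_
    filter_upwards [ae_mem_timeLaw (a := a) (b := b) (fT := fT)] with t ht
    simp only [Φ, Pi.zero_apply]
    rw [integral_mul_const, integral_sub (hXi t ht) (integrable_const _)]
    simp [meanFun]
  refine ⟨C₁ + C₂, ?_⟩
  filter_upwards [hC₁, hC₂] with ω h1 h2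
  filter_upwards [h1, h2] with n h3 h4 t ht I hI hIs
  have h5 := h3 t ht I hI hIs
  have h6 := h4 t ht I hI hIs
  rw [← hmean I hI.measurableSet] at h6
  have e : ∑ q ∈ pairs n (m n), pairWeight n (m n) q *
      ((X (ζ q.1 ω) (T q.1 q.2 ω) - meanFun Q X (T q.1 q.2 ω)) * I.indicator 1 (T q.1 q.2 ω)) =
      ∑ q ∈ pairs n (m n), pairWeight n (m n) q *
        (max (Φ (ζ q.1 ω) (T q.1 q.2 ω)) 0 * I.indicator 1 (T q.1 q.2 ω)) -
      ∑ q ∈ pairs n (m n), pairWeight n (m n) q *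
        (max (-Φ (ζ q.1 ω) (T q.1 q.2 ω)) 0 * I.indicator 1 (T q.1 q.2 ω)) := by
    rw [← Finset.sum_sub_distrib]
    refine Finset.sum_congr rfl fun q _ => ?_
    rw [← mul_sub, ← sub_mul]
    congr 2
    change Φ (ζ q.1 ω) (T q.1 q.2 ω) = _
    rcases le_total 0 (Φ (ζ q.1 ω) (T q.1 q.2 ω)) with h | h
    · rw [max_eq_left h, max_eq_right (by linarith), sub_zero]
    · rw [max_eq_right h, max_eq_left (by linarith)]; ring
  rw [e, add_mul]
  rw [abs_le] at h5 h6 ⊢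
  constructor <;> linarith [h5.1, h5.2, h6.1, h6.2]

/-- The weighted sums of the errors over all intervals in all windows. -/
theorem IsModel.ae_error_sum_le [IsProbabilityMeasure P]
    (hM : IsModel P Q a b X ζ fT T U m) (hfT : DensityCondition a b fT) (hp : 2 < p)
    (hh : BandwidthCondition h m p) (hU : MomentCondition P Q a b X U p)
    (hexc : ∀ᵐ ω ∂P, ∃ C : ℝ, ∀ᶠ n in atTop, errorExcess h m U n ω ≤ C * devRate h m n) :
    ∀ᵐ ω ∂P, ∃ C : ℝ, ∀ᶠ n in atTop, ∀ t ∈ Set.Icc a b, ∀ I : Set ℝ, I.OrdConnected →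
      I ⊆ Set.Icc (t - h n) (t + h n) →
      |∑ q ∈ pairs n (m n), pairWeight n (m n) q *
          (U q.1 q.2 ω * I.indicator 1 (T q.1 q.2 ω))| ≤ C * devRate h m n := by
  have hUi : Integrable (U 0 0) P := (hM.memLp_error 0 0).integrable (by norm_num)
  have hpart : ∀ u : ℝ, max u 0 - max (-u) 0 = u := by
    intro u
    rcases le_total 0 u with h | h
    · rw [max_eq_left h, max_eq_right (by linarith), sub_zero]
    · rw [max_eq_right h, max_eq_left (by linarith)]; ring
  have hmean : ∫ ω, max (U 0 0 ω) 0 ∂P = ∫ ω, max (-U 0 0 ω) 0 ∂P := by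
    rw [← sub_eq_zero, ← integral_sub hUi.pos_part hUi.neg_part]
    simp_rw [hpart]
    exact hM.mean_error 0 0
  filter_upwards [
    hM.ae_error_deviation hfT hp hh hU hexc (ψ := fun u => max u 0) (by fun_prop)
      (fun u => le_max_right _ _) (fun u => max_le (le_abs_self _) (abs_nonneg _)),
    hM.ae_error_deviation hfT hp hh hU hexc (ψ := fun u => max (-u) 0) (by fun_prop)
      (fun u => le_max_right _ _) (fun u => max_le (neg_le_abs _) (abs_nonneg _))]
    with ω ⟨C₁, h1⟩ ⟨C₂, h2⟩
  refine ⟨C₁ + C₂, ?_⟩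
  filter_upwards [h1, h2] with n h3 h4 t ht I hI hIs
  have h5 := h3 t ht I hI hIs
  have h6 := h4 t ht I hI hIs
  rw [← hmean] at h6
  have e : ∑ q ∈ pairs n (m n), pairWeight n (m n) q *
      (U q.1 q.2 ω * I.indicator 1 (T q.1 q.2 ω)) =
      ∑ q ∈ pairs n (m n), pairWeight n (m n) q *
        (max (U q.1 q.2 ω) 0 * I.indicator 1 (T q.1 q.2 ω)) -
      ∑ q ∈ pairs n (m n), pairWeight n (m n) q *
        (max (-U q.1 q.2 ω) 0 * I.indicator 1 (T q.1 q.2 ω)) := by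
    rw [← Finset.sum_sub_distrib]
    refine Finset.sum_congr rfl fun q _ => ?_
    rw [← mul_sub, ← sub_mul, hpart]
  rw [e, add_mul]
  rw [abs_le] at h5 h6 ⊢
  constructor <;> linarith [h5.1, h5.2, h6.1, h6.2]

/-- The empirical law of the observation times is uniformly close to the law of the times. -/
theorem IsModel.ae_design_deviation [IsProbabilityMeasure P] [IsProbabilityMeasure Q]
    (hM : IsModel P Q a b X ζ fT T U m) (hfT : DensityCondition a b fT) (hp : 2 < p)
    (hh : BandwidthCondition h m p) :
    ∃ C : ℝ, ∀ᵐ ω ∂P, ∀ᶠ n in atTop, ∀ t ∈ Set.Icc a b, ∀ I : Set ℝ, I.OrdConnected →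
      I ⊆ Set.Icc (t - h n) (t + h n) →
      |∑ q ∈ pairs n (m n), pairWeight n (m n) q * I.indicator 1 (T q.1 q.2 ω) -
        (timeLaw a b fT).real I| ≤ C * devRate h m n := by
  have hνp := hM.isProbabilityMeasure_timeLaw
  obtain ⟨C, hC⟩ := hM.ae_curve_deviation hfT hp hh (Ψ := fun _ _ => 1) (B := fun _ => 1)
    measurable_const (fun _ _ => zero_le_one) measurable_const (fun _ => zero_le_one)
    (memLp_const 1) (ae_of_all _ fun ξ t _ => le_rfl)
  refine ⟨C, ?_⟩
  filter_upwards [hC] with ω h1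
  filter_upwards [h1] with n h2 t ht I hI hIs
  have h3 := h2 t ht I hI hIs
  simp only [one_mul] at h3
  rw [integral_fun_snd (fun t : ℝ => I.indicator (1 : ℝ → ℝ) t),
    integral_indicator_one hI.measurableSet] at h3
  simpa using h3

end Noise

/-! ### The error of the local-linear estimator -/

theorem boundedVariationOn_pow (r : ℕ) :
    BoundedVariationOn (fun u : ℝ => u ^ r) (Set.Icc (-1) 1) := by
  induction r with
  | zero =>
    simp only [pow_zero]
    have hmono : MonotoneOn (fun _ : ℝ => (1 : ℝ)) (Set.Icc (-1) 1) := fun _ _ _ _ _ => le_rfl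
    have := hmono.locallyBoundedVariationOn (-1) 1 (by norm_num) (by norm_num)
    rwa [Set.inter_self] at this
  | succ r ih =>
    have hmono : MonotoneOn (fun u : ℝ => u) (Set.Icc (-1) 1) := fun _ _ _ _ h => h
    have := hmono.locallyBoundedVariationOn (-1) 1 (by norm_num) (by norm_num)
    rw [Set.inter_self] at this
    have h2 := ih.mul this
    simp only [pow_succ]
    exact h2

/-- The moments `K(u) u ^ r` of the kernel inherit bounded variation. -/
theorem KernelCondition.exists_moment_bound {K : ℝ → ℝ} (hK : KernelCondition K) (r : ℕ) :
    ∃ C : ℝ, 0 ≤ C ∧ ∀ {ι : Type} (S : Finset ι) (w x : ι → ℝ) (ν : Measure ℝ) (t h ε : ℝ),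
      IsFiniteMeasure ν → 0 < h →
      (∀ I : Set ℝ, I.OrdConnected → I ⊆ Set.Icc (t - h) (t + h) →
        |∑ i ∈ S, w i * I.indicator 1 (x i) - ν.real I| ≤ ε) →
      Integrable (fun y => K ((y - t) / h) * ((y - t) / h) ^ r) ν ∧
        |∑ i ∈ S, w i * (K ((x i - t) / h) * ((x i - t) / h) ^ r) -
          ∫ y, K ((y - t) / h) * ((y - t) / h) ^ r ∂ν| ≤ C * ε := by
  have hbv : BoundedVariationOn (fun u => K u * u ^ r) (Set.Icc (-1) 1) :=
    hK.boundedVariation.mul (boundedVariationOn_pow r)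
  exact exists_abs_sum_sub_integral_le hbv fun x hx => by rw [hK.support x hx, zero_mul]

/-- Lower bounds for a binary quadratic form survive small perturbations of its coefficients. -/
theorem quadraticForm_ge_of_abs_sub_le {s₀ s₁ s₂ σ₀ σ₁ σ₂ L δ₀ δ₁ δ₂ : ℝ}
    (hs : ∀ α β : ℝ, L * (α ^ 2 + β ^ 2) ≤ α ^ 2 * s₀ + 2 * α * β * s₁ + β ^ 2 * s₂)
    (d₀ : |σ₀ - s₀| ≤ δ₀) (d₁ : |σ₁ - s₁| ≤ δ₁) (d₂ : |σ₂ - s₂| ≤ δ₂)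
    (hδ : δ₀ + δ₁ + δ₂ ≤ L / 2) (α β : ℝ) :
    L / 2 * (α ^ 2 + β ^ 2) ≤ α ^ 2 * σ₀ + 2 * α * β * σ₁ + β ^ 2 * σ₂ := by
  have hδ₀ : 0 ≤ δ₀ := (abs_nonneg _).trans d₀
  have hδ₂ : 0 ≤ δ₂ := (abs_nonneg _).trans d₂
  have b0 : -(α ^ 2 * δ₀) ≤ α ^ 2 * (σ₀ - s₀) := by
    rw [← mul_neg]
    exact mul_le_mul_of_nonneg_left (abs_le.1 d₀).1 (sq_nonneg α)
  have b2 : -(β ^ 2 * δ₂) ≤ β ^ 2 * (σ₂ - s₂) := by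
    rw [← mul_neg]
    exact mul_le_mul_of_nonneg_left (abs_le.1 d₂).1 (sq_nonneg β)
  have b1 : |2 * α * β * (σ₁ - s₁)| ≤ (α ^ 2 + β ^ 2) * δ₁ := by
    rw [abs_mul]
    refine mul_le_mul ?_ d₁ (abs_nonneg _) (by positivity)
    rw [abs_le]
    constructor <;> linarith [sq_nonneg (α + β), sq_nonneg (α - β)]
  have p0 : 0 ≤ β ^ 2 * δ₀ := mul_nonneg (sq_nonneg β) hδ₀
  have p2 : 0 ≤ α ^ 2 * δ₂ := mul_nonneg (sq_nonneg α) hδ₂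
  have hL : (α ^ 2 + β ^ 2) * (δ₀ + δ₁ + δ₂) ≤ (α ^ 2 + β ^ 2) * (L / 2) :=
    mul_le_mul_of_nonneg_left hδ (by positivity)
  linarith [hs α β, (abs_le.1 b1).1]

set_option maxHeartbeats 400000 in
/-- Deterministic error bound for the local-linear estimator at one location `t`, in terms of the
deviations `ε₁` of the design and `ε₂` of the noise on the intervals of the window. -/
theorem exists_abs_localLinear_sub_le {a b : ℝ} (hab : a < b) {fT K μ : ℝ → ℝ}
    (hfT : DensityCondition a b fT) (hν : IsProbabilityMeasure (timeLaw a b fT))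
    (hK : KernelCondition K) (hμ : MeanCondition a b μ) :
    ∃ c C : ℝ, 0 < c ∧ 0 ≤ C ∧ ∀ (S : Finset ((_ : ℕ) × ℕ)) (w x y : ((_ : ℕ) × ℕ) → ℝ)
      (t h ε₁ ε₂ a₀ a₁ : ℝ), (∀ i, 0 ≤ w i) → (∀ i ∈ S, x i ∈ Set.Icc a b) → t ∈ Set.Icc a b →
      0 < h → h ≤ (b - a) / 2 → ε₁ ≤ c * h →
      (∀ I : Set ℝ, I.OrdConnected → I ⊆ Set.Icc (t - h) (t + h) →
        |∑ i ∈ S, w i * I.indicator 1 (x i) - (timeLaw a b fT).real I| ≤ ε₁) →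
      (∀ I : Set ℝ, I.OrdConnected → I ⊆ Set.Icc (t - h) (t + h) →
        |∑ i ∈ S, w i * ((y i - μ (x i)) * I.indicator 1 (x i))| ≤ ε₂) →
      (∀ c₀ c₁ : ℝ, ∑ i ∈ S, w i * ((y i - a₀ - a₁ * (x i - t)) ^ 2 * scaledKernel K h (x i - t)) ≤
        ∑ i ∈ S, w i * ((y i - c₀ - c₁ * (x i - t)) ^ 2 * scaledKernel K h (x i - t))) →
      |a₀ - μ t| ≤ C * (h ^ 2 + ε₂ / h) := by
  obtain ⟨l, hl, hform⟩ := exists_design_form hfT hK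
  obtain ⟨D, hD0, htaylor⟩ := hμ.taylor hab
  obtain ⟨Kb, hKb0, hKb⟩ := hK.exists_bound
  obtain ⟨C₀, hC₀, hb₀⟩ := hK.exists_moment_bound 0
  obtain ⟨C₁, hC₁, hb₁⟩ := hK.exists_moment_bound 1
  obtain ⟨C₂, hC₂, hb₂⟩ := hK.exists_moment_bound 2
  obtain ⟨⟨cT, DT, hcT, hDT⟩, -, -⟩ := hfT
  have hDT0 : 0 ≤ DT := hcT.le.trans ((hDT a ⟨le_rfl, hab.le⟩).1.trans (hDT a ⟨le_rfl, hab.le⟩).2)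
  set ν := timeLaw a b fT with hνdef
  set Cm := C₀ + C₁ + C₂ + 1 with hCm
  have hCm0 : 0 < Cm := by positivity
  set c := min 1 (l / (4 * Cm)) with hc
  have hc0 : 0 < c := lt_min one_pos (by positivity)
  set Sb := Kb * (DT * 2 + 1) with hSb
  have hSb0 : 0 ≤ Sb := by positivity
  refine ⟨c, 2 * (C₀ + C₁ + 2 * (D * Sb)) / (l / 2), hc0, by positivity, ?_⟩
  intro S w x y t h ε₁ ε₂ a₀ a₁ hw hx ht hh hhb hε₁ hdes hnoise hmin
  have hε₁0 : 0 ≤ ε₁ := (abs_nonneg _).trans (hdes ∅ Set.ordConnected_empty (Set.empty_subset _))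
  have hε₂0 : 0 ≤ ε₂ := (abs_nonneg _).trans (hnoise ∅ Set.ordConnected_empty (Set.empty_subset _))
  let u : ((_ : ℕ) × ℕ) → ℝ := fun i => (x i - t) / h
  let W : ((_ : ℕ) × ℕ) → ℝ := fun i => w i * (h⁻¹ * K (u i))
  have hu : ∀ i, h * u i = x i - t := fun i => mul_div_cancel₀ _ hh.ne'
  have hW0 : ∀ i, 0 ≤ W i := fun i =>
    mul_nonneg (hw i) (mul_nonneg (inv_nonneg.2 hh.le) (hK.nonneg _))
  -- the quadratic form of the design
  obtain ⟨i₀, d₀⟩ := hb₀ S w x ν t h ε₁ inferInstance hh hdes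
  obtain ⟨i₁, d₁⟩ := hb₁ S w x ν t h ε₁ inferInstance hh hdes
  obtain ⟨i₂, d₂⟩ := hb₂ S w x ν t h ε₁ inferInstance hh hdes
  set s₀ := ∫ y, K ((y - t) / h) * ((y - t) / h) ^ 0 ∂ν
  set s₁ := ∫ y, K ((y - t) / h) * ((y - t) / h) ^ 1 ∂ν
  set s₂ := ∫ y, K ((y - t) / h) * ((y - t) / h) ^ 2 ∂ν
  set σ₀ := ∑ i ∈ S, w i * (K ((x i - t) / h) * ((x i - t) / h) ^ 0)
  set σ₁ := ∑ i ∈ S, w i * (K ((x i - t) / h) * ((x i - t) / h) ^ 1)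
  set σ₂ := ∑ i ∈ S, w i * (K ((x i - t) / h) * ((x i - t) / h) ^ 2)
  have hs : ∀ α β : ℝ, l * h * (α ^ 2 + β ^ 2) ≤
      α ^ 2 * s₀ + 2 * α * β * s₁ + β ^ 2 * s₂ := by
    intro α β
    have e : ∫ y, K ((y - t) / h) * (α + β * ((y - t) / h)) ^ 2 ∂ν =
        α ^ 2 * s₀ + 2 * α * β * s₁ + β ^ 2 * s₂ := by
      have j₀ := i₀.const_mul (α ^ 2)
      have j₁ := i₁.const_mul (2 * α * β)
      have j₂ := i₂.const_mul (β ^ 2)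
      have k₂ := integral_add (j₀.add j₁) j₂
      have k₁ := integral_add j₀ j₁
      rw [integral_const_mul, integral_const_mul] at k₁
      rw [integral_const_mul] at k₂
      simp only [Pi.add_apply] at k₂
      rw [k₁] at k₂
      rw [← k₂]
      refine integral_congr_ae (ae_of_all _ fun y => ?_)
      simp only
      ring
    have h1 := mul_le_mul_of_nonneg_left (hform h hh hhb t ht α β) hh.le
    rw [e, mul_inv_cancel_left₀ hh.ne'] at h1
    linarith
  have hδ : C₀ * ε₁ + C₁ * ε₁ + C₂ * ε₁ ≤ l * h / 2 := by
    have h1 : ε₁ ≤ l / (4 * Cm) * h :=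
      hε₁.trans (mul_le_mul_of_nonneg_right (min_le_right _ _) hh.le)
    have h2 : Cm * ε₁ ≤ Cm * (l / (4 * Cm) * h) := mul_le_mul_of_nonneg_left h1 hCm0.le
    have h3 : Cm * (l / (4 * Cm) * h) = l * h / 4 := by field_simp
    have h4 : 0 < l * h := mul_pos hl hh
    have h5 : Cm * ε₁ = C₀ * ε₁ + C₁ * ε₁ + C₂ * ε₁ + ε₁ := by rw [hCm]; ring
    linarith
  have hpd : ∀ α β : ℝ, l / 2 * (α ^ 2 + β ^ 2) ≤ ∑ i ∈ S, W i * (α + β * u i) ^ 2 := by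
    intro α β
    have e : ∑ i ∈ S, W i * (α + β * u i) ^ 2 =
        h⁻¹ * (α ^ 2 * σ₀ + 2 * α * β * σ₁ + β ^ 2 * σ₂) := by
      simp only [σ₀, σ₁, σ₂, Finset.mul_sum, ← Finset.sum_add_distrib]
      refine Finset.sum_congr rfl fun i _ => ?_
      simp only [W, u]; ring
    rw [e, ← div_eq_inv_mul, le_div_iff₀ hh]
    linarith [quadraticForm_ge_of_abs_sub_le hs d₀ d₁ d₂ hδ α β]
  -- the total kernel weight
  have hSW : ∑ i ∈ S, W i ≤ Sb := by
    have h1 : ∀ i ∈ S, W i ≤ h⁻¹ * Kb * (w i * (Set.Icc (t - h) (t + h)).indicator 1 (x i)) := by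
      intro i _
      by_cases hi : x i ∈ Set.Icc (t - h) (t + h)
      · simp only [W, Set.indicator_of_mem hi, Pi.one_apply, mul_one]
        calc w i * (h⁻¹ * K (u i)) ≤ w i * (h⁻¹ * Kb) :=
              mul_le_mul_of_nonneg_left (mul_le_mul_of_nonneg_left (hKb _) (inv_nonneg.2 hh.le))
                (hw i)
          _ = _ := by ring
      · have : u i ∉ Set.Icc (-1 : ℝ) 1 := by
          intro hui
          apply hi
          have e := hu i
          constructor <;> nlinarith [hui.1, hui.2]
        simp [W, hK.support _ this, hi]
    have h2 := (abs_le.1 (hdes _ (Set.ordConnected_Icc (a := t - h) (b := t + h)) subset_rfl)).2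
    have h3 : ν.real (Set.Icc (t - h) (t + h)) ≤ DT * (2 * h) := by
      have := timeLaw_le (fun s hs => (hDT s hs).2) (Set.Icc (t - h) (t + h)) measurableSet_Icc
      rw [Real.volume_Icc, ← ENNReal.ofReal_mul hDT0] at this
      refine ENNReal.toReal_le_of_le_ofReal (by positivity) (this.trans_eq ?_)
      congr 2; ring
    have h4 : ε₁ ≤ h := hε₁.trans (by
      calc c * h ≤ 1 * h := by gcongr; exact min_le_left _ _
        _ = h := one_mul h)
    refine (Finset.sum_le_sum h1).trans ?_
    rw [← Finset.mul_sum]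
    calc h⁻¹ * Kb * ∑ i ∈ S, w i * (Set.Icc (t - h) (t + h)).indicator 1 (x i)
        ≤ h⁻¹ * Kb * (DT * (2 * h) + h) := by gcongr; linarith
      _ = Sb := by rw [hSb]; field_simp
  -- the residuals of the tangent line
  set d := derivWithin μ (Set.Icc a b) t with hd
  have hmin' : ∀ c₀ c₁ : ℝ, ∑ i ∈ S, W i * (y i - a₀ - a₁ * (h * u i)) ^ 2 ≤
      ∑ i ∈ S, W i * (y i - c₀ - c₁ * (h * u i)) ^ 2 := by
    intro c₀ c₁
    have e : ∀ e₀ e₁ : ℝ, ∑ i ∈ S, W i * (y i - e₀ - e₁ * (h * u i)) ^ 2 =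
        ∑ i ∈ S, w i * ((y i - e₀ - e₁ * (x i - t)) ^ 2 * scaledKernel K h (x i - t)) := by
      intro e₀ e₁
      refine Finset.sum_congr rfl fun i _ => ?_
      rw [hu]
      simp only [W, u, scaledKernel]; ring
    rw [e, e]
    exact hmin c₀ c₁
  have hmain := abs_intercept_sub_le S W u y hh.ne' (by positivity : 0 < l / 2) a₀ a₁ (μ t) d hmin'
    hpd
  have hnoise' : ∀ I : Set ℝ, I.OrdConnected → I ⊆ Set.Icc (t - h) (t + h) →
      |∑ i ∈ S, w i * (y i - μ (x i)) * I.indicator 1 (x i) - (0 : Measure ℝ).real I| ≤ ε₂ := by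
    intro I hI hIs
    simpa [mul_assoc] using hnoise I hI hIs
  have hres : ∀ (v : ((_ : ℕ) × ℕ) → ℝ) (C' : ℝ),
      (∀ i, K (u i) ≠ 0 → |v i| ≤ 1) →
      |∑ i ∈ S, w i * (y i - μ (x i)) * (K (u i) * v i)| ≤ C' * ε₂ →
      |∑ i ∈ S, W i * v i * (y i - μ t - d * (h * u i))| ≤
        h⁻¹ * (C' * ε₂) + Sb * (D * h ^ 2) := by
    intro v C' hv hC'
    have e1 : ∑ i ∈ S, W i * v i * (y i - μ t - d * (h * u i)) =
        h⁻¹ * ∑ i ∈ S, w i * (y i - μ (x i)) * (K (u i) * v i) +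
        ∑ i ∈ S, W i * (v i * (μ (x i) - μ t - d * (x i - t))) := by
      rw [Finset.mul_sum, ← Finset.sum_add_distrib]
      refine Finset.sum_congr rfl fun i _ => ?_
      rw [hu]
      simp only [W]; ring
    rw [e1]
    refine (abs_add_le _ _).trans (add_le_add ?_ ?_)
    · rw [abs_mul, abs_of_nonneg (inv_nonneg.2 hh.le)]
      gcongr
    · refine (Finset.abs_sum_le_sum_abs _ _).trans ?_
      have : ∀ i ∈ S, |W i * (v i * (μ (x i) - μ t - d * (x i - t)))| ≤ W i * (D * h ^ 2) := by
        intro i hi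
        rw [abs_mul, abs_of_nonneg (hW0 i)]
        by_cases hKu : K (u i) = 0
        · simp [W, hKu]
        · have hui : u i ∈ Set.Icc (-1 : ℝ) 1 := by
            by_contra hn
            exact hKu (hK.support _ hn)
          refine mul_le_mul_of_nonneg_left ?_ (hW0 i)
          rw [abs_mul]
          have h1 := htaylor t ht (x i) (hx i hi)
          have h2 : (x i - t) ^ 2 ≤ h ^ 2 := by
            rw [← hu i, mul_pow]
            have : u i ^ 2 ≤ 1 := by nlinarith [hui.1, hui.2]
            nlinarith [sq_nonneg h]
          calc |v i| * |μ (x i) - μ t - d * (x i - t)| ≤ 1 * (D * (x i - t) ^ 2) :=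
                mul_le_mul (hv i hKu) h1 (abs_nonneg _) zero_le_one
            _ ≤ D * h ^ 2 := by rw [one_mul]; gcongr
      refine (Finset.sum_le_sum this).trans ?_
      rw [← Finset.sum_mul]
      gcongr
  have n₀ := (hb₀ S (fun i => w i * (y i - μ (x i))) x 0 t h ε₂ inferInstance hh hnoise').2
  have n₁ := (hb₁ S (fun i => w i * (y i - μ (x i))) x 0 t h ε₂ inferInstance hh hnoise').2
  rw [integral_zero_measure, sub_zero] at n₀ n₁
  have r₀ := hres (fun _ => 1) C₀ (fun i _ => by simp) (by simpa only [pow_zero] using n₀)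
  have r₁ := hres u C₁ (fun i hi => abs_le.2 (by
    by_contra hn
    exact hi (hK.support _ hn))) (by simpa only [pow_one] using n₁)
  simp only [mul_one] at r₀
  refine hmain.trans ?_
  rw [div_mul_eq_mul_div]
  refine div_le_div_of_nonneg_right ?_ (by positivity)
  have f1 : h⁻¹ * (C₀ * ε₂) + Sb * (D * h ^ 2) + (h⁻¹ * (C₁ * ε₂) + Sb * (D * h ^ 2)) =
      (C₀ + C₁) * (ε₂ / h) + 2 * (D * Sb) * h ^ 2 := by
    rw [div_eq_mul_inv]; ring
  have f2 : 0 ≤ ε₂ / h := by positivity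
  have f3 : 0 ≤ (C₀ + C₁) * (ε₂ / h) := by positivity
  have f4 : 0 ≤ (C₀ + C₁) * h ^ 2 := by positivity
  have f5 : 0 ≤ D * Sb * h ^ 2 := by positivity
  have f6 : 0 ≤ D * Sb * (ε₂ / h) := by positivity
  nlinarith

section Rate

variable {Ω Ξ : Type*} [mΩ : MeasurableSpace Ω] [MeasurableSpace Ξ] {P : Measure Ω}
  {Q : Measure Ξ} {a b : ℝ} {X : Ξ → ℝ → ℝ} {ζ : ℕ → Ω → Ξ} {fT K : ℝ → ℝ}
  {T U : ℕ → ℕ → Ω → ℝ} {m : ℕ → ℕ → ℕ} {h : ℕ → ℝ} {p : ℝ} {μhat : ℕ → Ω → ℝ → ℝ}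

theorem BandwidthCondition.eventually_devRate_le (hh : BandwidthCondition h m p) (hp : 2 < p)
    {c : ℝ} (hc : 0 < c) : ∀ᶠ n in atTop, devRate h m n ≤ c * h n := by
  filter_upwards [hh.eventually_log_div_le hp (c := 2 / c ^ 2) (by positivity),
    hh.eventually_bandwidth hp] with n h1 h2
  have hh0 := hh.pos n
  refine Real.sqrt_le_iff.2 ⟨by positivity, ?_⟩
  have hx0 : 0 ≤ Real.log n / n := div_nonneg (Real.log_natCast_nonneg n) n.cast_nonneg
  have h3 : spread h m n ≤ 2 * h n := (spread_le_sq_add hh0).trans (by nlinarith)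
  have h4 : Real.log n / n * 2 ≤ c ^ 2 * h n := by
    rw [div_mul_eq_mul_div, div_le_iff₀ (by positivity)] at h1
    linarith
  calc Real.log n / n * spread h m n ≤ Real.log n / n * (2 * h n) := by gcongr
    _ = Real.log n / n * 2 * h n := by ring
    _ ≤ c ^ 2 * h n * h n := by gcongr
    _ = (c * h n) ^ 2 := by ring

/-- The uniform error of the estimator is of the order of the bias `h²` plus the deviations of the
interval masses, rescaled by `1 / h`. -/
theorem IsModel.ae_abs_estimator_sub_le [IsProbabilityMeasure P] [IsProbabilityMeasure Q]
    (hM : IsModel P Q a b X ζ fT T U m) (hfT : DensityCondition a b fT) (hK : KernelCondition K)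
    (hμ : MeanCondition a b (meanFun Q X)) (hp : 2 < p) (hmom : MomentCondition P Q a b X U p)
    (hh : BandwidthCondition h m p)
    (hest : IsLocalLinearEstimator a b K h m T (obs X ζ T U) μhat)
    (hexc : ∀ᵐ ω ∂P, ∃ C : ℝ, ∀ᶠ n in atTop, errorExcess h m U n ω ≤ C * devRate h m n) :
    ∀ᵐ ω ∂P, ∃ C : ℝ, 0 ≤ C ∧ ∀ᶠ n in atTop, ∀ t ∈ Set.Icc a b,
      |μhat n ω t - meanFun Q X t| ≤ C * (h n ^ 2 + devRate h m n / h n) := by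
  obtain ⟨c, C, hc, hC, hbound⟩ := exists_abs_localLinear_sub_le hM.lt hfT
    hM.isProbabilityMeasure_timeLaw hK hμ
  obtain ⟨C₁, hC₁⟩ := hM.ae_design_deviation hfT hp hh
  obtain ⟨C₂, hC₂⟩ := hM.ae_signal_deviation hfT hp hh hmom
  filter_upwards [hC₁, hC₂, hM.ae_error_sum_le hfT hp hh hmom hexc, hM.ae_time_mem]
    with ω h1 h2 ⟨C₃, h3⟩ hT
  refine ⟨C * (1 + |C₂ + C₃|), by positivity, ?_⟩
  have hba : 0 < (b - a) / 2 := by have := hM.lt; linarith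
  filter_upwards [h1, h2, h3, hh.eventually_devRate_le hp (c := c / (|C₁| + 1)) (by positivity),
    hh.tendsto_zero.eventually (gt_mem_nhds hba)] with n g1 g2 g3 g4 g5 t ht
  have hh0 := hh.pos n
  have hA0 : 0 ≤ devRate h m n := Real.sqrt_nonneg _
  obtain ⟨a₁, ha₁⟩ := hest n ω t ht
  have key := hbound (pairs n (m n)) (pairWeight n (m n)) (fun q => T q.1 q.2 ω)
    (fun q => obs X ζ T U q.1 q.2 ω) t (h n) (C₁ * devRate h m n) ((C₂ + C₃) * devRate h m n)
    (μhat n ω t) a₁ (pairWeight_nonneg _ _) (fun q _ => hT _ _) ht hh0 g5.le ?_ (g1 t ht) ?_ ?_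
  · refine key.trans ?_
    rw [mul_assoc]
    refine mul_le_mul_of_nonneg_left ?_ hC
    have e1 : (C₂ + C₃) * devRate h m n / h n ≤ |C₂ + C₃| * (devRate h m n / h n) := by
      rw [mul_div_assoc]
      exact mul_le_mul_of_nonneg_right (le_abs_self _) (by positivity)
    have e2 : 0 ≤ devRate h m n / h n := by positivity
    have e3 : 0 ≤ |C₂ + C₃| * h n ^ 2 := by positivity
    nlinarith
  · calc C₁ * devRate h m n ≤ (|C₁| + 1) * (c / (|C₁| + 1) * h n) := by
          refine mul_le_mul ?_ g4 hA0 (by positivity)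
          linarith [le_abs_self C₁]
      _ = c * h n := by field_simp
  · intro I hI hIs
    have e : ∑ q ∈ pairs n (m n), pairWeight n (m n) q *
        ((obs X ζ T U q.1 q.2 ω - meanFun Q X (T q.1 q.2 ω)) * I.indicator 1 (T q.1 q.2 ω)) =
        ∑ q ∈ pairs n (m n), pairWeight n (m n) q *
          ((X (ζ q.1 ω) (T q.1 q.2 ω) - meanFun Q X (T q.1 q.2 ω)) *
            I.indicator 1 (T q.1 q.2 ω)) +
        ∑ q ∈ pairs n (m n), pairWeight n (m n) q *
          (U q.1 q.2 ω * I.indicator 1 (T q.1 q.2 ω)) := by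
      rw [← Finset.sum_add_distrib]
      refine Finset.sum_congr rfl fun q _ => ?_
      simp only [obs]; ring
    rw [e, add_mul]
    exact (abs_add_le _ _).trans (add_le_add (g2 t ht I hI hIs) (g3 t ht I hI hIs))
  · intro c₀ c₁
    have e : ∀ e₀ e₁ : ℝ, criterion K (h n) n (m n) (fun i j => T i j ω)
        (fun i j => obs X ζ T U i j ω) t (e₀, e₁) =
        ∑ q ∈ pairs n (m n), pairWeight n (m n) q *
          ((obs X ζ T U q.1 q.2 ω - e₀ - e₁ * (T q.1 q.2 ω - t)) ^ 2 *
            scaledKernel K (h n) (T q.1 q.2 ω - t)) := by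
      intro e₀ e₁
      rw [sum_pairs, criterion, Finset.mul_sum]
      exact Finset.sum_congr rfl fun i _ => (mul_assoc _ _ _).symm
    have := ha₁ (Set.mem_univ (c₀, c₁))
    simp only [Set.mem_ofPred_eq] at this
    rw [e, e] at this
    exact this

theorem uniformRateAS_of_abs_le {μ : ℝ → ℝ} {r s : ℕ → ℝ}
    (hr : ∀ᵐ ω ∂P, ∃ C : ℝ, 0 ≤ C ∧ ∀ᶠ n in atTop, ∀ t ∈ Set.Icc a b,
      |μhat n ω t - μ t| ≤ C * s n)
    (hsr : ∃ C : ℝ, ∀ᶠ n in atTop, s n ≤ C * r n) : UniformRateAS P a b μhat μ r := by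
  obtain ⟨C', hC'⟩ := hsr
  filter_upwards [hr] with ω ⟨C, hC, h1⟩
  refine ⟨C * C', ?_⟩
  filter_upwards [h1, hC'] with n h2 h3
  refine iSup₂_le fun t ht => ?_
  rw [Real.enorm_eq_ofReal_abs]
  refine ENNReal.ofReal_le_ofReal ((h2 t ht).trans ?_)
  rw [mul_assoc]
  gcongr

end Rate

end FunctionalData


theorem corollary3p2 {Ω Ξ : Type*} [MeasurableSpace Ω] [MeasurableSpace Ξ]
    (P : Measure Ω) [IsProbabilityMeasure P] (Q : Measure Ξ) [IsProbabilityMeasure Q]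
    (a b : ℝ) (X : Ξ → ℝ → ℝ) (ζ : ℕ → Ω → Ξ) (fT : ℝ → ℝ) (T U : ℕ → ℕ → Ω → ℝ)
    (m : ℕ → ℕ → ℕ) (K : ℝ → ℝ) (h : ℕ → ℝ) (p : ℝ) (μhat : ℕ → Ω → ℝ → ℝ)
    (hmodel : FunctionalData.IsModel P Q a b X ζ fT T U m)
    (hfT : FunctionalData.DensityCondition a b fT)
    (hK : FunctionalData.KernelCondition K)
    (hμ : FunctionalData.MeanCondition a b (FunctionalData.meanFun Q X))
    (hp : 2 < p)
    (hmoment : FunctionalData.MomentCondition P Q a b X U p)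
    (hh : FunctionalData.BandwidthCondition h m p)
    (hμhat : FunctionalData.IsLocalLinearEstimator a b K h m T
      (FunctionalData.obs X ζ T U) μhat) :
    (∀ M : ℕ, (∀ n i, i < n → m n i ≤ M) →
      FunctionalData.UniformRateAS P a b μhat (FunctionalData.meanFun Q X)
        (fun n => h n ^ 2 + Real.sqrt (Real.log n / (n * h n)))) ∧
    (∀ M : ℕ → ℝ, (∀ n, 0 < M n) → (∀ n i, i < n → M n ≤ m n i) →
      (fun n => (M n)⁻¹) =O[atTop] h →
      h =O[atTop] (fun n : ℕ => (Real.log n / n) ^ (1 / 4 : ℝ)) →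
      FunctionalData.UniformRateAS P a b μhat (FunctionalData.meanFun Q X)
        (fun n => Real.sqrt (Real.log n / n))) := by
  have hx0 : ∀ n : ℕ, 0 ≤ Real.log n / n := fun n =>
    div_nonneg (Real.log_natCast_nonneg n) n.cast_nonneg
  refine ⟨fun M hM => ?_, fun M hM0 hM hMh hO => ?_⟩
  · refine FunctionalData.uniformRateAS_of_abs_le
      (hmodel.ae_abs_estimator_sub_le hfT hK hμ hp hmoment hh hμhat
        (hmodel.ae_errorExcess_le_of_le hp hh hmoment hM)) ⟨2, ?_⟩
    filter_upwards [hh.eventually_bandwidth hp, eventually_gt_atTop 0] with n hbw hn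
    have hn' : (0 : ℝ) < n := Nat.cast_pos.2 hn
    have hh0 := hh.pos n
    have h1 : FunctionalData.spread h m n ≤ 2 * h n :=
      (FunctionalData.spread_le_sq_add hh0).trans (by nlinarith [hbw.2])
    have h2 : FunctionalData.devRate h m n / h n ≤
        2 * Real.sqrt (Real.log n / (n * h n)) := by
      rw [div_le_iff₀ hh0]
      refine Real.sqrt_le_iff.2 ⟨by positivity, ?_⟩
      have hy0 : 0 ≤ Real.log n / (n * h n) :=
        div_nonneg (Real.log_natCast_nonneg n) (by positivity)
      rw [mul_pow, mul_pow, Real.sq_sqrt hy0]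
      have e : 2 ^ 2 * (Real.log n / (n * h n)) * h n ^ 2 = Real.log n / n * (4 * h n) := by
        field_simp
        ring
      rw [e]
      have := hx0 n
      gcongr
      linarith
    have h3 : 0 ≤ h n ^ 2 := sq_nonneg _
    linarith
  · obtain ⟨c, hc, hdense⟩ := hh.exists_dense hM0 hM hMh
    have hp4 : 4 < p := hh.four_lt hp hc (hdense.mono fun n hn => hn.2) hO
    obtain ⟨d, hd, hdb⟩ := hO.exists_pos
    refine FunctionalData.uniformRateAS_of_abs_le
      (hmodel.ae_abs_estimator_sub_le hfT hK hμ hp hmoment hh hμhat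
        (hmodel.ae_errorExcess_le_of_dense hp4 hh hmoment hc hdense)) ⟨d ^ 2 + (1 + c), ?_⟩
    filter_upwards [hdense, hdb.bound] with n hn hdn
    have hh0 := hh.pos n
    have hx := hx0 n
    rw [Real.norm_of_nonneg hh0.le, Real.norm_of_nonneg (by positivity)] at hdn
    have h1 : h n ^ 2 ≤ d ^ 2 * Real.sqrt (Real.log n / n) := by
      have h2 := pow_le_pow_left₀ hh0.le hdn 2
      rw [mul_pow, ← Real.rpow_natCast ((Real.log n / n) ^ (1 / 4 : ℝ)) 2,
        ← Real.rpow_mul hx] at h2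
      rw [Real.sqrt_eq_rpow]
      convert! h2 using 3
      norm_num
    have h2 : FunctionalData.devRate h m n / h n ≤
        (1 + c) * Real.sqrt (Real.log n / n) := by
      rw [div_le_iff₀ hh0]
      refine Real.sqrt_le_iff.2 ⟨by positivity, ?_⟩
      rw [mul_pow, mul_pow, Real.sq_sqrt hx]
      calc Real.log n / n * FunctionalData.spread h m n
          ≤ Real.log n / n * ((1 + c) * h n ^ 2) := by gcongr; exact hn.2
        _ ≤ Real.log n / n * ((1 + c) ^ 2 * h n ^ 2) := by
            gcongr
            nlinarith
        _ = _ := by ring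
    linarith
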